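/- Let $E$ be a real Banach space, $\gamma$ a centred Gaussian Radon measure on $E$, $\nu$ a Radon Lévy measure on $E$ and $\xi\in E$. Let $\pi=\delta_\xi*\tilde e_{\rm s}(\nu)$, where $\tilde e_{\rm s}(\nu)$ is the Radon probability measure on $E$ with characteristic functional $$x^*\mapsto\exp\Big(\int_E \big(e^{i\langle x,x^*\rangle}-1-i\langle x,x^*\rangle \mathbf 1_{\{\|x\|\le 1\}}\big)\,d\nu(x)\Big).$$ (A Lévy measure is a Borel measure $\nu$ with $\nu(\{0\})=0$, with finite Radon restrictions to the sets $\{\|x\|>\delta\}$, $\delta>0$, with $\int_{\{\|x\|\le1\}}\langle x,x^*\rangle^2\,d\nu(x)<\infty$ for all $x^*\in E^*$, and for which such a Radon probability measure exists.) Let $H_\gamma\subseteq E$ be the reproducing kernel Hilbert space of $\gamma$ and $\phi:H_\gamma\to L^2(\gamma)$, $h\mapsto\phi_h$, the isometry onto the first Wiener–Itô chaos. Consider * the Gaussian derivative $D_\gamma f=\sum_{i=1}^N\partial_i g(\phi_{h_1},\dots,\phi_{h_N})\otimes h_i$, from $L^2(\gamma)$ to $L^2(\gamma;H_\gamma)$,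 on cylindrical functions $f=g(\phi_{h_1},\dots,\phi_{h_N})$ with $g\in C_{\rm b}^1(\mathbb R^N)$ and $h_1,\dots,h_N\in H_\gamma$; * the Poissonian derivative $D_\pi f(x,y)=f(x+y)-f(x)$, from $L^2(\pi)$ to $L^2(\pi\times\nu)$, on all $f\in L^2(\pi)$ with $D_\pi f\in L^2(\pi\times\nu)$. Both are well defined and closable; denote their closures again by $D_\gamma$ and $D_\pi$, with domains $\mathsf D(D_\gamma)$ and $\mathsf D(D_\pi)$. For $n\ge0$ let $$\mathcal H_n=\bigoplus_{j+k=n}H_\gamma^{\odot j}\,\widehat\otimes\,L^2(\nu)^{\odot k},$$ where $\widehat\otimes$ is the Hilbert space tensor product, $G^{\odot 0}=\mathbb R$, and $G^{\odot j}\subseteq G^{\widehat\otimes j}$ is the closed subspace of symmetric tensors. For $h\in G$ and $s\in G^{\odot j}$ let $h\odot s\in G^{\odot(j+1)}$ be the symmetrisation (orthogonal projection) of $h\otimes s$. For $s\in H_\gamma^{\odot j}$ and $t\in L^2(\nu)^{\odot k}$ with $j+k=n$, put $$(D_\gamma\otimes I)\big(f\otimes g\otimes(s\otimes t)\big)(x,y)=g(y)\,\big(D_\gamma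 f(x)\odot s\big)\otimes t\qquad(f\in\mathsf D(D_\gamma),\ g\in L^2(\pi)),$$ $$(I\otimes D_\pi)\big(f\otimes g\otimes(s\otimes t)\big)(x,y)=f(x)\,s\otimes\big(D_\pi g(y,\cdot)\odot t\big)\qquad(f\in L^2(\gamma),\ g\in\mathsf D(D_\pi)),$$ and extend both linearly to operators from $L^2(\gamma\times\pi;\mathcal H_n)$ to $L^2(\gamma\times\pi;\mathcal H_{n+1})$. Then for every $n\ge0$ these two operators are well defined and closable. Denote their closures again by $D_\gamma\otimes I$ and $I\otimes D_\pi$, and let $$D=D_\gamma\otimes I+I\otimes D_\pi$$ on the intersection of the domains of the two closures. The domain of $D$ contains the linear span of all $f\otimes g\otimes(s\otimes t)$ with $f\in\mathsf D(D_\gamma)$, $g\in\mathsf D(D_\pi)$, $s\in H_\gamma^{\odot j}$, $t\in L^2(\nu)^{\odot k}$, $j+k=n$; this span is dense in $L^2(\gamma\times\pi;\mathcal H_n)$. Consequently $D$ is densely defined, and moreover $D$ is closable as an operator from $L^2(\gamma\times\pi;\mathcal H_n)$ to $L^2(\gamma\times\pi;\mathcal H_{n+1})$. -/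

import Mathlib

open MeasureTheory ProbabilityTheory
open scoped TensorProduct ENNReal

noncomputable section

universe u

namespace SecondQuantisation

/-! ## Hilbert space tensor products and symmetric powers -/

section Tensor

variable (H K : Type u) [NormedAddCommGroup H] [InnerProductSpace ℝ H]
  [NormedAddCommGroup K] [InnerProductSpace ℝ K]

/-- The Hilbert space tensor product: the completion of the algebraic tensor product with
respect to the inner product determined by `⟪x ⊗ y, x' ⊗ y'⟫ = ⟪x, x'⟫ * ⟪y, y'⟫`. -/
def HilbertTensor : Type u :=
  UniformSpace.Completion (H ⊗[ℝ] K)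

instance instNormedAddCommGroupHilbertTensor : NormedAddCommGroup (HilbertTensor H K) :=
  inferInstanceAs (NormedAddCommGroup (UniformSpace.Completion (H ⊗[ℝ] K)))

instance instInnerProductSpaceHilbertTensor : InnerProductSpace ℝ (HilbertTensor H K) :=
  inferInstanceAs (InnerProductSpace ℝ (UniformSpace.Completion (H ⊗[ℝ] K)))

instance instCompleteSpaceHilbertTensor : CompleteSpace (HilbertTensor H K) :=
  inferInstanceAs (CompleteSpace (UniformSpace.Completion (H ⊗[ℝ] K)))

variable {H K} in
/-- The elementary tensor `x ⊗ y` in the Hilbert space tensor product. -/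
def tens (x : H) (y : K) : HilbertTensor H K :=
  ((x ⊗ₜ[ℝ] y : H ⊗[ℝ] K) : UniformSpace.Completion (H ⊗[ℝ] K))

/-- A bundled real Hilbert space, used only to define tensor powers by recursion. -/
structure BundledHilbert : Type (u + 1) where
  carrier : Type u
  [normed : NormedAddCommGroup carrier]
  [ips : InnerProductSpace ℝ carrier]
  [complete : CompleteSpace carrier]

attribute [instance] BundledHilbert.normed BundledHilbert.ips BundledHilbert.complete

/-- The real line, lifted to the universe `u`, as a Hilbert space. -/
def liftedReal : BundledHilbert.{u} :=
  letI : InnerProductSpace ℝ (ULift.{u} ℝ) :=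
    { inner := fun x y => x.down * y.down
      norm_sq_eq_re_inner := fun x => by
        change ‖x.down‖ ^ 2 = x.down * x.down
        rw [Real.norm_eq_abs, sq_abs, sq]
      conj_inner_symm := fun x y => by simp [mul_comm]
      add_left := fun x y z => by simp [add_mul]
      smul_left := fun x y r => by simp [mul_assoc] }
  ⟨ULift.{u} ℝ⟩

/-- `H^{⊗ 0} = ℝ` and `H^{⊗ (n+1)} = H ⊗ H^{⊗ n}`. -/
def tensorPowBundled : ℕ → BundledHilbert.{u}
  | 0 => liftedReal
  | n + 1 => ⟨HilbertTensor H (tensorPowBundled n).carrier⟩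

/-- The Hilbert space tensor power `H^{⊗ n}`. -/
abbrev TensorPow (n : ℕ) : Type u := (tensorPowBundled H n).carrier

variable {H} in
/-- The tensor `h ⊗ t` in `H^{⊗ (n+1)}`, for `h` in `H` and `t` in `H^{⊗ n}`. -/
def tensCons {n : ℕ} (h : H) (t : TensorPow H n) : TensorPow H (n + 1) :=
  tens h t

variable {H} in
/-- The diagonal tensor `h^{⊗ n} = h ⊗ ⋯ ⊗ h`. -/
def diagTens (h : H) : (n : ℕ) → TensorPow H n
  | 0 => (ULift.up (1 : ℝ) : ULift.{u} ℝ)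
  | n + 1 => tensCons h (diagTens h n)

/-- The symmetric power `H^{⊙ n}`, as a closed subspace of `H^{⊗ n}`. By polarisation, the
symmetric tensors are the closed linear span of the diagonal tensors `h^{⊗ n}`. -/
def symSubspace (n : ℕ) : Submodule ℝ (TensorPow H n) :=
  (Submodule.span ℝ (Set.range fun h : H => diagTens h n)).topologicalClosure

/-- The symmetric power `H^{⊙ n}`, as a type. -/
def SymPow (n : ℕ) : Type u := symSubspace H n

instance instNormedAddCommGroupSymPow (n : ℕ) : NormedAddCommGroup (SymPow H n) :=
  inferInstanceAs (NormedAddCommGroup (symSubspace H n))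

instance instInnerProductSpaceSymPow (n : ℕ) : InnerProductSpace ℝ (SymPow H n) :=
  inferInstanceAs (InnerProductSpace ℝ (symSubspace H n))

instance instCompleteSpaceSymSubspace (n : ℕ) : CompleteSpace (symSubspace H n) :=
  Submodule.topologicalClosure.completeSpace _

instance instCompleteSpaceSymPow (n : ℕ) : CompleteSpace (SymPow H n) :=
  instCompleteSpaceSymSubspace H n

variable {H} in
/-- The inclusion of `H^{⊙ n}` into `H^{⊗ n}`. -/
def symIncl (n : ℕ) : SymPow H n →ₗᵢ[ℝ] TensorPow H n := (symSubspace H n).subtypeₗᵢ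

variable {H} in
/-- The symmetric product `h ⊙ t` in `H^{⊙ (n+1)}`, for `h` in `H` and `t` in `H^{⊙ n}`: the
image of `h ⊗ t` under the orthogonal projection onto the symmetric tensors (this projection
is the symmetrisation of tensors). -/
def symMul {n : ℕ} (h : H) (t : SymPow H n) : SymPow H (n + 1) :=
  (symSubspace H (n + 1)).orthogonalProjectionOnto (tensCons h (symIncl n t))

/-- The Hilbert space `⨁_{j + k = n} H^{⊙ j} ⊗ K^{⊙ k}`. -/
def ChaosSpace (n : ℕ) : Type u :=
  PiLp 2 fun p : Finset.HasAntidiagonal.antidiagonal n =>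
    HilbertTensor (SymPow H p.1.1) (SymPow K p.1.2)

instance instNormedAddCommGroupChaosSpace (n : ℕ) : NormedAddCommGroup (ChaosSpace H K n) :=
  inferInstanceAs (NormedAddCommGroup (PiLp 2 fun p : Finset.HasAntidiagonal.antidiagonal n =>
    HilbertTensor (SymPow H p.1.1) (SymPow K p.1.2)))

instance instInnerProductSpaceChaosSpace (n : ℕ) : InnerProductSpace ℝ (ChaosSpace H K n) :=
  inferInstanceAs (InnerProductSpace ℝ (PiLp 2 fun p : Finset.HasAntidiagonal.antidiagonal n =>
    HilbertTensor (SymPow H p.1.1) (SymPow K p.1.2)))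

instance instCompleteSpaceChaosSpace (n : ℕ) : CompleteSpace (ChaosSpace H K n) :=
  inferInstanceAs (CompleteSpace (PiLp 2 fun p : Finset.HasAntidiagonal.antidiagonal n =>
    HilbertTensor (SymPow H p.1.1) (SymPow K p.1.2)))

variable {H K} in
/-- The vector `s ⊗ t`, for `s` in `H^{⊙ j}` and `t` in `K^{⊙ k}`, as an element of the summand
`(j, k)` of the direct sum `⨁_{j + k = n} H^{⊙ j} ⊗ K^{⊙ k}`. -/
def chaosTens {n : ℕ} (j k : ℕ) (hjk : j + k = n) (s : SymPow H j) (t : SymPow K k) :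
    ChaosSpace H K n :=
  PiLp.single 2
    (β := fun p : Finset.HasAntidiagonal.antidiagonal n =>
      HilbertTensor (SymPow H p.1.1) (SymPow K p.1.2))
    ⟨(j, k), Finset.HasAntidiagonal.mem_antidiagonal.mpr hjk⟩ (tens s t)

end Tensor

/-! ## Unbounded operators given by their graphs -/

section Graph

variable {X Y : Type*} [NormedAddCommGroup X] [NormedSpace ℝ X]
  [NormedAddCommGroup Y] [NormedSpace ℝ Y]

/-- The subspace `G` of `X × Y` is the graph of a (well-defined) closable linear operator: its
closure is the graph of an operator. -/
def IsClosableGraph (G : Submodule ℝ (X × Y)) : Prop :=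
  ∀ p ∈ G.topologicalClosure, p.1 = 0 → p.2 = 0

/-- The closure of the closable operator with graph `G`. -/
def closedOperator (G : Submodule ℝ (X × Y)) : X →ₗ.[ℝ] Y :=
  G.topologicalClosure.toLinearPMap

/-- If `G` is a closable graph, the graph of `closedOperator G` is the closure of `G`. -/
theorem closedOperator_graph {G : Submodule ℝ (X × Y)} (hG : IsClosableGraph G) :
    (closedOperator G).graph = G.topologicalClosure :=
  Submodule.toLinearPMap_graph_eq _ hG

end Graph

variable {E : Type u} [NormedAddCommGroup E] [NormedSpace ℝ E] [MeasurableSpace E]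

/-! ## Lévy measures and generalised exponentials -/

section Levy

/-- The Lévy–Khintchine exponent without Gaussian part and without drift,
`∫ (exp(i⟨x, x*⟩) - 1 - i⟨x, x*⟩ 1_{‖x‖ ≤ 1}) dν(x)`. -/
def levyExponent (ν : Measure E) (L : StrongDual ℝ E) : ℂ :=
  ∫ x, (Complex.exp (Complex.I * (L x : ℂ)) - 1
    - (Metric.closedBall (0 : E) 1).indicator (fun y => Complex.I * (L y : ℂ)) x) ∂ν

/-- `μ` is a Radon probability measure with characteristic functional `exp (levyExponent ν)`. -/
structure IsGeneralisedExponential (ν μ : Measure E) : Prop where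
  isProbabilityMeasure : IsProbabilityMeasure μ
  radon : μ.InnerRegular
  charFunDual_eq : ∀ L : StrongDual ℝ E, charFunDual μ L = Complex.exp (levyExponent ν L)

/-- Radon Lévy measures on a Banach space. -/
structure IsLevyMeasure (ν : Measure E) : Prop where
  zero : ν {0} = 0
  finite_away : ∀ δ : ℝ, 0 < δ → ν {x | δ < ‖x‖} < ∞
  radon_away : ∀ δ : ℝ, 0 < δ → (ν.restrict {x | δ < ‖x‖}).InnerRegular
  sq_near_zero : ∀ L : StrongDual ℝ E, ∫⁻ x in Metric.closedBall 0 1, ‖L x‖ₑ ^ 2 ∂ν < ∞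
  exists_exponential : ∃ μ : Measure E, IsGeneralisedExponential ν μ

open Classical in
/-- The generalised exponential of a Lévy measure `ν`: the unique Radon probability measure with
characteristic functional `exp (levyExponent ν)`. -/
def generalisedExponential (ν : Measure E) : Measure E :=
  if h : ∃ μ : Measure E, IsGeneralisedExponential ν μ then h.choose else 0

theorem isGeneralisedExponential {ν : Measure E} (hν : IsLevyMeasure ν) :
    IsGeneralisedExponential ν (generalisedExponential ν) := by
  unfold generalisedExponential
  rw [dif_pos hν.exists_exponential]
  exact hν.exists_exponential.choose_spec

/-- The measure `π = δ_ξ * ẽ(ν)`, i.e. the translate over `ξ` of the generalised exponential. -/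
def jumpMeasure (ξ : E) (ν : Measure E) : Measure E :=
  (generalisedExponential ν).map fun x => ξ + x

end Levy

/-! ## The reproducing kernel Hilbert space of a Gaussian measure -/

section RKHS

/-- The first Wiener–Itô chaos of `γ`: the closure in `L²(γ)` of the continuous linear
functionals. -/
def firstChaos (γ : Measure E) : Submodule ℝ (Lp ℝ 2 γ) :=
  (Submodule.span ℝ {F : Lp ℝ 2 γ | ∃ L : StrongDual ℝ E, F =ᵐ[γ] L}).topologicalClosure

variable [BorelSpace E] (γ : Measure E) [IsGaussian γ]

/-- `w = φ_h`: `w` belongs to the first chaos and `h = ∫ w(x) x dγ(x)` as a weak integral. -/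
def IsChaosOf (h : E) (w : Lp ℝ 2 γ) : Prop :=
  w ∈ firstChaos γ ∧ ∀ L : StrongDual ℝ E, ∫ x, w x * L x ∂γ = L h

theorem inner_toLp (w : Lp ℝ 2 γ) (L : StrongDual ℝ E) (F : Lp ℝ 2 γ) (hF : F =ᵐ[γ] L) :
    inner ℝ F w = ∫ x, w x * L x ∂γ := by
  rw [L2.inner_def]
  refine integral_congr_ae ?_
  filter_upwards [hF] with x hx
  simp [hx]

variable {γ}

theorem IsChaosOf.unique {h : E} {w w' : Lp ℝ 2 γ} (hw : IsChaosOf γ h w)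
    (hw' : IsChaosOf γ h w') : w = w' := by
  have hmem : w - w' ∈ firstChaos γ := sub_mem hw.1 hw'.1
  have horth : firstChaos γ ≤ (ℝ ∙ (w - w'))ᗮ := by
    refine Submodule.topologicalClosure_minimal _ ?_ (Submodule.isClosed_orthogonal _)
    rw [Submodule.span_le]
    rintro F ⟨L, hF⟩
    rw [SetLike.mem_coe, Submodule.mem_orthogonal_singleton_iff_inner_left, inner_sub_right,
      inner_toLp γ w L F hF, inner_toLp γ w' L F hF, hw.2 L, hw'.2 L, sub_self]
  have h0 := horth hmem
  rw [Submodule.mem_orthogonal_singleton_iff_inner_left] at h0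
  exact sub_eq_zero.mp (inner_self_eq_zero.mp h0)

theorem integrable_mul_dual (w : Lp ℝ 2 γ) (L : StrongDual ℝ E) :
    Integrable (fun x => w x * L x) γ :=
  (Lp.memLp w).integrable_mul (IsGaussian.memLp_dual γ L 2 (by simp))

theorem IsChaosOf.add {h h' : E} {w w' : Lp ℝ 2 γ} (hw : IsChaosOf γ h w)
    (hw' : IsChaosOf γ h' w') : IsChaosOf γ (h + h') (w + w') := by
  refine ⟨add_mem hw.1 hw'.1, fun L => ?_⟩
  rw [map_add, ← hw.2 L, ← hw'.2 L,
    ← integral_add (integrable_mul_dual w L) (integrable_mul_dual w' L)]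
  refine integral_congr_ae ?_
  filter_upwards [Lp.coeFn_add w w'] with x hx
  rw [hx, Pi.add_apply, add_mul]

theorem IsChaosOf.smul {h : E} {w : Lp ℝ 2 γ} (c : ℝ) (hw : IsChaosOf γ h w) :
    IsChaosOf γ (c • h) (c • w) := by
  refine ⟨Submodule.smul_mem _ c hw.1, fun L => ?_⟩
  rw [map_smul, ← hw.2 L, smul_eq_mul, ← integral_const_mul]
  refine integral_congr_ae ?_
  filter_upwards [Lp.coeFn_smul c w] with x hx
  rw [hx, Pi.smul_apply, smul_eq_mul, mul_assoc]

theorem IsChaosOf.zero : IsChaosOf γ (0 : E) (0 : Lp ℝ 2 γ) := by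
  refine ⟨zero_mem _, fun L => ?_⟩
  rw [map_zero, ← integral_zero E ℝ (μ := γ)]
  refine integral_congr_ae ?_
  filter_upwards [Lp.coeFn_zero ℝ 2 γ] with x hx
  rw [hx, Pi.zero_apply, zero_mul]

variable (γ)

/-- The reproducing kernel Hilbert space `H_γ` of `γ`, as a linear subspace of `E`. -/
def rkhsSubspace : Submodule ℝ E where
  carrier := {h | ∃ w, IsChaosOf γ h w}
  add_mem' := fun ⟨w, hw⟩ ⟨w', hw'⟩ => ⟨w + w', hw.add hw'⟩
  zero_mem' := ⟨0, IsChaosOf.zero⟩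
  smul_mem' := fun c _ ⟨w, hw⟩ => ⟨c • w, hw.smul c⟩

/-- The reproducing kernel Hilbert space `H_γ` of `γ`, as a type. Its norm is not the norm of
`E`, but the one that makes `h ↦ φ_h` isometric. -/
def RKHS : Type u := rkhsSubspace γ

instance instAddCommGroupRKHS : AddCommGroup (RKHS γ) :=
  inferInstanceAs (AddCommGroup (rkhsSubspace γ))

instance instModuleRKHS : Module ℝ (RKHS γ) :=
  inferInstanceAs (Module ℝ (rkhsSubspace γ))

/-- The inclusion of `H_γ` into `E`. -/
def rkhsIncl : RKHS γ →ₗ[ℝ] E := (rkhsSubspace γ).subtype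

theorem exists_isChaosOf (h : RKHS γ) : ∃ w, IsChaosOf γ (rkhsIncl γ h) w := h.2

/-- The map `φ : H_γ → L²(γ)`, `h ↦ φ_h`, as a linear map. -/
def chaosMap : RKHS γ →ₗ[ℝ] Lp ℝ 2 γ where
  toFun h := (exists_isChaosOf γ h).choose
  map_add' h h' := by
    refine (exists_isChaosOf γ (h + h')).choose_spec.unique ?_
    rw [map_add]
    exact (exists_isChaosOf γ h).choose_spec.add (exists_isChaosOf γ h').choose_spec
  map_smul' c h := by
    refine (exists_isChaosOf γ (c • h)).choose_spec.unique ?_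
    rw [map_smul]
    exact (exists_isChaosOf γ h).choose_spec.smul c

theorem isChaosOf_chaosMap (h : RKHS γ) : IsChaosOf γ (rkhsIncl γ h) (chaosMap γ h) :=
  (exists_isChaosOf γ h).choose_spec

theorem chaosMap_injective : Function.Injective (chaosMap γ) := by
  rw [← LinearMap.ker_eq_bot, LinearMap.ker_eq_bot']
  intro h hh
  have h1 := isChaosOf_chaosMap γ h
  rw [hh] at h1
  have h2 : rkhsIncl γ h = 0 := by
    rw [SeparatingDual.eq_zero_iff_forall_dual_eq_zero (R := ℝ)]
    intro L
    rw [← h1.2 L, ← (IsChaosOf.zero (γ := γ)).2 L |>.trans (map_zero L)]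
  exact Subtype.ext h2

instance instNormedAddCommGroupRKHS : NormedAddCommGroup (RKHS γ) :=
  NormedAddCommGroup.induced (RKHS γ) (Lp ℝ 2 γ) (chaosMap γ) (chaosMap_injective γ)

instance instInnerProductSpaceRKHS : InnerProductSpace ℝ (RKHS γ) :=
  InnerProductSpace.induced (chaosMap γ)

/-- The isometry `φ : H_γ → L²(γ)`, `h ↦ φ_h`. -/
def chaosIsometry : RKHS γ →ₗᵢ[ℝ] Lp ℝ 2 γ where
  toLinearMap := chaosMap γ
  norm_map' _ := rfl

end RKHS

/-! ## The Gaussian and the Poissonian derivative -/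

section Derivatives

/-- The functions of class `C_b^1`: continuously differentiable, bounded, with bounded
derivative. -/
def IsCb1 {N : ℕ} (g : (Fin N → ℝ) → ℝ) : Prop :=
  ContDiff ℝ 1 g ∧ ∃ C : ℝ, ∀ t, |g t| ≤ C ∧ ‖fderiv ℝ g t‖ ≤ C

/-- The graph of the Gaussian derivative on cylindrical functions
`f = g(φ_{h_1}, …, φ_{h_N})`, namely `D_γ f = ∑ ∂_i g(φ_{h_1}, …, φ_{h_N}) ⊗ h_i`. -/
def gaussianGraph [BorelSpace E] (γ : Measure E) [IsGaussian γ] :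
    Submodule ℝ (Lp ℝ 2 γ × Lp (RKHS γ) 2 γ) :=
  Submodule.span ℝ {p | ∃ (N : ℕ) (g : (Fin N → ℝ) → ℝ) (h : Fin N → RKHS γ), IsCb1 g ∧
    p.1 =ᵐ[γ] (fun x => g fun i => chaosIsometry γ (h i) x) ∧
    p.2 =ᵐ[γ] fun x => ∑ i, fderiv ℝ g (fun i => chaosIsometry γ (h i) x) (Pi.single i 1) • h i}

/-- The Gaussian derivative `D_γ`, as a closed operator from `L²(γ)` to `L²(γ; H_γ)`. -/
def gaussianDerivative [BorelSpace E] (γ : Measure E) [IsGaussian γ] :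
    Lp ℝ 2 γ →ₗ.[ℝ] Lp (RKHS γ) 2 γ :=
  closedOperator (gaussianGraph γ)

/-- The graph of the Poissonian derivative `D_π f (x, y) = f(x + y) - f(x)`, defined for all `f`
in `L²(π)` for which `D_π f` belongs to `L²(π × ν)`. -/
def poissonGraph (π ν : Measure E) : Submodule ℝ (Lp ℝ 2 π × Lp ℝ 2 (π.prod ν)) :=
  Submodule.span ℝ {p | ∃ f : E → ℝ, p.1 =ᵐ[π] f ∧
    p.2 =ᵐ[π.prod ν] fun z => f (z.1 + z.2) - f z.1}

/-- The Poissonian derivative `D_π`, as a closed operator from `L²(π)` to `L²(π × ν)`. -/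
def poissonDerivative (π ν : Measure E) : Lp ℝ 2 π →ₗ.[ℝ] Lp ℝ 2 (π.prod ν) :=
  closedOperator (poissonGraph π ν)

end Derivatives

/-! ## The operators `D_γ ⊗ I`, `I ⊗ D_π` and their sum -/

section Sum

variable [BorelSpace E] (γ : Measure E) [IsGaussian γ] (π ν : Measure E)

/-- The Hilbert space `𝓗_n = ⨁_{j + k = n} H_γ^{⊙ j} ⊗ L²(ν)^{⊙ k}`. -/
abbrev Chaos (n : ℕ) : Type u := ChaosSpace (RKHS γ) (Lp ℝ 2 ν) n

/-- The function space `L²(γ × π; 𝓗_n)`. -/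
abbrev L2Chaos (n : ℕ) : Type u := Lp (Chaos γ ν n) 2 (γ.prod π)

/-- The graph of `D_γ ⊗ I` on the algebraic tensor product of the domain of `D_γ`, `L²(π)` and
`𝓗_n`: it maps `f ⊗ g ⊗ (s ⊗ t)`, with `s` in `H_γ^{⊙ j}` and `t` in `L²(ν)^{⊙ k}`, to
`(x, y) ↦ g(y) (D_γ f(x) ⊙ s) ⊗ t`. -/
def gaussianTensorGraph (n : ℕ) : Submodule ℝ (L2Chaos γ π ν n × L2Chaos γ π ν (n + 1)) :=
  Submodule.span ℝ {p | ∃ (f : (gaussianDerivative γ).domain) (g : Lp ℝ 2 π) (j k : ℕ)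
    (hjk : j + k = n) (s : SymPow (RKHS γ) j) (t : SymPow (Lp ℝ 2 ν) k),
    p.1 =ᵐ[γ.prod π] (fun z => ((f : Lp ℝ 2 γ) z.1 * g z.2) • chaosTens j k hjk s t) ∧
    p.2 =ᵐ[γ.prod π] fun z => g z.2 •
      chaosTens (j + 1) k (by omega) (symMul (gaussianDerivative γ f z.1) s) t}

/-- The graph of `I ⊗ D_π` on the algebraic tensor product of `L²(γ)`, the domain of `D_π` and
`𝓗_n`: it maps `f ⊗ g ⊗ (s ⊗ t)`, with `s` in `H_γ^{⊙ j}` and `t` in `L²(ν)^{⊙ k}`, to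
`(x, y) ↦ f(x) s ⊗ (D_π g(y, ·) ⊙ t)`. Here `G` is the element of `L²(π; L²(ν))` that corresponds
to `D_π g` under the identification `L²(π × ν) = L²(π; L²(ν))`. -/
def poissonTensorGraph (n : ℕ) : Submodule ℝ (L2Chaos γ π ν n × L2Chaos γ π ν (n + 1)) :=
  Submodule.span ℝ {p | ∃ (f : Lp ℝ 2 γ) (g : (poissonDerivative π ν).domain)
    (G : Lp (Lp ℝ 2 ν) 2 π) (j k : ℕ)
    (hjk : j + k = n) (s : SymPow (RKHS γ) j) (t : SymPow (Lp ℝ 2 ν) k),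
    (∀ᵐ y ∂π, G y =ᵐ[ν] fun y' => poissonDerivative π ν g (y, y')) ∧
    p.1 =ᵐ[γ.prod π] (fun z => (f z.1 * (g : Lp ℝ 2 π) z.2) • chaosTens j k hjk s t) ∧
    p.2 =ᵐ[γ.prod π] fun z => f z.1 •
      chaosTens j (k + 1) (by omega) s (symMul (G z.2) t)}

/-- `D_γ ⊗ I` as a closed operator from `L²(γ × π; 𝓗_n)` to `L²(γ × π; 𝓗_{n+1})`. -/
def gaussianTensor (n : ℕ) : L2Chaos γ π ν n →ₗ.[ℝ] L2Chaos γ π ν (n + 1) :=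
  closedOperator (gaussianTensorGraph γ π ν n)

/-- `I ⊗ D_π` as a closed operator from `L²(γ × π; 𝓗_n)` to `L²(γ × π; 𝓗_{n+1})`. -/
def poissonTensor (n : ℕ) : L2Chaos γ π ν n →ₗ.[ℝ] L2Chaos γ π ν (n + 1) :=
  closedOperator (poissonTensorGraph γ π ν n)

/-- The operator `D = D_γ ⊗ I + I ⊗ D_π`, with domain the intersection of the domains of the two
closed operators `D_γ ⊗ I` and `I ⊗ D_π`. -/
def totalDerivative (n : ℕ) : L2Chaos γ π ν n →ₗ.[ℝ] L2Chaos γ π ν (n + 1) :=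
  gaussianTensor γ π ν n + poissonTensor γ π ν n

/-- The natural domain of `D`: the linear span of all `f ⊗ g ⊗ (s ⊗ t)` with `f` in the domain
of `D_γ`, `g` in the domain of `D_π`, `s` in `H_γ^{⊙ j}`, `t` in `L²(ν)^{⊙ k}`, `j + k = n`. -/
def naturalDomain (n : ℕ) : Submodule ℝ (L2Chaos γ π ν n) :=
  Submodule.span ℝ {F | ∃ (f : (gaussianDerivative γ).domain) (g : (poissonDerivative π ν).domain)
    (j k : ℕ) (hjk : j + k = n) (s : SymPow (RKHS γ) j) (t : SymPow (Lp ℝ 2 ν) k),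
    F =ᵐ[γ.prod π] fun z =>
      ((f : Lp ℝ 2 γ) z.1 * (g : Lp ℝ 2 π) z.2) • chaosTens j k hjk s t}

end Sum

end SecondQuantisation

end

open SecondQuantisation

/-!
All closability statements are proved by duality. If `G` is a linear relation between Hilbert
spaces and the test vectors `y` for which `p ↦ ⟪p.2, y⟫` is on `G` of the form `p ↦ ⟪p.1, x⟫` are
dense, then `G` is closable (`isClosableGraph_of_dense_adjointDomain`). Passing to the closure of
`G` does not change the test vectors, so common test vectors of two relations are test vectors of the
sum of the two closures (`isClosable_closedOperator_add`). This gives the closability of `D`, as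
soon as `D_γ ⊗ I` and `I ⊗ D_π` have a dense set of common test vectors. Such vectors are
`φ ⊗ ψ ⊗ (h ⊗ ⋯ ⊗ h) ⊗ (u ⊗ ⋯ ⊗ u)`, with `φ` and `ψ` the cosine or sine of a continuous linear
functional, `h` in `H_γ`, and `u` in `L²(ν)` bounded and vanishing near the origin. On diagonal
tensors the symmetrised product is adjoint to contraction (`inner_symMul_symDiag`), so that
everything reduces to `φ ⊗ h` being a test vector of `D_γ` and `ψ ⊗ u` being one of `D_π`.

For `D_γ` this is Gaussian integration by parts (`integral_mul_cylindrical`). Elements of the first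
chaos are jointly normal, hence the components of `φ_{h_1}, …, φ_{h_N}` orthogonal to `φ_h` are
independent of `φ_h`, and Fubini's theorem reduces the formula to dimension one.

For `D_π` one has to integrate `f (x + y) ψ(x) u(y)` against `π × ν`. This is bounded in `f` because
the law of `x + y` under `π × ν_B`, with `ν_B` the restriction of `ν` to the complement `B` of a
neighbourhood of the origin, is dominated by a measure with a square integrable density with respect
to `π` (`IsLevyMeasure.exists_map_add_le`). This consequence of the Mecke formula is obtained
without constructing a Poisson random measure. The characteristic functional of `π` is `K exp(ν̂_B)`, where
`K` is positive definite as a pointwise limit of characteristic functionals of compound Poisson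
laws, up to constants. It is not necessary to know that `K` belongs to a measure. Expanding the
exponential turns positive definiteness into a quadratic inequality
(`IsPosDefFun.quadratic_nonneg`), whose discriminant bounds `∫ f d(π * ν_B)` by the norm of `f` in
`L²(π)`, for every real trigonometric polynomial `f`. The Riesz theorem yields the density, and
uniqueness of characteristic functionals identifies the measure. The same estimate shows that
`f (x + y)` only depends on the class of `f`.

No separability of `E` is assumed. Being Radon, the measures involved are carried by a common closed
separable subspace (`IsLevyMeasure.exists_carrier`); this is needed for the measurability of
addition and for the uniqueness of characteristic functionals.

The natural domain is dense because trigonometric functions are total in `L²(γ)` and `L²(π)` and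
belong to the domains of `D_γ` and `D_π`. For `D_γ` this holds since every continuous linear
functional `L` is `φ_h` with `h = ∫ L(x) x dγ(x)`, the integral existing by Fernique's theorem,
and for `D_π` since `|cos a - cos b|` and `|sin a - sin b|` are at most `min 2 |a - b|`.
-/

noncomputable section

universe u

namespace SecondQuantisation

/-! ### Closability by means of test vectors -/

section Closability

variable {X Y : Type*} [NormedAddCommGroup X] [InnerProductSpace ℝ X]
  [NormedAddCommGroup Y] [InnerProductSpace ℝ Y]

/-- The domain of the adjoint of the linear relation `G`. No completeness is needed, since the
value of the adjoint is required to exist rather than obtained from the Riesz theorem. -/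
def adjointDomain (G : Submodule ℝ (X × Y)) : Submodule ℝ Y where
  carrier := {y | ∃ x : X, ∀ p ∈ G, inner ℝ p.2 y = inner ℝ p.1 x}
  add_mem' := by
    rintro y y' ⟨x, hx⟩ ⟨x', hx'⟩
    exact ⟨x + x', fun p hp => by rw [inner_add_right, inner_add_right, hx p hp, hx' p hp]⟩
  zero_mem' := ⟨0, fun p _ => by simp⟩
  smul_mem' := by
    rintro c y ⟨x, hx⟩
    exact ⟨c • x, fun p hp => by rw [inner_smul_right, inner_smul_right, hx p hp]⟩

theorem mem_adjointDomain_span {S : Set (X × Y)} {y : Y} (x : X)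
    (h : ∀ p ∈ S, inner ℝ p.2 y = inner ℝ p.1 x) :
    y ∈ adjointDomain (Submodule.span ℝ S) := by
  refine ⟨x, fun p hp => ?_⟩
  induction hp using Submodule.span_induction with
  | mem p hp => exact h p hp
  | zero => simp
  | add p q _ _ hp hq => simp [inner_add_left, hp, hq]
  | smul c p _ hp => simp [inner_smul_left, hp]

/-- A relation and its closure have the same adjoint. -/
theorem adjointDomain_topologicalClosure (G : Submodule ℝ (X × Y)) :
    adjointDomain G.topologicalClosure = adjointDomain G := by
  refine le_antisymm ?_ ?_
  · rintro y ⟨x, hx⟩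
    exact ⟨x, fun p hp => hx p (G.le_topologicalClosure hp)⟩
  · rintro y ⟨x, hx⟩
    refine ⟨x, fun p hp => ?_⟩
    have hcl : IsClosed {p : X × Y | inner ℝ p.2 y = inner ℝ p.1 x} :=
      isClosed_eq (by fun_prop) (by fun_prop)
    exact closure_minimal hx hcl hp

/-- A linear relation whose adjoint is densely defined is closable. -/
theorem isClosableGraph_of_dense_adjointDomain {G : Submodule ℝ (X × Y)}
    (hG : Dense (adjointDomain G : Set Y)) : IsClosableGraph G := by
  intro p hp h0
  rw [← adjointDomain_topologicalClosure] at hG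
  refine hG.eq_zero_of_inner_left ℝ fun y hy => ?_
  obtain ⟨x, hx⟩ := hy
  rw [hx p hp, h0, inner_zero_left]

theorem isClosable_of_isClosableGraph {T : X →ₗ.[ℝ] Y} (hT : IsClosableGraph T.graph) :
    T.IsClosable :=
  ⟨_, (Submodule.toLinearPMap_graph_eq _ hT).symm⟩

theorem mem_closedOperator_domain {G : Submodule ℝ (X × Y)} {p : X × Y} (hp : p ∈ G) :
    p.1 ∈ (closedOperator G).domain := by
  change p.1 ∈ G.topologicalClosure.map (LinearMap.fst ℝ X Y)
  exact ⟨p, G.le_topologicalClosure hp, rfl⟩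

theorem closedOperator_apply_mem {G : Submodule ℝ (X × Y)} (hG : IsClosableGraph G)
    (x : (closedOperator G).domain) : ((x : X), closedOperator G x) ∈ G.topologicalClosure := by
  rw [← closedOperator_graph hG]
  exact LinearPMap.mem_graph _ x

/-- Common test vectors of two closable operators are test vectors of the sum of their
closures. -/
theorem isClosable_closedOperator_add {G G' : Submodule ℝ (X × Y)} (hG : IsClosableGraph G)
    (hG' : IsClosableGraph G')
    (h : Dense ((adjointDomain G ⊓ adjointDomain G' : Submodule ℝ Y) : Set Y)) :
    (closedOperator G + closedOperator G').IsClosable := by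
  refine isClosable_of_isClosableGraph (isClosableGraph_of_dense_adjointDomain (h.mono ?_))
  rintro y ⟨hy, hy'⟩
  rw [SetLike.mem_coe, ← adjointDomain_topologicalClosure] at hy hy'
  obtain ⟨x, hx⟩ := hy
  obtain ⟨x', hx'⟩ := hy'
  refine ⟨x + x', fun p hp => ?_⟩
  obtain ⟨z, hz1, hz2⟩ := (LinearPMap.mem_graph_iff _).1 hp
  have h1 := hx _ (closedOperator_apply_mem hG ⟨z, z.2.1⟩)
  have h2 := hx' _ (closedOperator_apply_mem hG' ⟨z, z.2.2⟩)
  rw [← hz1, ← hz2, LinearPMap.add_apply, inner_add_left, inner_add_right]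
  exact congrArg₂ (· + ·) h1 h2

end Closability

/-! ### Total sets -/

section Total

variable {X Y Z : Type*} [NormedAddCommGroup X] [NormedSpace ℝ X]
  [NormedAddCommGroup Y] [NormedSpace ℝ Y] [NormedAddCommGroup Z] [NormedSpace ℝ Z]

theorem dense_of_span_dense_subset {S : Set X} (hS : Dense (Submodule.span ℝ S : Set X))
    {M : Submodule ℝ X} (h : S ⊆ M) : Dense (M : Set X) :=
  hS.mono (Submodule.span_le.2 h)

/-- A closed subspace that contains a total set is everything. -/
theorem mem_of_total {S : Set X} (hS : Dense (Submodule.span ℝ S : Set X))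
    {M : Submodule ℝ X} (hM : IsClosed (M : Set X)) (h : S ⊆ M) (x : X) : x ∈ M := by
  have h1 : Dense (M : Set X) := dense_of_span_dense_subset hS h
  have h2 := hM.closure_eq ▸ h1.closure_eq
  exact (Set.eq_univ_iff_forall.1 h2) x

/-- A total family stays total if it is restricted to total sets of arguments in each of two
linear continuous arguments. -/
theorem total_image2 (B : X →L[ℝ] Y →L[ℝ] Z) {S : Set X} {T : Set Y}
    (hS : Dense (Submodule.span ℝ S : Set X)) (hT : Dense (Submodule.span ℝ T : Set Y))
    {R : Set Z} (hR : Dense (Submodule.span ℝ R : Set Z))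
    (hB : ∀ z ∈ R, ∃ x y, B x y = z) :
    Dense (Submodule.span ℝ {z | ∃ x ∈ S, ∃ y ∈ T, B x y = z} : Set Z) := by
  set W : Submodule ℝ Z :=
    (Submodule.span ℝ {z | ∃ x ∈ S, ∃ y ∈ T, B x y = z}).topologicalClosure with hW
  have hWc : IsClosed (W : Set Z) := Submodule.isClosed_topologicalClosure _
  have h1 : ∀ x ∈ S, ∀ y, B x y ∈ W := by
    intro x hx y
    refine mem_of_total hT (M := W.comap (B x : Y →ₗ[ℝ] Z)) (hWc.preimage (B x).continuous) ?_ y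
    intro y hy
    exact Submodule.le_topologicalClosure _ (Submodule.subset_span ⟨x, hx, y, hy, rfl⟩)
  have h2 : ∀ x y, B x y ∈ W := by
    intro x y
    refine mem_of_total hS (M := W.comap (B.flip y : X →ₗ[ℝ] Z))
      (hWc.preimage (B.flip y).continuous) ?_ x
    intro x hx
    exact h1 x hx y
  have h3 : ∀ z, z ∈ W := by
    refine mem_of_total hR hWc ?_
    intro z hz
    obtain ⟨x, y, rfl⟩ := hB z hz
    exact h2 x y
  intro z
  exact h3 z

end Total

/-! ### Elementary tensors -/

section Tensor

variable {H K : Type u} [NormedAddCommGroup H] [InnerProductSpace ℝ H]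
  [NormedAddCommGroup K] [InnerProductSpace ℝ K]

theorem inner_tens (x x' : H) (y y' : K) :
    inner ℝ (tens x y) (tens x' y') = inner ℝ x x' * inner ℝ y y' := by
  change inner ℝ ((x ⊗ₜ[ℝ] y : H ⊗[ℝ] K) : UniformSpace.Completion (H ⊗[ℝ] K))
    ((x' ⊗ₜ[ℝ] y' : H ⊗[ℝ] K) : UniformSpace.Completion (H ⊗[ℝ] K)) = _
  rw [UniformSpace.Completion.inner_coe, TensorProduct.inner_tmul]

theorem norm_tens (x : H) (y : K) : ‖tens x y‖ = ‖x‖ * ‖y‖ := by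
  change ‖((x ⊗ₜ[ℝ] y : H ⊗[ℝ] K) : UniformSpace.Completion (H ⊗[ℝ] K))‖ = _
  rw [UniformSpace.Completion.norm_coe, TensorProduct.norm_tmul]

variable (H K) in
/-- The elementary tensor as a continuous bilinear map. -/
def tensL : H →L[ℝ] K →L[ℝ] HilbertTensor H K :=
  LinearMap.mkContinuous₂
    (LinearMap.mk₂ ℝ tens
      (fun x x' y => by
        unfold tens; rw [TensorProduct.add_tmul]; exact UniformSpace.Completion.coe_add _ _)
      (fun c x y => by
        unfold tens; rw [← TensorProduct.smul_tmul']
        exact UniformSpace.Completion.coe_smul _ _)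
      (fun x y y' => by
        unfold tens; rw [TensorProduct.tmul_add]; exact UniformSpace.Completion.coe_add _ _)
      (fun c x y => by
        unfold tens; rw [TensorProduct.tmul_smul]
        exact UniformSpace.Completion.coe_smul _ _))
    1 (fun x y => by rw [LinearMap.mk₂_apply, norm_tens, one_mul])

@[simp] theorem tensL_apply (x : H) (y : K) : tensL H K x y = tens x y := rfl

variable (H K) in
theorem dense_span_tens :
    Dense (Submodule.span ℝ {z : HilbertTensor H K | ∃ x y, z = tens x y} :
      Set (HilbertTensor H K)) := by
  have h1 : Dense (Set.range ((↑) : H ⊗[ℝ] K → UniformSpace.Completion (H ⊗[ℝ] K))) :=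
    UniformSpace.Completion.denseRange_coe
  refine Dense.mono (s₁ := (Set.range ((↑) : H ⊗[ℝ] K → UniformSpace.Completion (H ⊗[ℝ] K)) :
    Set (HilbertTensor H K))) ?_ h1
  rintro _ ⟨z, rfl⟩
  induction z using TensorProduct.induction_on with
  | zero =>
    have : ((0 : H ⊗[ℝ] K) : UniformSpace.Completion (H ⊗[ℝ] K)) = 0 := rfl
    rw [this]; exact Submodule.zero_mem _
  | tmul x y => exact Submodule.subset_span ⟨x, y, rfl⟩
  | add a b ha hb =>
    rw [UniformSpace.Completion.coe_add]
    exact Submodule.add_mem _ ha hb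

theorem dense_span_tens_of_dense {S : Set H} {T : Set K}
    (hS : Dense (Submodule.span ℝ S : Set H)) (hT : Dense (Submodule.span ℝ T : Set K)) :
    Dense (Submodule.span ℝ {z : HilbertTensor H K | ∃ x ∈ S, ∃ y ∈ T, tensL H K x y = z} :
      Set (HilbertTensor H K)) := by
  refine total_image2 (tensL H K) hS hT (dense_span_tens H K) ?_
  rintro z ⟨x, y, rfl⟩
  exact ⟨x, y, rfl⟩

/-! ### Symmetric tensors -/

/-- The diagonal tensor `h^{⊗ n}` as a symmetric tensor. -/
def symDiag (h : H) (n : ℕ) : SymPow H n :=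
  (⟨diagTens h n, Submodule.le_topologicalClosure _ (Submodule.subset_span ⟨h, rfl⟩)⟩ :
    symSubspace H n)

theorem continuous_diagTens (n : ℕ) : Continuous fun h : H => diagTens h n := by
  induction n with
  | zero => exact continuous_const
  | succ n ih =>
    exact (tensL H (TensorPow H n)).isBoundedBilinearMap.continuous.comp
      (continuous_id.prodMk ih)

/-- The diagonal tensors of the vectors of a dense set are total among the symmetric tensors. -/
theorem dense_span_symDiag {U : Set H} (hU : Dense U) (n : ℕ) :
    Dense (Submodule.span ℝ ((fun h => symDiag h n) '' U) : Set (SymPow H n)) := by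
  set W := (Submodule.span ℝ ((fun h => symDiag h n) '' U)).topologicalClosure with hW
  have hWc : IsClosed (W : Set (SymPow H n)) := Submodule.isClosed_topologicalClosure _
  have hcont : Continuous fun h : H => symDiag h n :=
    Continuous.subtype_mk (continuous_diagTens n) _
  have h1 : ∀ h, symDiag h n ∈ W := by
    have : closure U ⊆ (fun h => symDiag h n) ⁻¹' W :=
      closure_minimal (fun h hh => Submodule.le_topologicalClosure _
        (Submodule.subset_span ⟨h, hh, rfl⟩)) (hWc.preimage hcont)
    intro h
    exact this (hU h)
  have h2 : ∀ x : TensorPow H n,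
      x ∈ Submodule.span ℝ (Set.range fun h : H => diagTens h n) →
        x ∈ W.map (symIncl n).toLinearMap := by
    intro x hx
    refine (Submodule.span_le.2 ?_) hx
    rintro _ ⟨h, rfl⟩
    exact ⟨symDiag h n, h1 h, rfl⟩
  have hWmap : IsClosed (W.map (symIncl n).toLinearMap : Set (TensorPow H n)) := by
    have : IsClosed ((symIncl (H := H) n) '' (W : Set (SymPow H n))) :=
      (symIncl (H := H) n).isometry.isClosedEmbedding.isClosedMap _ hWc
    exact this
  intro s
  have hs : symIncl n s ∈ W.map (symIncl n).toLinearMap :=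
    closure_minimal h2 hWmap s.2
  obtain ⟨w, hw, hws⟩ := hs
  have : w = s := (symIncl (H := H) n).injective hws
  exact this ▸ hw

/-- Symmetrised multiplication by a vector is adjoint to contraction with that vector, here
tested on diagonal tensors. -/
theorem inner_symMul_symDiag {n : ℕ} (h h' : H) (s : SymPow H n) :
    inner ℝ (symMul h s) (symDiag h' (n + 1)) = inner ℝ h h' * inner ℝ s (symDiag h' n) := by
  have h1 : inner ℝ (symMul h s) (symDiag h' (n + 1)) =
      inner ℝ (tensCons h (symIncl n s)) (diagTens h' (n + 1)) :=
    Submodule.inner_orthogonalProjectionOnto_eq_of_mem_right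
      (K := symSubspace H (n + 1)) (symDiag h' (n + 1)) (tensCons h (symIncl n s))
  have h2 : inner ℝ (tensCons h (symIncl n s)) (diagTens h' (n + 1)) =
      inner ℝ h h' * inner ℝ (symIncl n s) (diagTens h' n) :=
    inner_tens h h' (symIncl n s) (diagTens h' n)
  rw [h1, h2]
  rfl

/-- Symmetrised multiplication `h ↦ h ⊙ s`, as a continuous linear map. -/
def symMulL {n : ℕ} (s : SymPow H n) : H →L[ℝ] SymPow H (n + 1) :=
  ((symSubspace H (n + 1)).orthogonalProjectionOnto).comp
    ((tensL H (TensorPow H n)).flip (symIncl n s))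

/-! ### The direct sum of the mixed symmetric powers -/

theorem piLp_single_smul {ι : Type*} [DecidableEq ι] {β : ι → Type*}
    [∀ i, AddCommGroup (β i)] [∀ i, Module ℝ (β i)] (i : ι) (c : ℝ) (a : β i) :
    PiLp.single 2 i (c • a) = c • (PiLp.single 2 i a : PiLp 2 β) := by
  rw [← PiLp.toLp_single, Pi.single_smul, WithLp.toLp_smul, PiLp.toLp_single]

theorem piLp_eq_sum_single {ι : Type*} [Fintype ι] [DecidableEq ι] {β : ι → Type*}
    [∀ i, NormedAddCommGroup (β i)] (z : PiLp 2 β) : z = ∑ i, PiLp.single 2 i (z i) := by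
  refine PiLp.ext fun j => ?_
  rw [WithLp.ofLp_sum, Finset.sum_apply, Finset.sum_eq_single j]
  · simp
  · intro i _ hi
    simp [hi.symm]
  · simp

theorem inner_chaosTens_self {n j k : ℕ} (hjk hjk' : j + k = n) (s s' : SymPow H j)
    (t t' : SymPow K k) :
    inner ℝ (chaosTens j k hjk s t) (chaosTens j k hjk' s' t') = inner ℝ s s' * inner ℝ t t' := by
  rw [← inner_tens]
  refine (PiLp.inner_apply _ _).trans ?_
  rw [Finset.sum_eq_single
    (⟨(j, k), Finset.HasAntidiagonal.mem_antidiagonal.mpr hjk⟩ :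
      Finset.HasAntidiagonal.antidiagonal n)]
  · simp [chaosTens]
  · intro b _ hb
    simp [chaosTens, hb]
  · simp

theorem inner_chaosTens_of_ne {n j k j' k' : ℕ} (hjk : j + k = n) (hjk' : j' + k' = n)
    (h : j ≠ j') (s : SymPow H j) (t : SymPow K k) (s' : SymPow H j') (t' : SymPow K k') :
    inner ℝ (chaosTens j k hjk s t) (chaosTens j' k' hjk' s' t') = 0 := by
  refine (PiLp.inner_apply _ _).trans (Finset.sum_eq_zero fun b _ => ?_)
  by_cases hb : b = ⟨(j, k), Finset.HasAntidiagonal.mem_antidiagonal.mpr hjk⟩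
  · have hb' : b ≠ ⟨(j', k'), Finset.HasAntidiagonal.mem_antidiagonal.mpr hjk'⟩ := by
      rw [hb]; intro h2
      exact h (congrArg (fun p => p.1.1) h2)
    simp [chaosTens, hb']
  · simp [chaosTens, hb]

variable (H K) in
/-- The inclusion of a summand into `⨁_{j + k = n} H^{⊙ j} ⊗ K^{⊙ k}`, as a continuous
bilinear map. -/
def chaosTensL {n : ℕ} (j k : ℕ) (hjk : j + k = n) :
    SymPow H j →L[ℝ] SymPow K k →L[ℝ] ChaosSpace H K n :=
  LinearMap.mkContinuous₂
    (LinearMap.mk₂ ℝ (chaosTens j k hjk)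
      (fun s s' t => by
        unfold chaosTens
        rw [← tensL_apply, map_add, add_apply]
        exact PiLp.single_add ..)
      (fun c s t => by
        unfold chaosTens
        rw [← tensL_apply, map_smul, smul_apply]
        exact piLp_single_smul ..)
      (fun s t t' => by
        unfold chaosTens
        rw [← tensL_apply, map_add]
        exact PiLp.single_add ..)
      (fun c s t => by
        unfold chaosTens
        rw [← tensL_apply, map_smul]
        exact piLp_single_smul ..))
    1 (fun s t => by
      rw [LinearMap.mk₂_apply, one_mul, ← norm_tens]
      exact le_of_eq (PiLp.norm_single ..))

/-- The tensors `h^{⊗ j} ⊗ u^{⊗ k}`, `j + k = n`, with `h` and `u` from dense sets, are total. -/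
theorem dense_span_chaosTens {U : Set H} {V : Set K} (hU : Dense U) (hV : Dense V) (n : ℕ) :
    Dense (Submodule.span ℝ {z : ChaosSpace H K n | ∃ (j k : ℕ) (hjk : j + k = n),
      ∃ h ∈ U, ∃ u ∈ V, z = chaosTens j k hjk (symDiag h j) (symDiag u k)} :
      Set (ChaosSpace H K n)) := by
  set W := (Submodule.span ℝ {z : ChaosSpace H K n | ∃ (j k : ℕ) (hjk : j + k = n),
      ∃ h ∈ U, ∃ u ∈ V, z = chaosTens j k hjk (symDiag h j) (symDiag u k)}).topologicalClosure
    with hW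
  have hWc : IsClosed (W : Set (ChaosSpace H K n)) := Submodule.isClosed_topologicalClosure _
  suffices h : ∀ z : ChaosSpace H K n, z ∈ W from fun z => h z
  have h1 : ∀ (p : Finset.HasAntidiagonal.antidiagonal n)
      (x : HilbertTensor (SymPow H p.1.1) (SymPow K p.1.2)),
      (PiLp.single 2 (β := fun p : Finset.HasAntidiagonal.antidiagonal n =>
        HilbertTensor (SymPow H p.1.1) (SymPow K p.1.2)) p x : ChaosSpace H K n) ∈ W := by
    rintro ⟨⟨j, k⟩, hp⟩ x
    have hjk := Finset.HasAntidiagonal.mem_antidiagonal.mp hp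
    let ι : HilbertTensor (SymPow H j) (SymPow K k) →ₗᵢ[ℝ] ChaosSpace H K n :=
      { toFun := fun x => PiLp.single 2 (β := fun p : Finset.HasAntidiagonal.antidiagonal n =>
          HilbertTensor (SymPow H p.1.1) (SymPow K p.1.2)) ⟨(j, k), hp⟩ x
        map_add' := fun x y => PiLp.single_add ..
        map_smul' := fun c x => piLp_single_smul ..
        norm_map' := fun x => PiLp.norm_single .. }
    refine mem_of_total (dense_span_tens_of_dense (dense_span_symDiag hU j)
      (dense_span_symDiag hV k)) (M := W.comap ι.toLinearMap) (hWc.preimage ι.continuous) ?_ x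
    rintro _ ⟨_, ⟨h, hh, rfl⟩, _, ⟨u, hu, rfl⟩, rfl⟩
    exact Submodule.le_topologicalClosure _ (Submodule.subset_span ⟨j, k, hjk, h, hh, u, hu, rfl⟩)
  intro z
  refine (piLp_eq_sum_single (show PiLp 2 fun p : Finset.HasAntidiagonal.antidiagonal n =>
    HilbertTensor (SymPow H p.1.1) (SymPow K p.1.2) from z)).symm ▸ ?_
  exact Submodule.sum_mem _ fun p _ => h1 p _

end Tensor

/-! ### Elementary tensors in spaces of square integrable functions -/

section LpTensor

variable {α β V : Type*} [MeasurableSpace α] [MeasurableSpace β] {μ : Measure α} {ν : Measure β}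
  [NormedAddCommGroup V]

theorem eLpNorm_two_sq (f : α → V) : eLpNorm f 2 μ ^ 2 = ∫⁻ x, ‖f x‖ₑ ^ 2 ∂μ := by
  have := eLpNorm_nnreal_pow_eq_lintegral (f := f) (μ := μ) (p := 2) two_ne_zero
  simpa using this

/-- The bilinear map `(f, c) ↦ f ⊗ c` into a Bochner space. -/
def lpSmul [NormedSpace ℝ V] (μ : Measure α) : Lp ℝ 2 μ →L[ℝ] V →L[ℝ] Lp V 2 μ :=
  ((ContinuousLinearMap.lsmul ℝ ℝ : ℝ →L[ℝ] V →L[ℝ] V).flip.compLpL₂ 2 μ).flip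

theorem coeFn_lpSmul [NormedSpace ℝ V] (f : Lp ℝ 2 μ) (c : V) :
    lpSmul μ f c =ᵐ[μ] fun x => f x • c := by
  have h : lpSmul μ f c =
      ((ContinuousLinearMap.lsmul ℝ ℝ : ℝ →L[ℝ] V →L[ℝ] V).flip c).compLp f := by
    rw [lpSmul, ContinuousLinearMap.flip_apply, ContinuousLinearMap.compLpL₂_apply_apply]
  rw [h]
  filter_upwards [ContinuousLinearMap.coeFn_compLp'
    ((ContinuousLinearMap.lsmul ℝ ℝ : ℝ →L[ℝ] V →L[ℝ] V).flip c) f] with x hx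
  rw [hx, ContinuousLinearMap.flip_apply, ContinuousLinearMap.lsmul_apply]

/-- In a Bochner space, the functions `f ⊗ c` with `f` and `c` from total sets are total. -/
theorem dense_span_lpSmul [NormedSpace ℝ V] {S : Set (Lp ℝ 2 μ)} {T : Set V}
    (hS : Dense (Submodule.span ℝ S : Set (Lp ℝ 2 μ))) (hT : Dense (Submodule.span ℝ T : Set V)) :
    Dense (Submodule.span ℝ {z | ∃ f ∈ S, ∃ c ∈ T, lpSmul μ f c = z} : Set (Lp V 2 μ)) := by
  refine total_image2 (lpSmul (V := V) μ) hS hT (R := {z | ∃ f, ∃ c : V, lpSmul μ f c = z}) ?_ ?_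
  swap
  · rintro z ⟨f, c, h⟩
    exact ⟨f, c, h⟩
  intro z
  change z ∈
    ((Submodule.span ℝ {z : Lp V 2 μ | ∃ f, ∃ c : V, lpSmul μ f c = z}).topologicalClosure :
    Set (Lp V 2 μ))
  induction z using Lp.induction (p := 2) (by simp) with
  | @indicatorConst c s hs hμs =>
    refine Submodule.le_topologicalClosure _ (Submodule.subset_span
      ⟨indicatorConstLp 2 hs hμs.ne 1, c, ?_⟩)
    refine Lp.ext ?_
    rw [Lp.simpleFunc.coe_indicatorConst]
    filter_upwards [coeFn_lpSmul (indicatorConstLp 2 hs hμs.ne (1 : ℝ)) c,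
      indicatorConstLp_coeFn (p := 2) (hs := hs) (hμs := hμs.ne) (c := (1 : ℝ)),
      indicatorConstLp_coeFn (p := 2) (hs := hs) (hμs := hμs.ne) (c := c)] with x h1 h2 h3
    rw [h1, h2, h3]
    by_cases hx : x ∈ s <;> simp [Set.indicator, hx]
  | add hf hg _ h1 h2 => exact Submodule.add_mem _ h1 h2
  | isClosed => exact Submodule.isClosed_topologicalClosure _

theorem memLp_prod_smul [NormedSpace ℝ V] [SFinite μ] [SFinite ν] {f : α → V} {g : β → ℝ}
    (hf : MemLp f 2 μ) (hg : MemLp g 2 ν) :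
    MemLp (fun z : α × β => g z.2 • f z.1) 2 (μ.prod ν) := by
  have hm : AEStronglyMeasurable (fun z : α × β => g z.2 • f z.1) (μ.prod ν) :=
    (hg.1.comp_quasiMeasurePreserving Measure.quasiMeasurePreserving_snd).smul
      (hf.1.comp_quasiMeasurePreserving Measure.quasiMeasurePreserving_fst)
  rw [memLp_two_iff_integrable_sq_norm hm]
  have := ((memLp_two_iff_integrable_sq_norm hf.1).1 hf).mul_prod
    ((memLp_two_iff_integrable_sq_norm hg.1).1 hg)
  refine this.congr (Filter.Eventually.of_forall fun z => ?_)
  simp only [norm_smul]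
  ring

theorem memLp_prod_smul' [NormedSpace ℝ V] [SFinite μ] [SFinite ν] {f : α → ℝ} {g : β → V}
    (hf : MemLp f 2 μ) (hg : MemLp g 2 ν) :
    MemLp (fun z : α × β => f z.1 • g z.2) 2 (μ.prod ν) := by
  have hm : AEStronglyMeasurable (fun z : α × β => f z.1 • g z.2) (μ.prod ν) :=
    (hf.1.comp_quasiMeasurePreserving Measure.quasiMeasurePreserving_fst).smul
      (hg.1.comp_quasiMeasurePreserving Measure.quasiMeasurePreserving_snd)
  rw [memLp_two_iff_integrable_sq_norm hm]
  have := ((memLp_two_iff_integrable_sq_norm hf.1).1 hf).mul_prod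
    ((memLp_two_iff_integrable_sq_norm hg.1).1 hg)
  refine this.congr (Filter.Eventually.of_forall fun z => ?_)
  simp only [norm_smul]
  ring

theorem ae_fst {p : α → Prop} [SFinite ν] (h : ∀ᵐ x ∂μ, p x) : ∀ᵐ z ∂μ.prod ν, p z.1 :=
  Measure.quasiMeasurePreserving_fst.ae h

theorem ae_snd {p : β → Prop} [SFinite ν] (h : ∀ᵐ x ∂ν, p x) : ∀ᵐ z ∂μ.prod ν, p z.2 :=
  Measure.quasiMeasurePreserving_snd.ae h

variable [SFinite μ] [SFinite ν]

/-- The function `(x, y) ↦ f x * g y` as an element of `L²(μ × ν)`. -/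
def lpProdFun (f : Lp ℝ 2 μ) (g : Lp ℝ 2 ν) : Lp ℝ 2 (μ.prod ν) :=
  (memLp_prod_smul' (Lp.memLp f) (Lp.memLp g)).toLp _

theorem coeFn_lpProdFun (f : Lp ℝ 2 μ) (g : Lp ℝ 2 ν) :
    lpProdFun f g =ᵐ[μ.prod ν] fun z => f z.1 * g z.2 :=
  MemLp.coeFn_toLp _

theorem inner_lpProdFun (f f' : Lp ℝ 2 μ) (g g' : Lp ℝ 2 ν) :
    inner ℝ (lpProdFun f g) (lpProdFun f' g') = inner ℝ f f' * inner ℝ g g' := by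
  rw [L2.inner_def, L2.inner_def, L2.inner_def, ← integral_prod_mul]
  refine integral_congr_ae ?_
  filter_upwards [coeFn_lpProdFun f g, coeFn_lpProdFun f' g'] with z h1 h2
  simp only [h1, h2, RCLike.inner_apply, conj_trivial]
  ring

variable (μ ν) in
/-- The bilinear map `(f, g) ↦ f ⊗ g` into `L²(μ × ν)`. -/
def lpProd : Lp ℝ 2 μ →L[ℝ] Lp ℝ 2 ν →L[ℝ] Lp ℝ 2 (μ.prod ν) :=
  LinearMap.mkContinuous₂
    (LinearMap.mk₂ ℝ lpProdFun
      (fun f f' g => by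
        refine Lp.ext ?_
        filter_upwards [coeFn_lpProdFun (f + f') g, coeFn_lpProdFun f g, coeFn_lpProdFun f' g,
          Lp.coeFn_add (lpProdFun f g) (lpProdFun f' g), ae_fst (Lp.coeFn_add f f')]
          with z h1 h2 h3 h4 h5
        rw [h1, h4, Pi.add_apply, h2, h3, h5, Pi.add_apply, add_mul])
      (fun c f g => by
        refine Lp.ext ?_
        filter_upwards [coeFn_lpProdFun (c • f) g, coeFn_lpProdFun f g,
          Lp.coeFn_smul c (lpProdFun f g), ae_fst (Lp.coeFn_smul c f)]
          with z h1 h2 h4 h5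
        rw [h1, h4, Pi.smul_apply, h2, h5, Pi.smul_apply, smul_eq_mul, smul_eq_mul, mul_assoc])
      (fun f g g' => by
        refine Lp.ext ?_
        filter_upwards [coeFn_lpProdFun f (g + g'), coeFn_lpProdFun f g, coeFn_lpProdFun f g',
          Lp.coeFn_add (lpProdFun f g) (lpProdFun f g'), ae_snd (Lp.coeFn_add g g')]
          with z h1 h2 h3 h4 h5
        rw [h1, h4, Pi.add_apply, h2, h3, h5, Pi.add_apply, mul_add])
      (fun c f g => by
        refine Lp.ext ?_
        filter_upwards [coeFn_lpProdFun f (c • g), coeFn_lpProdFun f g,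
          Lp.coeFn_smul c (lpProdFun f g), ae_snd (Lp.coeFn_smul c g)]
          with z h1 h2 h4 h5
        rw [h1, h4, Pi.smul_apply, h2, h5, Pi.smul_apply, smul_eq_mul, smul_eq_mul,
          mul_left_comm]))
    1 (fun f g => by
      rw [LinearMap.mk₂_apply, one_mul]
      refine le_of_eq ?_
      have h := inner_lpProdFun f f g g
      rw [real_inner_self_eq_norm_sq, real_inner_self_eq_norm_sq, real_inner_self_eq_norm_sq,
        ← mul_pow] at h
      exact (pow_left_inj₀ (norm_nonneg _) (by positivity) two_ne_zero).1 h)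

theorem coeFn_lpProd (f : Lp ℝ 2 μ) (g : Lp ℝ 2 ν) :
    lpProd μ ν f g =ᵐ[μ.prod ν] fun z => f z.1 * g z.2 :=
  coeFn_lpProdFun f g

/-- A square integrable function on a product space is zero if it is orthogonal to all functions
`f ⊗ g`. Indicators of rectangles with sides of finite measure would suffice. -/
theorem eq_zero_of_forall_inner_lpProd [SigmaFinite μ] [SigmaFinite ν]
    (F : Lp ℝ 2 (μ.prod ν)) (hF : ∀ f g, inner ℝ (lpProd μ ν f g) F = 0) : F = 0 := by
  have hrect : ∀ (A : Set α) (B : Set β), MeasurableSet A → MeasurableSet B → μ A ≠ ∞ → ν B ≠ ∞ →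
      ∫ z in A ×ˢ B, F z ∂μ.prod ν = 0 := by
    intro A B hA hB hμA hνB
    have h := hF (indicatorConstLp 2 hA hμA 1) (indicatorConstLp 2 hB hνB 1)
    rw [L2.inner_def] at h
    rw [← integral_indicator (hA.prod hB), ← h]
    refine integral_congr_ae ?_
    filter_upwards [coeFn_lpProd (indicatorConstLp 2 hA hμA (1 : ℝ))
        (indicatorConstLp 2 hB hνB (1 : ℝ)),
      ae_fst (indicatorConstLp_coeFn (p := 2) (hs := hA) (hμs := hμA) (c := (1 : ℝ))),
      ae_snd (indicatorConstLp_coeFn (p := 2) (hs := hB) (hμs := hνB) (c := (1 : ℝ)))]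
      with z h1 h2 h3
    rw [h1, h2, h3]
    by_cases hzA : z.1 ∈ A <;> by_cases hzB : z.2 ∈ B <;> simp [Set.indicator, hzA, hzB]
  have hloc : ∀ n : ℕ, ∀ᵐ z ∂μ.prod ν,
      z ∈ spanningSets μ n ×ˢ spanningSets ν n → F z = 0 := by
    intro n
    set A := spanningSets μ n
    set B := spanningSets ν n
    have hA : MeasurableSet A := measurableSet_spanningSets μ n
    have hB : MeasurableSet B := measurableSet_spanningSets ν n
    have hμA : μ A ≠ ∞ := (measure_spanningSets_lt_top μ n).ne
    have hνB : ν B ≠ ∞ := (measure_spanningSets_lt_top ν n).ne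
    have hfin : (μ.prod ν) (A ×ˢ B) ≠ ∞ := by
      rw [Measure.prod_prod]; exact ENNReal.mul_ne_top hμA hνB
    have hint : IntegrableOn F (A ×ˢ B) (μ.prod ν) := by
      have : IsFiniteMeasure ((μ.prod ν).restrict (A ×ˢ B)) :=
        ⟨by rw [Measure.restrict_apply_univ]; exact hfin.lt_top⟩
      exact ((Lp.memLp F).restrict _).integrable one_le_two
    rw [← ae_restrict_iff' (hA.prod hB)]
    refine Integrable.ae_eq_zero_of_forall_setIntegral_eq_zero hint fun s hs _ => ?_
    induction s, hs using MeasurableSpace.induction_on_inter generateFrom_prod.symm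
      isPiSystem_prod with
    | empty => simp
    | basic t ht =>
      obtain ⟨C, hC, D, hD, rfl⟩ := ht
      rw [Measure.restrict_restrict (MeasurableSet.prod hC hD), Set.prod_inter_prod]
      exact hrect _ _ (MeasurableSet.inter hC hA) (MeasurableSet.inter hD hB)
        (measure_ne_top_of_subset Set.inter_subset_right hμA)
        (measure_ne_top_of_subset Set.inter_subset_right hνB)
    | compl t ht ih =>
      have h1 := integral_add_compl ht hint
      have h2 : ∫ z, F z ∂(μ.prod ν).restrict (A ×ˢ B) = 0 := hrect A B hA hB hμA hνB
      have h3 := ih (by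
        rw [Measure.restrict_apply ht]
        exact (measure_mono Set.inter_subset_right).trans_lt hfin.lt_top)
      rw [h2, h3, zero_add] at h1
      exact h1
    | iUnion f hd hm ih =>
      rw [integral_iUnion hm hd hint.integrableOn]
      refine (tsum_congr fun i => ih i ?_).trans tsum_zero
      rw [Measure.restrict_apply (hm i)]
      exact (measure_mono Set.inter_subset_right).trans_lt hfin.lt_top
  refine (Lp.eq_zero_iff_ae_eq_zero).2 ?_
  filter_upwards [ae_all_iff.2 hloc] with z hz
  have h1 : z.1 ∈ ⋃ n, spanningSets μ n := by rw [iUnion_spanningSets]; trivial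
  have h2 : z.2 ∈ ⋃ n, spanningSets ν n := by rw [iUnion_spanningSets]; trivial
  obtain ⟨n, hn⟩ := Set.mem_iUnion.1 h1
  obtain ⟨m, hm⟩ := Set.mem_iUnion.1 h2
  exact hz (max n m) ⟨monotone_spanningSets μ (le_max_left n m) hn,
    monotone_spanningSets ν (le_max_right n m) hm⟩

/-- In `L²(μ × ν)`, the functions `f ⊗ g` with `f` and `g` from total sets are total. -/
theorem dense_span_lpProd [SigmaFinite μ] [SigmaFinite ν] {S : Set (Lp ℝ 2 μ)}
    {T : Set (Lp ℝ 2 ν)} (hS : Dense (Submodule.span ℝ S : Set (Lp ℝ 2 μ)))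
    (hT : Dense (Submodule.span ℝ T : Set (Lp ℝ 2 ν))) :
    Dense (Submodule.span ℝ {z | ∃ f ∈ S, ∃ g ∈ T, lpProd μ ν f g = z} :
      Set (Lp ℝ 2 (μ.prod ν))) := by
  refine total_image2 (lpProd μ ν) hS hT (R := {z | ∃ f g, lpProd μ ν f g = z}) ?_ fun z hz => hz
  rw [Submodule.dense_iff_topologicalClosure_eq_top, Submodule.topologicalClosure_eq_top_iff,
    Submodule.eq_bot_iff]
  intro F hF
  refine eq_zero_of_forall_inner_lpProd F fun f g => ?_
  exact (Submodule.mem_orthogonal _ _).1 hF _ (Submodule.subset_span ⟨f, g, rfl⟩)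

/-- Sections of square integrable functions: `L²(μ × ν) = L²(μ; L²(ν))`. The point is the strong
measurability of `x ↦ F (x, ·)`, which holds although `L²(ν)` may be nonseparable. -/
theorem exists_curry [SigmaFinite μ] [SigmaFinite ν] (F : Lp ℝ 2 (μ.prod ν)) :
    ∃ G : Lp (Lp ℝ 2 ν) 2 μ, ∀ᵐ x ∂μ, G x =ᵐ[ν] fun y => F (x, y) := by
  classical
  let P : Lp ℝ 2 (μ.prod ν) → Prop := fun F => ∃ G : α → Lp ℝ 2 ν, AEStronglyMeasurable G μ ∧
    ∀ᵐ x ∂μ, G x =ᵐ[ν] fun y => F (x, y)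
  have hP : ∀ F ∈ Submodule.span ℝ {z | ∃ f ∈ Set.univ, ∃ g ∈ Set.univ, lpProd μ ν f g = z},
      P F := by
    intro F hF
    induction hF using Submodule.span_induction with
    | mem z hz =>
      obtain ⟨f, -, g, -, rfl⟩ := hz
      refine ⟨fun x => f x • g, (Lp.aestronglyMeasurable f).smul_const g, ?_⟩
      filter_upwards [Measure.ae_ae_of_ae_prod (coeFn_lpProd f g)] with x hx
      filter_upwards [hx, Lp.coeFn_smul (f x) g] with y hy hy'
      rw [hy, hy']; rfl
    | zero =>
      refine ⟨fun _ => 0, aestronglyMeasurable_const, ?_⟩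
      filter_upwards [Measure.ae_ae_of_ae_prod (Lp.coeFn_zero ℝ 2 (μ.prod ν))] with x hx
      filter_upwards [hx, Lp.coeFn_zero ℝ 2 ν] with y hy hy'
      rw [hy, hy']; rfl
    | add a b _ _ ha hb =>
      obtain ⟨G, hG, hGa⟩ := ha
      obtain ⟨G', hG', hGb⟩ := hb
      refine ⟨fun x => G x + G' x, hG.add hG', ?_⟩
      filter_upwards [Measure.ae_ae_of_ae_prod (Lp.coeFn_add a b), hGa, hGb] with x hx h1 h2
      filter_upwards [hx, h1, h2, Lp.coeFn_add (G x) (G' x)] with y h1 h2 h3 h4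
      rw [h1, h4, Pi.add_apply, Pi.add_apply, h2, h3]
    | smul c a _ ha =>
      obtain ⟨G, hG, hGa⟩ := ha
      refine ⟨fun x => c • G x, hG.const_smul c, ?_⟩
      filter_upwards [Measure.ae_ae_of_ae_prod (Lp.coeFn_smul c a), hGa] with x hx h1
      filter_upwards [hx, h1, Lp.coeFn_smul c (G x)] with y h1 h2 h4
      rw [h1, h4, Pi.smul_apply, Pi.smul_apply, h2]
  -- `F ↦ F (x, ·)` preserves norms; hence the norms of the sections of `Fs n - F` tend to zero
  -- almost everywhere if `Fs n` converges to `F` fast enough.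
  have hfib : ∀ H : Lp ℝ 2 (μ.prod ν),
      ∫⁻ x, eLpNorm (fun y => H (x, y)) 2 ν ^ 2 ∂μ = ‖H‖ₑ ^ 2 := by
    intro H
    rw [Lp.enorm_def, eLpNorm_two_sq, lintegral_prod _
      ((Lp.stronglyMeasurable H).enorm.pow_const 2).aemeasurable]
    exact lintegral_congr fun x => eLpNorm_two_sq _
  have hmem : ∀ᵐ x ∂μ, MemLp (fun y => F (x, y)) 2 ν := by
    have h1 : ∫⁻ x, eLpNorm (fun y => F (x, y)) 2 ν ^ 2 ∂μ ≠ ∞ := by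
      rw [hfib]; exact ENNReal.pow_ne_top enorm_ne_top
    have hmeas : AEMeasurable (fun x => eLpNorm (fun y => F (x, y)) 2 ν ^ 2) μ := by
      simp_rw [eLpNorm_two_sq]
      exact ((Lp.stronglyMeasurable F).enorm.pow_const 2).lintegral_prod_right'.aemeasurable
    filter_upwards [ae_lt_top' hmeas h1] with x hx
    refine ⟨((Lp.stronglyMeasurable F).comp_measurable measurable_prodMk_left).aestronglyMeasurable,
      ?_⟩
    by_contra hcon
    rw [not_lt_top_iff] at hcon
    simp [hcon] at hx
  have hdense := dense_span_lpProd (μ := μ) (ν := ν) (S := Set.univ) (T := Set.univ)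
    (by simp) (by simp)
  have hseq : ∀ n : ℕ, ∃ F' ∈ Submodule.span ℝ
      {z | ∃ f ∈ Set.univ, ∃ g ∈ Set.univ, lpProd μ ν f g = z}, ‖F' - F‖ ≤ (1 / 2 : ℝ) ^ n := by
    intro n
    obtain ⟨F', hF', hd⟩ := Metric.dense_iff.1 hdense F ((1 / 2 : ℝ) ^ n) (by positivity)
    exact ⟨F', hd, by rw [← dist_eq_norm]; exact (Metric.mem_ball.1 hF').le⟩
  choose Fs hFs hFn using hseq
  choose Gs hGs hGF using fun n => hP _ (hFs n)
  have hsum : ∀ᵐ x ∂μ, Filter.Tendsto (fun n => eLpNorm (fun y => (Fs n - F) (x, y)) 2 ν ^ 2)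
      Filter.atTop (nhds 0) := by
    have hmeas : ∀ n, AEMeasurable (fun x => eLpNorm (fun y => (Fs n - F) (x, y)) 2 ν ^ 2) μ := by
      intro n
      simp_rw [eLpNorm_two_sq]
      exact ((Lp.stronglyMeasurable (Fs n - F)).enorm.pow_const 2).lintegral_prod_right'.aemeasurable
    have h1 : ∫⁻ x, ∑' n, eLpNorm (fun y => (Fs n - F) (x, y)) 2 ν ^ 2 ∂μ ≠ ∞ := by
      rw [lintegral_tsum hmeas]
      simp_rw [hfib]
      have hle : ∀ n, ‖Fs n - F‖ₑ ^ 2 ≤ ENNReal.ofReal ((1 / 4 : ℝ) ^ n) := by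
        intro n
        rw [← ofReal_norm, ← ENNReal.ofReal_pow (norm_nonneg _)]
        refine ENNReal.ofReal_le_ofReal ?_
        calc ‖Fs n - F‖ ^ 2 ≤ ((1 / 2 : ℝ) ^ n) ^ 2 := by gcongr; exact hFn n
          _ = (1 / 4 : ℝ) ^ n := by rw [← pow_mul, mul_comm, pow_mul]; norm_num
      refine ne_top_of_le_ne_top ?_ (ENNReal.tsum_le_tsum hle)
      exact (summable_geometric_of_lt_one (by norm_num) (by norm_num)).tsum_ofReal_ne_top
    filter_upwards [ae_lt_top' (AEMeasurable.tsum hmeas) h1] with x hx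
    exact ENNReal.tendsto_atTop_zero_of_tsum_ne_top hx.ne
  let G : α → Lp ℝ 2 ν := fun x => if h : MemLp (fun y => F (x, y)) 2 ν then h.toLp _ else 0
  have hGe : ∀ᵐ x ∂μ, G x =ᵐ[ν] fun y => F (x, y) := by
    filter_upwards [hmem] with x hx
    simp only [G, dif_pos hx]
    exact hx.coeFn_toLp
  have hGm : AEStronglyMeasurable G μ := by
    refine aestronglyMeasurable_of_tendsto_ae Filter.atTop hGs ?_
    have hsub : ∀ᵐ x ∂μ, ∀ n, ∀ᵐ y ∂ν, (Fs n - F) (x, y) = Fs n (x, y) - F (x, y) :=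
      ae_all_iff.2 fun n => Measure.ae_ae_of_ae_prod (Lp.coeFn_sub (Fs n) F)
    filter_upwards [hsum, hGe, ae_all_iff.2 hGF, hsub] with x h1 h2 h3 h4
    rw [tendsto_iff_edist_tendsto_0]
    have h5 : ∀ n, edist (Gs n x) (G x) = eLpNorm (fun y => (Fs n - F) (x, y)) 2 ν := by
      intro n
      rw [Lp.edist_def]
      refine eLpNorm_congr_ae ?_
      filter_upwards [h2, h3 n, h4 n] with y h5 h6 h7
      rw [Pi.sub_apply, h5, h6, h7]
    simp_rw [h5]
    have h6 := (ENNReal.continuous_rpow_const (y := (1 / 2 : ℝ))).tendsto 0 |>.comp h1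
    simp only [Function.comp_def] at h6
    refine (h6.congr fun n => ?_).trans (by simp)
    rw [← ENNReal.rpow_natCast, ← ENNReal.rpow_mul]
    norm_num
  have hGL : MemLp G 2 μ := by
    refine ⟨hGm, ?_⟩
    have h1 : eLpNorm G 2 μ ^ 2 = ‖F‖ₑ ^ 2 := by
      rw [eLpNorm_two_sq, ← hfib]
      refine lintegral_congr_ae ?_
      filter_upwards [hGe] with x hx
      rw [Lp.enorm_def, eLpNorm_congr_ae hx]
    by_contra hcon
    rw [not_lt_top_iff] at hcon
    rw [hcon] at h1
    exact ENNReal.pow_ne_top (n := 2) (enorm_ne_top (x := F)) (by rw [← h1]; simp)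
  refine ⟨hGL.toLp G, ?_⟩
  filter_upwards [hGe, hGL.coeFn_toLp] with x h1 h2
  rw [h2]; exact h1

end LpTensor

/-! ### Radon measures and separable subspaces -/

section Separable

variable {E : Type*} [NormedAddCommGroup E] [NormedSpace ℝ E] [MeasurableSpace E]

/-- The measure `μ` is carried by the subspace `F`, which is closed and separable. -/
structure IsCarriedBy (μ : Measure E) (F : Submodule ℝ E) : Prop where
  isClosed : IsClosed (F : Set E)
  isSeparable : TopologicalSpace.IsSeparable (F : Set E)
  null : μ (F : Set E)ᶜ = 0

theorem IsCarriedBy.of_absolutelyContinuous {μ μ' : Measure E} {F : Submodule ℝ E}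
    (h : IsCarriedBy μ F) (hac : μ' ≪ μ) : IsCarriedBy μ' F :=
  ⟨h.isClosed, h.isSeparable, hac h.null⟩

theorem IsCarriedBy.ae_mem {μ : Measure E} {F : Submodule ℝ E} (h : IsCarriedBy μ F) :
    ∀ᵐ x ∂μ, x ∈ F := h.null

variable [BorelSpace E]

omit [NormedSpace ℝ E] in
theorem exists_isSeparable_null_compl (μ : Measure E) [IsFiniteMeasure μ] [μ.InnerRegular] :
    ∃ S : Set E, TopologicalSpace.IsSeparable S ∧ μ Sᶜ = 0 := by
  have h : ∀ n : ℕ, ∃ K ⊆ (Set.univ : Set E), IsCompact K ∧ μ (Set.univ \ K) < (n + 1 : ℝ≥0∞)⁻¹ :=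
    fun n => MeasurableSet.univ.exists_isCompact_sdiff_lt (measure_ne_top _ _) (by simp)
  choose K _ hK hμK using h
  refine ⟨⋃ n, K n, TopologicalSpace.IsSeparable.iUnion fun n => (hK n).isSeparable, ?_⟩
  refine le_antisymm (ENNReal.le_of_forall_pos_le_add fun ε hε _ => ?_) (zero_le)
  obtain ⟨n, hn⟩ := ENNReal.exists_inv_nat_lt (a := (ε : ℝ≥0∞)) (by simpa using hε.ne')
  calc μ (⋃ n, K n)ᶜ ≤ μ (Set.univ \ K n) := by
        refine measure_mono fun x hx => ⟨trivial, fun hxK => hx (Set.mem_iUnion.2 ⟨n, hxK⟩)⟩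
    _ ≤ (n + 1 : ℝ≥0∞)⁻¹ := (hμK n).le
    _ ≤ (n : ℝ≥0∞)⁻¹ := ENNReal.inv_le_inv.2 le_self_add
    _ ≤ 0 + ε := by rw [zero_add]; exact hn.le

/-- Countably many finite Radon measures are carried by a common closed separable subspace, which
may be chosen to contain a given point. -/
theorem exists_common_carrier {ι : Type*} [Countable ι] (μ : ι → Measure E)
    (hfin : ∀ i, IsFiniteMeasure (μ i)) (hreg : ∀ i, (μ i).InnerRegular) (ξ : E) :
    ∃ F : Submodule ℝ E, ξ ∈ F ∧ ∀ i, IsCarriedBy (μ i) F := by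
  choose S hS hμS using fun i => exists_isSeparable_null_compl (μ i)
  set T : Set E := {ξ} ∪ ⋃ i, S i with hT
  have hTs : TopologicalSpace.IsSeparable T :=
    (Set.finite_singleton ξ).isSeparable.union (TopologicalSpace.IsSeparable.iUnion hS)
  have hTF : T ⊆ (Submodule.span ℝ T).topologicalClosure :=
    Submodule.subset_span.trans (Submodule.le_topologicalClosure _)
  refine ⟨(Submodule.span ℝ T).topologicalClosure, hTF (Or.inl rfl), fun i =>
    ⟨Submodule.isClosed_topologicalClosure _, ?_, ?_⟩⟩
  · rw [Submodule.topologicalClosure_coe]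
    exact (hTs.span (R := ℝ)).closure
  · refine measure_mono_null (Set.compl_subset_compl.2 fun x hx => ?_) (hμS i)
    exact hTF (Or.inr (Set.mem_iUnion.2 ⟨i, hx⟩))

open Classical in
/-- A measurable map onto the subspace `F` which is the identity on `F`. -/
def retract (F : Submodule ℝ E) (x : E) : F := if h : x ∈ F then ⟨x, h⟩ else 0

omit [MeasurableSpace E] [BorelSpace E] in
theorem coe_retract {F : Submodule ℝ E} {x : E} (hx : x ∈ F) : (retract F x : E) = x := by
  simp [retract, hx]

theorem measurable_retract {F : Submodule ℝ E} (hF : IsClosed (F : Set E)) :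
    Measurable (retract F) := by
  classical
  exact Measurable.dite (s := (F : Set E)) (f := fun x => (x : F)) (g := fun _ => (0 : F))
    measurable_id measurable_const hF.measurableSet

omit [BorelSpace E] in
theorem IsCarriedBy.secondCountable {μ : Measure E} {F : Submodule ℝ E} (h : IsCarriedBy μ F) :
    SecondCountableTopology F := by
  have := h.isSeparable.separableSpace
  exact UniformSpace.secondCountable_of_separable F

theorem IsCarriedBy.map_retract {μ : Measure E} {F : Submodule ℝ E} (h : IsCarriedBy μ F) :
    (μ.map (retract F)).map ((↑) : F → E) = μ := by
  rw [Measure.map_map measurable_subtype_coe (measurable_retract h.isClosed)]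
  conv_rhs => rw [← Measure.map_id (μ := μ)]
  refine Measure.map_congr ?_
  filter_upwards [h.ae_mem] with x hx
  exact coe_retract hx

/-- Addition is measurable up to a null set for products of measures carried by a separable
subspace, although the Borel `σ`-algebra of `E × E` may exceed the product `σ`-algebra. -/
theorem IsCarriedBy.aemeasurable_add {μ ν : Measure E} [SFinite μ] [SFinite ν]
    {F : Submodule ℝ E} (hμ : IsCarriedBy μ F) (hν : IsCarriedBy ν F) :
    AEMeasurable (fun z : E × E => z.1 + z.2) (μ.prod ν) := by
  have := hμ.secondCountable
  have hr := measurable_retract hμ.isClosed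
  refine ⟨fun z => ((retract F z.1 + retract F z.2 : F) : E), ?_, ?_⟩
  · exact measurable_subtype_coe.comp ((hr.comp measurable_fst).add (hr.comp measurable_snd))
  · filter_upwards [ae_fst hμ.ae_mem, ae_snd hν.ae_mem] with z h1 h2
    rw [Submodule.coe_add, coe_retract h1, coe_retract h2]

theorem IsCarriedBy.charFunDual_map_retract {μ : Measure E} {F : Submodule ℝ E}
    (h : IsCarriedBy μ F) {L : StrongDual ℝ E} {L' : StrongDual ℝ F} (hL : ∀ x : F, L x = L' x) :
    charFunDual (μ.map (retract F)) L' = charFunDual μ L := by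
  rw [charFunDual_apply, charFunDual_apply, integral_map
    (measurable_retract h.isClosed).aemeasurable
    (by fun_prop)]
  refine integral_congr_ae ?_
  filter_upwards [h.ae_mem] with x hx
  rw [← hL, coe_retract hx]

/-- Uniqueness of the characteristic functional. -/
theorem IsCarriedBy.ext_of_charFunDual [CompleteSpace E] {μ μ' : Measure E} [IsFiniteMeasure μ]
    [IsFiniteMeasure μ'] {F : Submodule ℝ E} (hμ : IsCarriedBy μ F) (hμ' : IsCarriedBy μ' F)
    (h : ∀ L : StrongDual ℝ E, charFunDual μ L = charFunDual μ' L) : μ = μ' := by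
  have := hμ.secondCountable
  have : CompleteSpace F := hμ.isClosed.completeSpace_coe
  rw [← hμ.map_retract, ← hμ'.map_retract]
  congr 1
  refine Measure.ext_of_charFunDual ?_
  ext L'
  obtain ⟨L, hL, -⟩ := exists_extension_norm_eq F L'
  rw [hμ.charFunDual_map_retract hL, hμ'.charFunDual_map_retract hL, h]

/-! ### Trigonometric functions -/

theorem integrable_cos_dual (μ : Measure E) [IsFiniteMeasure μ] (L : StrongDual ℝ E) :
    Integrable (fun x => Real.cos (L x)) μ :=
  Integrable.of_bound
    (Real.continuous_cos.measurable.comp L.continuous.measurable).aestronglyMeasurable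
    1 (Filter.Eventually.of_forall fun _ => Real.abs_cos_le_one _)

theorem integrable_sin_dual (μ : Measure E) [IsFiniteMeasure μ] (L : StrongDual ℝ E) :
    Integrable (fun x => Real.sin (L x)) μ :=
  Integrable.of_bound
    (Real.continuous_sin.measurable.comp L.continuous.measurable).aestronglyMeasurable
    1 (Filter.Eventually.of_forall fun _ => Real.abs_sin_le_one _)

theorem charFunDual_eq_cos_add_sin (μ : Measure E) [IsFiniteMeasure μ] (L : StrongDual ℝ E) :
    charFunDual μ L = (∫ x, Real.cos (L x) ∂μ : ℝ) + (∫ x, Real.sin (L x) ∂μ : ℝ) * Complex.I := by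
  rw [charFunDual_apply, ← integral_complex_ofReal, ← integral_complex_ofReal,
    ← integral_mul_const, ← integral_add (integrable_cos_dual μ L).ofReal
      ((integrable_sin_dual μ L).ofReal.mul_const _)]
  refine integral_congr_ae (Filter.Eventually.of_forall fun x => ?_)
  simp [Complex.exp_mul_I]

omit [NormedAddCommGroup E] [NormedSpace ℝ E] [BorelSpace E] in
theorem integral_withDensity_ofReal (μ : Measure E) {h : E → ℝ} (hh : Integrable h μ)
    (u : E → ℝ) : ∫ x, u x ∂μ.withDensity (fun x => ENNReal.ofReal (h x)) =
      ∫ x, max (h x) 0 * u x ∂μ := by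
  rw [integral_withDensity_eq_integral_toReal_smul₀ hh.aemeasurable.ennreal_ofReal
    (Filter.Eventually.of_forall fun _ => ENNReal.ofReal_lt_top)]
  refine integral_congr_ae (Filter.Eventually.of_forall fun x => ?_)
  simp [ENNReal.toReal_ofReal']

/-- If the finite measure `M` has the same trigonometric integrals as the signed measure `h μ`,
then `M = h μ`. -/
theorem add_withDensity_eq_withDensity [CompleteSpace E] {μ M : Measure E} [IsFiniteMeasure M]
    {F : Submodule ℝ E} (hμ : IsCarriedBy μ F) (hM : IsCarriedBy M F) {h : E → ℝ}
    (hh : Integrable h μ)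
    (hcos : ∀ L : StrongDual ℝ E, ∫ x, Real.cos (L x) ∂M = ∫ x, h x * Real.cos (L x) ∂μ)
    (hsin : ∀ L : StrongDual ℝ E, ∫ x, Real.sin (L x) ∂M = ∫ x, h x * Real.sin (L x) ∂μ) :
    M + μ.withDensity (fun x => ENNReal.ofReal (-h x)) =
      μ.withDensity (fun x => ENNReal.ofReal (h x)) := by
  have hfin : ∀ k : E → ℝ, Integrable k μ →
      IsFiniteMeasure (μ.withDensity (fun x => ENNReal.ofReal (k x))) := fun k hk =>
    isFiniteMeasure_withDensity_ofReal hk.2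
  have hh' : Integrable (fun x => -h x) μ := hh.neg
  have := hfin h hh
  have := hfin _ hh'
  have hcar : IsCarriedBy (M + μ.withDensity (fun x => ENNReal.ofReal (-h x))) F := by
    refine ⟨hμ.isClosed, hμ.isSeparable, ?_⟩
    rw [Measure.add_apply, hM.null, withDensity_absolutelyContinuous _ _ hμ.null, add_zero]
  have key : ∀ u : E → ℝ, Measurable u → (∀ x, |u x| ≤ 1) → ∫ x, u x ∂M = ∫ x, h x * u x ∂μ →
      ∫ x, u x ∂(M + μ.withDensity (fun x => ENNReal.ofReal (-h x))) =
        ∫ x, u x ∂μ.withDensity (fun x => ENNReal.ofReal (h x)) := by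
    intro u hu hb hM
    have hint : ∀ (N : Measure E) [IsFiniteMeasure N], Integrable u N := fun N _ =>
      Integrable.of_bound hu.aestronglyMeasurable 1 (Filter.Eventually.of_forall hb)
    have hmul : ∀ k : E → ℝ, Integrable k μ → Integrable (fun x => k x * u x) μ := fun k hk =>
      hk.mul_bdd (c := 1) hu.aestronglyMeasurable (Filter.Eventually.of_forall hb)
    rw [integral_add_measure (hint _) (hint _), integral_withDensity_ofReal μ hh,
      integral_withDensity_ofReal μ hh', hM, ← integral_add (hmul _ hh) (hmul _ hh'.pos_part)]
    refine integral_congr_ae (Filter.Eventually.of_forall fun x => ?_)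
    beta_reduce
    rcases le_total (h x) 0 with h0 | h0
    · rw [max_eq_right h0, max_eq_left (by linarith)]; ring
    · rw [max_eq_left h0, max_eq_right (by linarith)]; ring
  refine hcar.ext_of_charFunDual
    (hμ.of_absolutelyContinuous (withDensity_absolutelyContinuous _ _)) fun L => ?_
  rw [charFunDual_eq_cos_add_sin, charFunDual_eq_cos_add_sin,
    key (fun x => Real.cos (L x)) (by fun_prop) (fun _ => Real.abs_cos_le_one _) (hcos L),
    key (fun x => Real.sin (L x)) (by fun_prop) (fun _ => Real.abs_sin_le_one _) (hsin L)]

/-- The functions `cos ∘ L` and `sin ∘ L` in `L²(μ)`, for `L` a continuous linear functional. -/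
def trigSet (μ : Measure E) : Set (Lp ℝ 2 μ) :=
  {f | ∃ L : StrongDual ℝ E, f =ᵐ[μ] (fun x => Real.cos (L x)) ∨ f =ᵐ[μ] fun x => Real.sin (L x)}

theorem memLp_cos_dual (μ : Measure E) [IsFiniteMeasure μ] (L : StrongDual ℝ E) :
    MemLp (fun x => Real.cos (L x)) 2 μ :=
  MemLp.of_bound (integrable_cos_dual μ L).1 1
    (Filter.Eventually.of_forall fun _ => Real.abs_cos_le_one _)

theorem memLp_sin_dual (μ : Measure E) [IsFiniteMeasure μ] (L : StrongDual ℝ E) :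
    MemLp (fun x => Real.sin (L x)) 2 μ :=
  MemLp.of_bound (integrable_sin_dual μ L).1 1
    (Filter.Eventually.of_forall fun _ => Real.abs_sin_le_one _)

/-- The trigonometric functions are total in `L²(μ)`. -/
theorem IsCarriedBy.dense_span_trigSet [CompleteSpace E] {μ : Measure E} [IsFiniteMeasure μ]
    {F : Submodule ℝ E} (hμ : IsCarriedBy μ F) :
    Dense (Submodule.span ℝ (trigSet μ) : Set (Lp ℝ 2 μ)) := by
  rw [Submodule.dense_iff_topologicalClosure_eq_top, Submodule.topologicalClosure_eq_top_iff,
    Submodule.eq_bot_iff]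
  intro h hh
  have horth : ∀ u : E → ℝ, ∀ hu : MemLp u 2 μ, hu.toLp u ∈ trigSet μ →
      ∫ x, h x * u x ∂μ = 0 := by
    intro u hu hmem
    rw [← (Submodule.mem_orthogonal _ _).1 hh _ (Submodule.subset_span hmem), L2.inner_def]
    refine integral_congr_ae ?_
    filter_upwards [hu.coeFn_toLp] with x hx
    simp [hx]
  have hz := add_withDensity_eq_withDensity (M := 0) hμ
    ⟨hμ.isClosed, hμ.isSeparable, by simp⟩ ((Lp.memLp h).integrable one_le_two)
    (fun L => by
      rw [integral_zero_measure, horth _ (memLp_cos_dual μ L) ⟨L, Or.inl (MemLp.coeFn_toLp _)⟩])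
    (fun L => by
      rw [integral_zero_measure, horth _ (memLp_sin_dual μ L) ⟨L, Or.inr (MemLp.coeFn_toLp _)⟩])
  have hint := (Lp.memLp h).integrable one_le_two
  have hint' : Integrable (fun x => -h x) μ := hint.neg
  rw [zero_add, withDensity_eq_iff hint'.aemeasurable.ennreal_ofReal
    hint.aemeasurable.ennreal_ofReal hint'.lintegral_lt_top.ne] at hz
  refine (Lp.eq_zero_iff_ae_eq_zero).2 ?_
  filter_upwards [hz] with x hx
  rcases lt_trichotomy (h x) 0 with h0 | h0 | h0
  · rw [ENNReal.ofReal_of_nonpos h0.le, ENNReal.ofReal_eq_zero] at hx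
    exact absurd hx (by linarith)
  · exact h0
  · rw [ENNReal.ofReal_of_nonpos (by linarith : -h x ≤ 0), eq_comm, ENNReal.ofReal_eq_zero] at hx
    exact absurd hx (by linarith)

end Separable

/-! ### Positive definite functions on the dual space -/

section PosDef

open scoped ComplexConjugate

variable {E : Type*} [NormedAddCommGroup E] [NormedSpace ℝ E] [MeasurableSpace E]

/-- The form `∑ i, ∑ j, c i * conj (c j) * K (L i - L j)`. -/
def quadForm {ι : Type} [Fintype ι] (K : StrongDual ℝ E → ℂ) (c : ι → ℂ)
    (L : ι → StrongDual ℝ E) : ℂ :=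
  ∑ i, ∑ j, c i * conj (c j) * K (L i - L j)

/-- Positive definite functions on the dual of `E`. Only the real parts of the associated forms
are required to be nonnegative. -/
def IsPosDefFun (K : StrongDual ℝ E → ℂ) : Prop :=
  ∀ (ι : Type) [Fintype ι] (c : ι → ℂ) (L : ι → StrongDual ℝ E), 0 ≤ (quadForm K c L).re

omit [MeasurableSpace E] in
theorem quadForm_one {ι : Type} [Fintype ι] (c : ι → ℂ) (L : ι → StrongDual ℝ E) :
    quadForm (fun _ => 1) c L = (‖∑ i, c i‖ ^ 2 : ℝ) := by
  rw [Complex.ofReal_pow, ← Complex.mul_conj', map_sum, Finset.sum_mul_sum]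
  simp [quadForm]

omit [MeasurableSpace E] in
theorem isPosDefFun_one : IsPosDefFun (E := E) fun _ => 1 := by
  intro ι _ c L
  rw [quadForm_one, Complex.ofReal_re]
  positivity

omit [MeasurableSpace E] in
theorem IsPosDefFun.mul_const {K : StrongDual ℝ E → ℂ} (hK : IsPosDefFun K) {a : ℝ}
    (ha : 0 ≤ a) : IsPosDefFun fun L => K L * a := by
  intro ι _ c L
  have h : quadForm (fun L => K L * a) c L = quadForm K c L * a := by
    simp only [quadForm, Finset.sum_mul, mul_assoc]
  rw [h, Complex.re_mul_ofReal]
  exact mul_nonneg (hK ι c L) ha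

omit [MeasurableSpace E] in
/-- Multiplication by a character preserves positive definiteness. -/
theorem IsPosDefFun.mul_char {K : StrongDual ℝ E → ℂ} (hK : IsPosDefFun K)
    (l : StrongDual ℝ E → ℝ) (hl : ∀ L L', l (L - L') = l L - l L') :
    IsPosDefFun fun L => K L * Complex.exp (l L * Complex.I) := by
  intro ι _ c L
  have h : quadForm (fun L => K L * Complex.exp (l L * Complex.I)) c L =
      quadForm K (fun i => c i * Complex.exp (l (L i) * Complex.I)) L := by
    simp only [quadForm]
    refine Finset.sum_congr rfl fun i _ => Finset.sum_congr rfl fun j _ => ?_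
    have h1 : Complex.exp (l (L i - L j) * Complex.I) =
        Complex.exp (l (L i) * Complex.I) * conj (Complex.exp (l (L j) * Complex.I)) := by
      rw [← Complex.exp_conj, ← Complex.exp_add, hl]
      congr 1
      simp only [Complex.ofReal_sub, map_mul, Complex.conj_ofReal, Complex.conj_I]
      ring
    rw [h1, map_mul]
    ring
  rw [h]
  exact hK ι _ L

omit [MeasurableSpace E] in
theorem IsPosDefFun.of_tendsto {K : StrongDual ℝ E → ℂ} {Ks : ℕ → StrongDual ℝ E → ℂ}
    (hK : ∀ n, IsPosDefFun (Ks n))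
    (h : ∀ L, Filter.Tendsto (fun n => Ks n L) Filter.atTop (nhds (K L))) : IsPosDefFun K := by
  intro ι _ c L
  refine ge_of_tendsto' (x := Filter.atTop) (f := fun n => (quadForm (Ks n) c L).re) ?_
    fun n => hK n ι c L
  refine (Complex.continuous_re.tendsto _).comp ?_
  exact tendsto_finsetSum _ fun i _ => tendsto_finsetSum _ fun j _ => (h _).const_mul _

theorem quadForm_mul_charFunDual [OpensMeasurableSpace E] {ι : Type} [Fintype ι]
    (K : StrongDual ℝ E → ℂ) (μ : Measure E)
    [IsFiniteMeasure μ] (c : ι → ℂ) (L : ι → StrongDual ℝ E) :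
    Integrable (fun x => quadForm K (fun i => c i * Complex.exp (L i x * Complex.I)) L) μ ∧
    quadForm (fun L => K L * charFunDual μ L) c L =
      ∫ x, quadForm K (fun i => c i * Complex.exp (L i x * Complex.I)) L ∂μ := by
  have hexp : ∀ L : StrongDual ℝ E, Integrable (fun x => Complex.exp (L x * Complex.I)) μ :=
    fun L => Integrable.of_bound (by fun_prop) 1
      (Filter.Eventually.of_forall fun x => (Complex.norm_exp_ofReal_mul_I _).le)
  have h1 : ∀ i j x, c i * Complex.exp (L i x * Complex.I) *
      conj (c j * Complex.exp (L j x * Complex.I)) * K (L i - L j) =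
      c i * conj (c j) * K (L i - L j) * Complex.exp ((L i - L j) x * Complex.I) := by
    intro i j x
    have h1 : Complex.exp (((L i - L j) x : ℝ) * Complex.I) =
        Complex.exp (L i x * Complex.I) * conj (Complex.exp (L j x * Complex.I)) := by
      rw [← Complex.exp_conj, ← Complex.exp_add]
      congr 1
      simp only [_root_.sub_apply, Complex.ofReal_sub, map_mul, Complex.conj_ofReal,
        Complex.conj_I]
      ring
    rw [h1, map_mul]
    ring
  simp only [quadForm, h1]
  refine ⟨integrable_finsetSum _ fun i _ => integrable_finsetSum _ fun j _ =>
    (hexp _).const_mul _, ?_⟩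
  rw [integral_finsetSum _ fun i _ => integrable_finsetSum _ fun j _ => (hexp _).const_mul _]
  refine Finset.sum_congr rfl fun i _ => ?_
  rw [integral_finsetSum _ fun j _ => (hexp _).const_mul _]
  refine Finset.sum_congr rfl fun j _ => ?_
  rw [integral_const_mul, charFunDual_apply]
  ring

theorem IsPosDefFun.mul_charFunDual [OpensMeasurableSpace E] {K : StrongDual ℝ E → ℂ}
    (hK : IsPosDefFun K) (μ : Measure E) [IsFiniteMeasure μ] :
    IsPosDefFun fun L => K L * charFunDual μ L := by
  intro ι _ c L
  obtain ⟨h1, h2⟩ := quadForm_mul_charFunDual K μ c L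
  rw [h2]
  have h3 := integral_re h1
  simp only [RCLike.re_eq_complex_re] at h3
  rw [← h3]
  exact integral_nonneg fun x => hK ι _ L

theorem IsPosDefFun.mul_charFunDual_pow [OpensMeasurableSpace E] {K : StrongDual ℝ E → ℂ}
    (hK : IsPosDefFun K) (μ : Measure E) [IsFiniteMeasure μ] (k : ℕ) :
    IsPosDefFun fun L => K L * charFunDual μ L ^ k := by
  induction k with
  | zero => simpa using hK
  | succ k ih => simpa only [pow_succ, mul_assoc] using ih.mul_charFunDual μ

theorem hasSum_pow_div_factorial (z : ℂ) :
    HasSum (fun k : ℕ => z ^ k / k.factorial) (Complex.exp z) := by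
  rw [Complex.exp_eq_exp_ℂ]
  exact NormedSpace.exp_series_hasSum_exp' (𝕂 := ℂ) z |>.congr_fun fun k => by
    rw [smul_eq_mul, inv_mul_eq_div]

theorem hasSum_mul_pow_div_factorial (z : ℂ) :
    HasSum (fun k : ℕ => k * (z ^ k / k.factorial)) (z * Complex.exp z) := by
  rw [← hasSum_nat_add_iff' 1]
  simp only [Finset.range_one, Finset.sum_singleton, Nat.cast_zero, zero_mul, sub_zero]
  refine ((hasSum_pow_div_factorial z).mul_left z).congr_fun fun k => ?_
  rw [Nat.factorial_succ]
  have := Nat.cast_add_one_ne_zero (R := ℂ) k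
  have := Nat.cast_ne_zero (R := ℂ).2 k.factorial_ne_zero
  push_cast
  field_simp
  exact pow_succ' z k

theorem hasSum_sq_mul_pow_div_factorial (z : ℂ) :
    HasSum (fun k : ℕ => (k : ℂ) ^ 2 * (z ^ k / k.factorial))
      (z * (z * Complex.exp z + Complex.exp z)) := by
  rw [← hasSum_nat_add_iff' 1]
  simp only [Finset.range_one, Finset.sum_singleton, Nat.cast_zero, ne_eq, OfNat.ofNat_ne_zero,
    not_false_eq_true, zero_pow, zero_mul, sub_zero]
  refine (((hasSum_mul_pow_div_factorial z).add (hasSum_pow_div_factorial z)).mul_left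
    z).congr_fun fun k => ?_
  rw [Nat.factorial_succ]
  have := Nat.cast_add_one_ne_zero (R := ℂ) k
  have := Nat.cast_ne_zero (R := ℂ).2 k.factorial_ne_zero
  push_cast
  field_simp
  exact pow_succ' z k

omit [MeasurableSpace E] in
theorem hasSum_quadForm {ι : Type} [Fintype ι] {Ks : ℕ → StrongDual ℝ E → ℂ}
    {K : StrongDual ℝ E → ℂ} (h : ∀ L, HasSum (fun k => Ks k L) (K L)) (c : ι → ℂ)
    (L : ι → StrongDual ℝ E) : HasSum (fun k => quadForm (Ks k) c L) (quadForm K c L) :=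
  hasSum_sum fun _ _ => hasSum_sum fun _ _ => (h _).mul_left _

theorem IsPosDefFun.mul_exp_charFunDual [OpensMeasurableSpace E] {K : StrongDual ℝ E → ℂ}
    (hK : IsPosDefFun K) (μ : Measure E) [IsFiniteMeasure μ] :
    IsPosDefFun fun L => K L * Complex.exp (charFunDual μ L) := by
  intro ι _ c L
  have h := hasSum_quadForm (fun L => (hasSum_pow_div_factorial (charFunDual μ L)).mul_left (K L))
    c L
  refine HasSum.nonneg (fun k => ?_) (Complex.hasSum_re h)
  have h1 := ((hK.mul_charFunDual_pow μ k).mul_const (a := (k.factorial : ℝ)⁻¹) (by positivity))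
    ι c L
  simpa only [div_eq_mul_inv, mul_assoc, Complex.ofReal_inv, Complex.ofReal_natCast] using h1

/-- The quadratic estimate for a generalised compound Poisson law. If `P̂ = K * exp N̂` with `K`
positive definite, then `P` is a Poisson mixture over `k` of the "laws" with characteristic
functions `K * N̂ ^ k`. The form of each of these is evaluated at a vector whose component at `0` is
proportional to `k`; summation over `k` gives the factor `P̂ * N̂` in the linear term. -/
theorem IsPosDefFun.quadratic_nonneg [OpensMeasurableSpace E] {K : StrongDual ℝ E → ℂ}
    (hK : IsPosDefFun K) (P N : Measure E) [IsFiniteMeasure P] [IsFiniteMeasure N]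
    (hP : ∀ L, charFunDual P L = K L * Complex.exp (charFunDual N L))
    {ι : Type} [Fintype ι] (c : ι → ℂ) (L : ι → StrongDual ℝ E) (t : ℝ) :
    0 ≤ t ^ 2 * (charFunDual P 0 * charFunDual N 0 * (charFunDual N 0 + 1)).re +
      t * (∑ i, c i * (charFunDual P (L i) * charFunDual N (L i))).re +
      t * (∑ i, conj (c i) * (charFunDual P (-L i) * charFunDual N (-L i))).re +
      (quadForm (charFunDual P) c L).re := by
  have hsum1 : HasSum (fun k : ℕ => (t : ℂ) ^ 2 * (K 0 * ((k : ℂ) ^ 2 *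
      (charFunDual N 0 ^ k / k.factorial))))
      ((t : ℂ) ^ 2 * (charFunDual P 0 * charFunDual N 0 * (charFunDual N 0 + 1))) := by
    have := ((hasSum_sq_mul_pow_div_factorial (charFunDual N 0)).mul_left (K 0)).mul_left
      ((t : ℂ) ^ 2)
    have h1 : charFunDual P 0 * charFunDual N 0 * (charFunDual N 0 + 1) =
        K 0 * (charFunDual N 0 * (charFunDual N 0 * Complex.exp (charFunDual N 0) +
          Complex.exp (charFunDual N 0))) := by
      rw [hP]
      ring
    rw [h1]
    exact this
  have hlin : ∀ L, HasSum (fun k : ℕ => K L * (k * (charFunDual N L ^ k / k.factorial)))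
      (charFunDual P L * charFunDual N L) := by
    intro L
    have := (hasSum_mul_pow_div_factorial (charFunDual N L)).mul_left (K L)
    rw [hP, mul_assoc, mul_comm (Complex.exp _)]
    exact this
  have hsum2 := (hasSum_sum fun i (_ : i ∈ Finset.univ) => (hlin (L i)).mul_left (c i)).mul_left
    (t : ℂ)
  have hsum3 := (hasSum_sum fun i (_ : i ∈ Finset.univ) =>
    (hlin (-L i)).mul_left (conj (c i))).mul_left (t : ℂ)
  have hsum4 := hasSum_quadForm (K := charFunDual P) (fun L => by
    rw [hP L]
    exact (hasSum_pow_div_factorial (charFunDual N L)).mul_left (K L)) c L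
  have hsum := Complex.hasSum_re (((hsum1.add hsum2).add hsum3).add hsum4)
  have hnn := hsum.nonneg fun k => ?_
  · have : ((t : ℂ) ^ 2 * (charFunDual P 0 * charFunDual N 0 * (charFunDual N 0 + 1))).re =
        t ^ 2 * (charFunDual P 0 * charFunDual N 0 * (charFunDual N 0 + 1)).re := by
      rw [← Complex.ofReal_pow, Complex.re_ofReal_mul]
    simpa only [Complex.add_re, this, Complex.re_ofReal_mul] using hnn
  have h1 := ((hK.mul_charFunDual_pow N k).mul_const (a := (k.factorial : ℝ)⁻¹) (by positivity))
    (Option ι) (fun o => o.elim ((k * t : ℝ) : ℂ) c) (fun o => o.elim 0 L)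
  refine h1.trans_eq (congrArg Complex.re ?_)
  simp only [quadForm, Fintype.sum_option, Option.elim_none, Option.elim_some, sub_zero, zero_sub,
    Complex.conj_ofReal, Finset.sum_add_distrib, Finset.mul_sum]
  push_cast
  have hre : ∀ {x₁ x₂ x₃ x₄ y₁ y₂ y₃ y₄ : ℂ}, x₁ = y₁ → x₂ = y₂ → x₃ = y₃ → x₄ = y₄ →
      x₁ + x₂ + (x₃ + x₄) = y₁ + y₂ + y₃ + y₄ := by
    rintro _ _ _ _ _ _ _ _ rfl rfl rfl rfl
    ring
  refine hre ?_ ?_ ?_ ?_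
  · ring
  · exact Finset.sum_congr rfl fun i _ => by ring
  · exact Finset.sum_congr rfl fun i _ => by ring
  · exact Finset.sum_congr rfl fun i _ => Finset.sum_congr rfl fun j _ => by ring

end PosDef

/-! ### Convolution with a compound Poisson part -/

section Convolution

open scoped ComplexConjugate

/-- A bounded linear functional which is given on a subspace, by its graph `W`, is represented by a
vector. -/
theorem exists_inner_eq_of_bound {X : Type*} [NormedAddCommGroup X] [InnerProductSpace ℝ X]
    [CompleteSpace X] (W : Submodule ℝ (X × ℝ)) (C : ℝ) (h : ∀ p ∈ W, |p.2| ≤ C * ‖p.1‖) :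
    ∃ y : X, ∀ p ∈ W, p.2 = inner ℝ y p.1 := by
  have h0 : ∀ p ∈ W, p.1 = 0 → p.2 = 0 := by
    intro p hp hp0
    have := h p hp
    rw [hp0, norm_zero, mul_zero] at this
    exact abs_eq_zero.1 (le_antisymm this (abs_nonneg _))
  have hg := Submodule.toLinearPMap_graph_eq W h0
  set f := W.toLinearPMap with hf
  have hbound : ∀ x : f.domain, ‖f.toFun x‖ ≤ C * ‖x‖ := by
    intro x
    exact h _ (hg ▸ LinearPMap.mem_graph f x)
  obtain ⟨g, hgext, -⟩ := exists_extension_norm_eq f.domain (f.toFun.mkContinuous C hbound)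
  refine ⟨(InnerProductSpace.toDual ℝ X).symm g, fun p hp => ?_⟩
  rw [InnerProductSpace.toDual_symm_apply]
  rw [← hg] at hp
  obtain ⟨x, hx1, hx2⟩ := (LinearPMap.mem_graph_iff f).1 hp
  rw [← hx1, hgext x, ← hx2]
  rfl

variable {E : Type*} [NormedAddCommGroup E] [NormedSpace ℝ E] [MeasurableSpace E] [BorelSpace E]

theorem charFunDual_neg (μ : Measure E) [IsFiniteMeasure μ] (L : StrongDual ℝ E) :
    charFunDual μ (-L) = conj (charFunDual μ L) := by
  rw [charFunDual_eq_cos_add_sin, charFunDual_eq_cos_add_sin]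
  simp [integral_neg, Real.cos_neg, Real.sin_neg]

theorem charFunDual_map_add {P N : Measure E} [IsFiniteMeasure P] [IsFiniteMeasure N]
    (hadd : AEMeasurable (fun z : E × E => z.1 + z.2) (P.prod N)) (L : StrongDual ℝ E) :
    charFunDual ((P.prod N).map fun z => z.1 + z.2) L = charFunDual P L * charFunDual N L := by
  rw [charFunDual_apply, charFunDual_apply, charFunDual_apply,
    integral_map hadd (by fun_prop), ← integral_prod_mul]
  refine integral_congr_ae (Filter.Eventually.of_forall fun z => ?_)
  simp only [map_add, Complex.ofReal_add, add_mul, Complex.exp_add]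

/-- Trigonometric polynomials integrated against `P * N`, where `N` is a compound Poisson component
of `P`, are controlled by their norm in `L²(P)`. -/
theorem abs_integral_trig_le {P N : Measure E} [IsFiniteMeasure P] [IsFiniteMeasure N]
    (hadd : AEMeasurable (fun z : E × E => z.1 + z.2) (P.prod N))
    {K : StrongDual ℝ E → ℂ} (hK : IsPosDefFun K)
    (hP : ∀ L, charFunDual P L = K L * Complex.exp (charFunDual N L))
    {ι : Type} [Fintype ι] (c : ι → ℂ) (L : ι → StrongDual ℝ E) (f : E → ℝ)
    (hf : ∀ x, (f x : ℂ) = ∑ i, c i * Complex.exp (L i x * Complex.I)) :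
    |∫ x, f x ∂((P.prod N).map fun z => z.1 + z.2)| ≤
      √(charFunDual P 0 * charFunDual N 0 * (charFunDual N 0 + 1)).re * √(∫ x, f x ^ 2 ∂P) := by
  set M := (P.prod N).map fun z => z.1 + z.2 with hM
  set m := ∫ x, f x ∂M with hm
  have hexp : ∀ L : StrongDual ℝ E, Integrable (fun x => Complex.exp (L x * Complex.I)) M :=
    fun L => Integrable.of_bound (by fun_prop) 1
      (Filter.Eventually.of_forall fun x => (Complex.norm_exp_ofReal_mul_I _).le)
  have h1 : ∑ i, c i * (charFunDual P (L i) * charFunDual N (L i)) = (m : ℂ) := by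
    rw [hm, ← integral_complex_ofReal]
    simp only [hf]
    rw [integral_finsetSum _ fun i _ => (hexp _).const_mul _]
    refine Finset.sum_congr rfl fun i _ => ?_
    rw [integral_const_mul, ← charFunDual_map_add hadd, charFunDual_apply]
  have h2 : ∑ i, conj (c i) * (charFunDual P (-L i) * charFunDual N (-L i)) = (m : ℂ) := by
    rw [← Complex.conj_ofReal, ← h1, map_sum]
    simp only [charFunDual_neg, map_mul]
  have h3 : quadForm (charFunDual P) c L = (∫ x, f x ^ 2 ∂P : ℝ) := by
    have := (quadForm_mul_charFunDual (fun _ => 1) P c L).2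
    simp only [one_mul] at this
    rw [this, ← integral_complex_ofReal]
    refine integral_congr_ae (Filter.Eventually.of_forall fun x => ?_)
    simp only [quadForm_one, ← hf, Complex.norm_real, Real.norm_eq_abs, sq_abs]
  -- A nonnegative quadratic polynomial has a nonpositive discriminant.
  have hq := fun t => hK.quadratic_nonneg P N hP c L t
  simp only [h1, h2, h3, Complex.ofReal_re] at hq
  have hd := discrim_le_zero (a := (charFunDual P 0 * charFunDual N 0 * (charFunDual N 0 + 1)).re)
    (b := 2 * m) (c := ∫ x, f x ^ 2 ∂P) fun t => by
      have := hq t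
      nlinarith
  rw [discrim] at hd
  rw [← Real.sqrt_mul' _ (integral_nonneg fun x => sq_nonneg _)]
  exact Real.abs_le_sqrt (by linarith)

/-- If `P` has the compound Poisson component `N`, then the convolution of `P` and `N` is dominated
by `P`, with a square integrable density. The density is the Riesz representative of integration
against the convolution, which is bounded on trigonometric polynomials. -/
theorem exists_map_add_le_withDensity [CompleteSpace E] {P N : Measure E} [IsFiniteMeasure P]
    [IsFiniteMeasure N] {F : Submodule ℝ E} (hPF : IsCarriedBy P F) (hNF : IsCarriedBy N F)
    {K : StrongDual ℝ E → ℂ} (hK : IsPosDefFun K)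
    (hP : ∀ L, charFunDual P L = K L * Complex.exp (charFunDual N L)) :
    ∃ h : Lp ℝ 2 P, (P.prod N).map (fun z => z.1 + z.2) ≤
      P.withDensity fun x => ENNReal.ofReal (h x) := by
  have hadd := hPF.aemeasurable_add hNF
  set M := (P.prod N).map fun z => z.1 + z.2 with hM
  set W : Submodule ℝ (Lp ℝ 2 P × ℝ) := Submodule.span ℝ {p | ∃ L : StrongDual ℝ E,
    (p.1 =ᵐ[P] (fun x => Real.cos (L x)) ∧ p.2 = ∫ x, Real.cos (L x) ∂M) ∨
    (p.1 =ᵐ[P] (fun x => Real.sin (L x)) ∧ p.2 = ∫ x, Real.sin (L x) ∂M)} with hW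
  -- `W` is the graph of integration against `M` on real trigonometric polynomials.
  have hrep : ∀ p ∈ W, ∃ (ι : Type) (_ : Fintype ι) (c : ι → ℂ) (L : ι → StrongDual ℝ E)
      (f : E → ℝ), (∀ x, (f x : ℂ) = ∑ i, c i * Complex.exp (L i x * Complex.I)) ∧
      Integrable f M ∧ p.1 =ᵐ[P] f ∧ p.2 = ∫ x, f x ∂M := by
    intro p hp
    induction hp using Submodule.span_induction with
    | mem p hp =>
      obtain ⟨L, ⟨h1, h2⟩ | ⟨h1, h2⟩⟩ := hp
      · refine ⟨Bool, inferInstance, fun _ => 1 / 2, fun b => if b then L else -L, _, fun x => ?_,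
          integrable_cos_dual M L, h1, h2⟩
        rw [Fintype.sum_bool, Complex.ofReal_cos, Complex.cos]
        simp only [if_true, Bool.false_eq_true, if_false, _root_.neg_apply, Complex.ofReal_neg]
        ring
      · refine ⟨Bool, inferInstance, fun b => if b then -Complex.I / 2 else Complex.I / 2,
          fun b => if b then L else -L, _, fun x => ?_, integrable_sin_dual M L, h1, h2⟩
        rw [Fintype.sum_bool, Complex.ofReal_sin, Complex.sin]
        simp only [if_true, Bool.false_eq_true, if_false, _root_.neg_apply, Complex.ofReal_neg]
        ring
    | zero =>
      refine ⟨Empty, inferInstance, fun _ => 0, fun _ => 0, fun _ => 0, fun x => by simp, by simp,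
        Lp.coeFn_zero ℝ 2 P, by simp⟩
    | add p q _ _ hp hq =>
      obtain ⟨ι, _, c, L, f, h1, h2, h3, h4⟩ := hp
      obtain ⟨ι', _, c', L', f', h1', h2', h3', h4'⟩ := hq
      refine ⟨ι ⊕ ι', inferInstance, Sum.elim c c', Sum.elim L L', fun x => f x + f' x,
        fun x => ?_, h2.add h2', ?_, ?_⟩
      · simp [Fintype.sum_sum_type, h1, h1']
      · filter_upwards [Lp.coeFn_add p.1 q.1, h3, h3'] with x e1 e2 e3
        rw [Prod.fst_add, e1, Pi.add_apply, e2, e3]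
      · rw [integral_add h2 h2', Prod.snd_add, h4, h4']
    | smul a p _ hp =>
      obtain ⟨ι, _, c, L, f, h1, h2, h3, h4⟩ := hp
      refine ⟨ι, inferInstance, fun i => a * c i, L, fun x => a * f x, fun x => ?_,
        h2.const_mul a, ?_, ?_⟩
      · simp [h1, Finset.mul_sum, mul_assoc]
      · filter_upwards [Lp.coeFn_smul a p.1, h3] with x e1 e2
        rw [Prod.smul_fst, e1, Pi.smul_apply, e2, smul_eq_mul]
      · rw [integral_const_mul, Prod.smul_snd, h4, smul_eq_mul]
  have hbound : ∀ p ∈ W, |p.2| ≤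
      √(charFunDual P 0 * charFunDual N 0 * (charFunDual N 0 + 1)).re * ‖p.1‖ := by
    intro p hp
    obtain ⟨ι, _, c, L, f, h1, h2, h3, h4⟩ := hrep p hp
    have h5 : √(∫ x, f x ^ 2 ∂P) = ‖p.1‖ := by
      rw [← Real.sqrt_sq (norm_nonneg p.1), ← real_inner_self_eq_norm_sq, L2.inner_def]
      congr 1
      refine integral_congr_ae ?_
      filter_upwards [h3] with x hx
      rw [← hx, real_inner_self_eq_norm_sq, Real.norm_eq_abs, sq_abs]
    rw [h4, ← h5]
    exact abs_integral_trig_le hadd hK hP c L f h1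
  obtain ⟨h, hh⟩ := exists_inner_eq_of_bound W _ hbound
  refine ⟨h, ?_⟩
  have hMF : IsCarriedBy M F := by
    refine ⟨hPF.isClosed, hPF.isSeparable, ?_⟩
    rw [hM, Measure.map_apply_of_aemeasurable hadd hPF.isClosed.measurableSet.compl]
    have : ∀ᵐ z ∂P.prod N, z.1 + z.2 ∈ F := by
      filter_upwards [ae_fst hPF.ae_mem, ae_snd hNF.ae_mem] with z h1 h2
      exact F.add_mem h1 h2
    exact this
  have hint : ∀ u : E → ℝ, ∀ hu : MemLp u 2 P,
      inner ℝ h (hu.toLp u) = ∫ x, h x * u x ∂P := by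
    intro u hu
    rw [L2.inner_def]
    refine integral_congr_ae ?_
    filter_upwards [hu.coeFn_toLp] with x hx
    simp [hx, mul_comm]
  rw [← add_withDensity_eq_withDensity hPF hMF ((Lp.memLp h).integrable one_le_two) (fun L => ?_)
    (fun L => ?_)]
  · exact Measure.le_add_right le_rfl
  · rw [← hint _ (memLp_cos_dual P L)]
    exact hh ((memLp_cos_dual P L).toLp _, _)
      (Submodule.subset_span ⟨L, Or.inl ⟨MemLp.coeFn_toLp (memLp_cos_dual P L), rfl⟩⟩)
  · rw [← hint _ (memLp_sin_dual P L)]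
    exact hh ((memLp_sin_dual P L).toLp _, _)
      (Submodule.subset_span ⟨L, Or.inr ⟨MemLp.coeFn_toLp (memLp_sin_dual P L), rfl⟩⟩)

end Convolution

/-! ### Lévy measures -/

section Levy

variable {E : Type*} [NormedAddCommGroup E] [NormedSpace ℝ E] [MeasurableSpace E]

variable (E) in
/-- The sets `{‖x‖ > 1 / (N + 1)}`, which increase to the complement of the origin. -/
def awaySet (N : ℕ) : Set E := {x | 1 / ((N : ℝ) + 1) < ‖x‖}

omit [NormedSpace ℝ E] [MeasurableSpace E] in
theorem monotone_awaySet : Monotone (awaySet E) := by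
  intro N M hNM x hx
  have h : (N : ℝ) + 1 ≤ (M : ℝ) + 1 := by exact_mod_cast Nat.succ_le_succ hNM
  exact (one_div_le_one_div_of_le (by positivity) h).trans_lt hx

omit [NormedSpace ℝ E] [MeasurableSpace E] in
theorem iUnion_awaySet : (⋃ N, awaySet E N) = {(0 : E)}ᶜ := by
  ext x
  simp only [awaySet, Set.mem_iUnion, Set.mem_ofPred_eq, Set.mem_compl_iff, Set.mem_singleton_iff]
  refine ⟨?_, fun hx => exists_nat_one_div_lt (norm_pos_iff.2 hx)⟩
  rintro ⟨N, hN⟩ rfl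
  rw [norm_zero] at hN
  exact absurd hN (not_lt.2 (by positivity))

omit [NormedSpace ℝ E] in
theorem measurableSet_awaySet [OpensMeasurableSpace E] (N : ℕ) : MeasurableSet (awaySet E N) :=
  (isOpen_lt continuous_const continuous_norm).measurableSet

variable {ν : Measure E}

theorem IsLevyMeasure.awaySet_lt_top (hν : IsLevyMeasure ν) (N : ℕ) : ν (awaySet E N) < ∞ :=
  hν.finite_away _ (by positivity)

theorem IsLevyMeasure.isFiniteMeasure_restrict (hν : IsLevyMeasure ν) (N : ℕ) :
    IsFiniteMeasure (ν.restrict (awaySet E N)) :=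
  ⟨by rw [Measure.restrict_apply_univ]; exact hν.awaySet_lt_top N⟩

theorem IsLevyMeasure.ae_ne_zero (hν : IsLevyMeasure ν) : ∀ᵐ x ∂ν, x ≠ 0 := by
  have h := hν.zero
  rwa [measure_eq_zero_iff_ae_notMem] at h

theorem IsLevyMeasure.sigmaFinite (hν : IsLevyMeasure ν) : SigmaFinite ν := by
  refine ⟨⟨⟨fun N => {0} ∪ awaySet E N, fun _ => trivial, fun N => ?_, ?_⟩⟩⟩
  · refine (measure_union_le _ _).trans_lt ?_
    rw [hν.zero, zero_add]
    exact hν.awaySet_lt_top N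
  · rw [← Set.union_iUnion, iUnion_awaySet, Set.union_compl_self]

variable [BorelSpace E]

theorem norm_exp_sub_one_sub_le (t : ℝ) :
    ‖Complex.exp (Complex.I * t) - 1 - Complex.I * t‖ ≤ 3 * ‖t‖ ^ 2 := by
  have hn : ‖Complex.I * (t : ℂ)‖ = ‖t‖ := by simp
  rcases le_total ‖t‖ 1 with h | h
  · have := Complex.norm_exp_sub_one_sub_id_le (hn.trans_le h)
    rw [hn] at this
    nlinarith [sq_nonneg ‖t‖]
  · have h1 : ‖Complex.exp (Complex.I * t)‖ = 1 := by
      rw [mul_comm]; exact Complex.norm_exp_ofReal_mul_I t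
    have h2 := norm_sub_le (Complex.exp (Complex.I * t) - 1) (Complex.I * t)
    have h3 := norm_sub_le (Complex.exp (Complex.I * t)) 1
    rw [hn] at h2
    rw [h1, norm_one] at h3
    nlinarith

theorem IsLevyMeasure.integrableOn_sq (hν : IsLevyMeasure ν) (L : StrongDual ℝ E) :
    IntegrableOn (fun x => ‖L x‖ ^ 2) (Metric.closedBall 0 1) ν := by
  refine ⟨by fun_prop, ?_⟩
  refine lt_of_le_of_lt (le_of_eq (lintegral_congr fun x => ?_)) (hν.sq_near_zero L)
  rw [enorm_pow, enorm_norm]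

omit [BorelSpace E] in
theorem IsLevyMeasure.measure_compl_closedBall_lt_top (hν : IsLevyMeasure ν) :
    ν (Metric.closedBall 0 1)ᶜ < ∞ := by
  refine (measure_mono fun x hx => ?_).trans_lt (hν.finite_away 1 one_pos)
  simpa using hx

theorem IsLevyMeasure.integrable_exponent (hν : IsLevyMeasure ν) (L : StrongDual ℝ E) :
    Integrable (fun x => Complex.exp (Complex.I * (L x : ℂ)) - 1
      - (Metric.closedBall (0 : E) 1).indicator (fun y => Complex.I * (L y : ℂ)) x) ν := by
  have hB : MeasurableSet (Metric.closedBall (0 : E) 1) := Metric.isClosed_closedBall.measurableSet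
  have h1 : Integrable ((Metric.closedBall (0 : E) 1).indicator fun x => 3 * ‖L x‖ ^ 2) ν :=
    IntegrableOn.integrable_indicator (Integrable.const_mul (hν.integrableOn_sq L) 3) hB
  have h2 : Integrable ((Metric.closedBall (0 : E) 1)ᶜ.indicator fun _ => (2 : ℝ)) ν :=
    (integrableOn_const hν.measure_compl_closedBall_lt_top.ne).integrable_indicator hB.compl
  refine (h1.add h2).mono' ?_ (Filter.Eventually.of_forall fun x => ?_)
  · refine AEStronglyMeasurable.sub (by fun_prop) ?_
    exact AEStronglyMeasurable.indicator (by fun_prop) hB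
  · by_cases hx : x ∈ Metric.closedBall (0 : E) 1
    · simp only [Pi.add_apply, Set.indicator_of_mem hx,
        Set.indicator_of_notMem (fun h : x ∈ (Metric.closedBall (0 : E) 1)ᶜ => h hx), add_zero]
      exact norm_exp_sub_one_sub_le (L x)
    · simp only [Pi.add_apply, Set.indicator_of_notMem hx, sub_zero, zero_add,
        Set.indicator_of_mem (show x ∈ (Metric.closedBall (0 : E) 1)ᶜ from hx)]
      refine (norm_sub_le _ _).trans ?_
      rw [mul_comm, Complex.norm_exp_ofReal_mul_I, norm_one]
      norm_num

theorem IsLevyMeasure.integrableOn_dual (hν : IsLevyMeasure ν) (L : StrongDual ℝ E) (N : ℕ) :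
    IntegrableOn (fun x => L x) (awaySet E N ∩ Metric.closedBall 0 1) ν := by
  have hfin : ν (awaySet E N ∩ Metric.closedBall 0 1) < ∞ :=
    (measure_mono Set.inter_subset_left).trans_lt (hν.awaySet_lt_top N)
  refine IntegrableOn.of_bound hfin (by fun_prop) ‖L‖ ?_
  filter_upwards [ae_restrict_mem ((measurableSet_awaySet N).inter
    Metric.isClosed_closedBall.measurableSet)] with x hx
  have h1 : ‖x‖ ≤ 1 := by simpa using hx.2
  exact (L.le_opNorm x).trans (mul_le_of_le_one_right (norm_nonneg _) h1)

/-- The Lévy–Khintchine exponent restricted to jumps away from zero. -/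
theorem IsLevyMeasure.setIntegral_exponent (hν : IsLevyMeasure ν) (L : StrongDual ℝ E)
    {N m : ℕ} (hm : N ≤ m) :
    ∫ x in awaySet E m, (Complex.exp (Complex.I * (L x : ℂ)) - 1
      - (Metric.closedBall (0 : E) 1).indicator (fun y => Complex.I * (L y : ℂ)) x) ∂ν =
    charFunDual (ν.restrict (awaySet E m \ awaySet E N)) L +
      charFunDual (ν.restrict (awaySet E N)) L - (ν.real (awaySet E m) : ℂ) -
      (∫ x in awaySet E m ∩ Metric.closedBall 0 1, L x ∂ν : ℝ) * Complex.I := by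
  have hB : MeasurableSet (Metric.closedBall (0 : E) 1) := Metric.isClosed_closedBall.measurableSet
  have := hν.isFiniteMeasure_restrict m
  have hexp : IntegrableOn (fun x => Complex.exp (Complex.I * (L x : ℂ))) (awaySet E m) ν :=
    Integrable.of_bound (by fun_prop) 1
      (Filter.Eventually.of_forall fun x => by rw [mul_comm]; exact
        (Complex.norm_exp_ofReal_mul_I _).le)
  have hone : IntegrableOn (fun _ : E => (1 : ℂ)) (awaySet E m) ν := integrable_const _
  have hind : IntegrableOn ((Metric.closedBall (0 : E) 1).indicator
      fun y => Complex.I * (L y : ℂ)) (awaySet E m) ν := by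
    rw [IntegrableOn, integrable_indicator_iff hB, IntegrableOn, Measure.restrict_restrict hB,
      Set.inter_comm]
    exact (hν.integrableOn_dual L m).ofReal.const_mul _
  have hsub : IntegrableOn (fun x => Complex.exp (Complex.I * (L x : ℂ)) - 1) (awaySet E m) ν :=
    hexp.sub hone
  rw [integral_sub hsub hind, integral_sub hexp hone, setIntegral_indicator hB,
    integral_const_mul, integral_complex_ofReal, setIntegral_const, mul_comm Complex.I]
  congr 1
  congr 1
  · rw [charFunDual_apply, charFunDual_apply, ← setIntegral_union Set.disjoint_sdiff_left
      (measurableSet_awaySet N), Set.sdiff_union_of_subset (monotone_awaySet hm)]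
    · simp only [mul_comm]
    · refine IntegrableOn.mono_set ?_ Set.sdiff_subset
      simpa only [mul_comm] using hexp
    · refine IntegrableOn.mono_set ?_ (monotone_awaySet hm)
      simpa only [mul_comm] using hexp
  · simp

/-- After removal of the jumps larger than `1 / (N + 1)`, the Lévy–Khintchine formula still
defines a positive definite function: it is a pointwise limit of characteristic functionals of
compound Poisson laws. -/
theorem IsLevyMeasure.isPosDefFun (hν : IsLevyMeasure ν) (ξ : E) (N : ℕ) :
    IsPosDefFun fun L => Complex.exp (L ξ * Complex.I) * Complex.exp (levyExponent ν L -
      charFunDual (ν.restrict (awaySet E N)) L) := by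
  refine IsPosDefFun.of_tendsto (Ks := fun m L => 1 * Complex.exp
    ((L ξ - ∫ x in awaySet E (m + N) ∩ Metric.closedBall 0 1, L x ∂ν : ℝ) * Complex.I) *
    Complex.exp (charFunDual (ν.restrict (awaySet E (m + N) \ awaySet E N)) L) *
    (Real.exp (-ν.real (awaySet E (m + N))) : ℝ)) (fun m => ?_) fun L => ?_
  · have := hν.isFiniteMeasure_restrict (m + N)
    have : IsFiniteMeasure (ν.restrict (awaySet E (m + N) \ awaySet E N)) :=
      ⟨by rw [Measure.restrict_apply_univ]
          exact (measure_mono Set.sdiff_subset).trans_lt (hν.awaySet_lt_top _)⟩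
    refine ((isPosDefFun_one.mul_char (fun L : StrongDual ℝ E =>
      L ξ - ∫ x in awaySet E (m + N) ∩ Metric.closedBall 0 1, L x ∂ν) fun L L' => ?_)
      |>.mul_exp_charFunDual _).mul_const (Real.exp_nonneg _)
    simp only [_root_.sub_apply]
    rw [integral_sub (hν.integrableOn_dual L _) (hν.integrableOn_dual L' _)]
    ring
  · have hlim : Filter.Tendsto (fun m : ℕ => ∫ x in awaySet E (m + N),
        (Complex.exp (Complex.I * (L x : ℂ)) - 1 - (Metric.closedBall (0 : E) 1).indicator
          (fun y => Complex.I * (L y : ℂ)) x) ∂ν) Filter.atTop (nhds (levyExponent ν L)) := by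
      have h := tendsto_setIntegral_of_monotone (μ := ν) (s := awaySet E)
        (f := fun x => Complex.exp (Complex.I * (L x : ℂ)) - 1 -
          (Metric.closedBall (0 : E) 1).indicator (fun y => Complex.I * (L y : ℂ)) x)
        measurableSet_awaySet monotone_awaySet (hν.integrable_exponent L).integrableOn
      rw [iUnion_awaySet, Measure.restrict_eq_self_of_ae_mem (s := {0}ᶜ) hν.ae_ne_zero] at h
      exact h.comp (Filter.tendsto_add_atTop_nat N)
    have hlim2 := ((Complex.continuous_exp.tendsto _).comp (hlim.sub_const
      (charFunDual (ν.restrict (awaySet E N)) L))).const_mul (Complex.exp (L ξ * Complex.I))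
    refine hlim2.congr fun m => ?_
    simp only [Function.comp_apply]
    rw [hν.setIntegral_exponent L (Nat.le_add_left N m), Complex.ofReal_exp, one_mul,
      ← Complex.exp_add, ← Complex.exp_add, ← Complex.exp_add]
    congr 1
    push_cast
    ring

theorem IsLevyMeasure.isProbabilityMeasure_jumpMeasure (hν : IsLevyMeasure ν) (ξ : E) :
    IsProbabilityMeasure (jumpMeasure ξ ν) := by
  have := (isGeneralisedExponential hν).isProbabilityMeasure
  exact Measure.isProbabilityMeasure_map (measurable_const_add ξ).aemeasurable

theorem IsLevyMeasure.charFunDual_jumpMeasure (hν : IsLevyMeasure ν) (ξ : E) (L : StrongDual ℝ E) :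
    charFunDual (jumpMeasure ξ ν) L =
      Complex.exp (L ξ * Complex.I) * Complex.exp (levyExponent ν L) := by
  rw [jumpMeasure, charFunDual_map_const_add, (isGeneralisedExponential hν).charFunDual_eq]
  ring

/-- The measures `γ`, `ν` and `jumpMeasure ξ ν` are carried by a common closed separable
subspace. -/
theorem IsLevyMeasure.exists_carrier (hν : IsLevyMeasure ν) (ξ : E) (γ : Measure E)
    [IsFiniteMeasure γ] [γ.InnerRegular] :
    ∃ F : Submodule ℝ E, IsCarriedBy γ F ∧ IsCarriedBy ν F ∧ IsCarriedBy (jumpMeasure ξ ν) F := by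
  have hexp := isGeneralisedExponential hν
  let μ : ℕ ⊕ Bool → Measure E := Sum.elim (fun N => ν.restrict (awaySet E N))
    fun b => if b then γ else generalisedExponential ν
  obtain ⟨F, hξ, hF⟩ := exists_common_carrier μ
    (by
      rintro (N | _ | _)
      · exact hν.isFiniteMeasure_restrict N
      · have := hexp.isProbabilityMeasure
        change IsFiniteMeasure (generalisedExponential ν)
        infer_instance
      · change IsFiniteMeasure γ
        infer_instance)
    (by
      rintro (N | _ | _)
      · exact hν.radon_away _ (by positivity)
      · exact hexp.radon
      · change γ.InnerRegular
        infer_instance) ξ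
  have hγ := hF (Sum.inr true)
  have he : generalisedExponential ν (F : Set E)ᶜ = 0 := (hF (Sum.inr false)).null
  refine ⟨F, hγ, ⟨hγ.isClosed, hγ.isSeparable, ?_⟩, ⟨hγ.isClosed, hγ.isSeparable, ?_⟩⟩
  · have h1 : ∀ N, ν ((F : Set E)ᶜ ∩ awaySet E N) = 0 := fun N => by
      rw [← Measure.restrict_apply hγ.isClosed.measurableSet.compl]
      exact (hF (Sum.inl N)).null
    have h2 : (F : Set E)ᶜ ⊆ ⋃ N, (F : Set E)ᶜ ∩ awaySet E N := by
      rw [← Set.inter_iUnion, iUnion_awaySet]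
      refine fun x hx => ⟨hx, fun h0 => hx ?_⟩
      rw [Set.mem_singleton_iff.1 h0]
      exact F.zero_mem
    exact measure_mono_null h2 (measure_iUnion_null h1)
  · rw [jumpMeasure, Measure.map_apply (measurable_const_add ξ) hγ.isClosed.measurableSet.compl]
    refine measure_mono_null (t := (F : Set E)ᶜ) (fun x hx hxF => hx ?_) he
    exact F.add_mem hξ hxF

/-- The law of `X + Y`, for `X` with law `π` and an independent jump `Y` away from zero, is
dominated by a measure with a square integrable density with respect to `π`. By the Mecke formula
the density of the law is the conditional expectation of the number of such jumps in `X`. -/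
theorem IsLevyMeasure.exists_map_add_le [CompleteSpace E] (hν : IsLevyMeasure ν) (ξ : E) (N : ℕ)
    {F : Submodule ℝ E} (hνF : IsCarriedBy ν F) (hπF : IsCarriedBy (jumpMeasure ξ ν) F) :
    ∃ h : Lp ℝ 2 (jumpMeasure ξ ν),
      ((jumpMeasure ξ ν).prod (ν.restrict (awaySet E N))).map (fun z => z.1 + z.2) ≤
        (jumpMeasure ξ ν).withDensity fun x => ENNReal.ofReal (h x) := by
  have := hν.isFiniteMeasure_restrict N
  have := hν.isProbabilityMeasure_jumpMeasure ξ
  refine exists_map_add_le_withDensity hπF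
    (hνF.of_absolutelyContinuous Measure.absolutelyContinuous_restrict) (hν.isPosDefFun ξ N)
    fun L => ?_
  rw [hν.charFunDual_jumpMeasure, mul_assoc, ← Complex.exp_add (levyExponent ν L - _),
    sub_add_cancel]

end Levy

/-! ### The Poissonian derivative -/

section Poisson

variable {E : Type*} [NormedAddCommGroup E] [MeasurableSpace E]

/-- What the Poissonian derivative needs to know about the law `π` of a random vector and the
intensity `ν` of its jumps: adding a jump away from zero is a measurable operation, and the
resulting law is dominated by a measure with a square integrable density with respect to `π`. -/
structure IsMeckePair (π ν : Measure E) : Prop where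
  lt_top : ∀ N, ν (awaySet E N) < ∞
  ae_ne_zero : ∀ᵐ y ∂ν, y ≠ 0
  aemeasurable_add : AEMeasurable (fun z : E × E => z.1 + z.2) (π.prod ν)
  exists_density : ∀ N, ∃ h : Lp ℝ 2 π, (π.prod (ν.restrict (awaySet E N))).map
    (fun z => z.1 + z.2) ≤ π.withDensity fun x => ENNReal.ofReal (h x)

variable (E) in
/-- The Hilbert space elements of bounded functions that vanish near the origin. -/
def boundedAway (ν : Measure E) : Submodule ℝ (Lp ℝ 2 ν) where
  carrier := {u | ∃ (N : ℕ) (C : ℝ), ∀ᵐ y ∂ν, |u y| ≤ C ∧ (y ∉ awaySet E N → u y = 0)}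
  add_mem' := by
    rintro u v ⟨N, C, hu⟩ ⟨M, C', hv⟩
    refine ⟨max N M, C + C', ?_⟩
    filter_upwards [hu, hv, Lp.coeFn_add u v] with y h1 h2 h3
    rw [h3, Pi.add_apply]
    refine ⟨(abs_add_le _ _).trans (add_le_add h1.1 h2.1), fun hy => ?_⟩
    rw [h1.2 fun h => hy (monotone_awaySet (le_max_left N M) h),
      h2.2 fun h => hy (monotone_awaySet (le_max_right N M) h), add_zero]
  zero_mem' := by
    refine ⟨0, 0, ?_⟩
    filter_upwards [Lp.coeFn_zero ℝ 2 ν] with y hy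
    exact ⟨le_of_eq (abs_eq_zero.2 hy), fun _ => hy⟩
  smul_mem' := by
    rintro c u ⟨N, C, hu⟩
    refine ⟨N, |c| * C, ?_⟩
    filter_upwards [hu, Lp.coeFn_smul c u] with y h1 h2
    rw [h2, Pi.smul_apply, smul_eq_mul, abs_mul]
    exact ⟨mul_le_mul_of_nonneg_left h1.1 (abs_nonneg c), fun hy => by rw [h1.2 hy, mul_zero]⟩

variable {π ν : Measure E} [OpensMeasurableSpace E]

theorem dense_boundedAway (h0 : ∀ᵐ y ∂ν, y ≠ 0) :
    Dense (boundedAway E ν : Set (Lp ℝ 2 ν)) := by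
  rw [Submodule.dense_iff_topologicalClosure_eq_top, Submodule.topologicalClosure_eq_top_iff,
    Submodule.eq_bot_iff]
  intro v hv
  have hvm := (Lp.stronglyMeasurable v).measurable
  have key : ∀ N : ℕ, ∀ᵐ y ∂ν, y ∈ awaySet E N → |v y| ≤ N → v y = 0 := by
    intro N
    set S : Set E := awaySet E N ∩ {y | |v y| ≤ N} with hS
    have hSm : MeasurableSet S :=
      (measurableSet_awaySet N).inter (measurableSet_le hvm.abs measurable_const)
    have hmem : MemLp (S.indicator v) 2 ν := (Lp.memLp v).indicator hSm
    have hu : hmem.toLp _ ∈ boundedAway E ν := by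
      refine ⟨N, N, ?_⟩
      filter_upwards [hmem.coeFn_toLp] with y hy
      rw [hy]
      refine ⟨?_, fun h => Set.indicator_of_notMem (fun hyS => h hyS.1) _⟩
      by_cases hyS : y ∈ S
      · rw [Set.indicator_of_mem hyS]; exact hyS.2
      · rw [Set.indicator_of_notMem hyS]; simp
    have h1 := (Submodule.mem_orthogonal _ _).1 hv _ hu
    rw [L2.inner_def] at h1
    have h2 : ∫ y, S.indicator (fun y => v y ^ 2) y ∂ν = 0 := by
      rw [← h1]
      refine integral_congr_ae ?_
      filter_upwards [hmem.coeFn_toLp] with y hy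
      rw [hy]
      by_cases hyS : y ∈ S <;> simp [hyS, sq]
    have h3 : Integrable (S.indicator fun y => v y ^ 2) ν :=
      ((memLp_two_iff_integrable_sq (Lp.aestronglyMeasurable v)).1 (Lp.memLp v)).indicator hSm
    rw [integral_eq_zero_iff_of_nonneg
      (fun y => Set.indicator_nonneg (fun y _ => sq_nonneg (v y)) y) h3] at h2
    filter_upwards [h2] with y hy hyN hyv
    have hyS : y ∈ S := ⟨hyN, hyv⟩
    rw [Set.indicator_of_mem hyS] at hy
    exact pow_eq_zero_iff two_ne_zero |>.1 hy
  refine (Lp.eq_zero_iff_ae_eq_zero).2 ?_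
  filter_upwards [ae_all_iff.2 key, h0] with y hy hy0
  have h1 : y ∈ ⋃ N, awaySet E N := by rw [iUnion_awaySet]; exact hy0
  obtain ⟨N, hN⟩ := Set.mem_iUnion.1 h1
  obtain ⟨M, hM⟩ := exists_nat_ge |v y|
  refine hy (max N M) (monotone_awaySet (le_max_left N M) hN) (hM.trans ?_)
  exact_mod_cast le_max_right N M

variable [IsProbabilityMeasure π] [SigmaFinite ν]

omit [IsProbabilityMeasure π] [OpensMeasurableSpace E] in
theorem prod_restrict_away (N : ℕ) [SFinite π] :
    (π.prod ν).restrict (Set.univ ×ˢ awaySet E N) = π.prod (ν.restrict (awaySet E N)) := by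
  rw [← Measure.prod_restrict, Measure.restrict_univ]

omit [OpensMeasurableSpace E] in
theorem IsMeckePair.aemeasurable_add_restrict (h : IsMeckePair π ν) (N : ℕ) :
    AEMeasurable (fun z : E × E => z.1 + z.2) (π.prod (ν.restrict (awaySet E N))) := by
  rw [← prod_restrict_away]
  exact h.aemeasurable_add.restrict

/-- Properties that hold almost surely persist after adding a jump. In particular `f (x + y)` only
depends on the class of `f`. -/
theorem IsMeckePair.ae_add (h : IsMeckePair π ν) {p : E → Prop} (hp : ∀ᵐ x ∂π, p x) :
    ∀ᵐ z ∂π.prod ν, p (z.1 + z.2) := by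
  have h1 : ∀ N : ℕ, ∀ᵐ z ∂π.prod ν, z ∈ Set.univ ×ˢ awaySet E N → p (z.1 + z.2) := by
    intro N
    rw [← ae_restrict_iff' (MeasurableSet.univ.prod (measurableSet_awaySet N)), prod_restrict_away]
    obtain ⟨k, hk⟩ := h.exists_density N
    refine ae_of_ae_map (h.aemeasurable_add_restrict N) ?_
    exact ((Measure.absolutelyContinuous_of_le hk).trans
      (withDensity_absolutelyContinuous _ _)).ae_le hp
  filter_upwards [ae_all_iff.2 h1, ae_snd h.ae_ne_zero] with z hz hz0
  have h2 : z.2 ∈ ⋃ N, awaySet E N := by rw [iUnion_awaySet]; exact hz0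
  obtain ⟨N, hN⟩ := Set.mem_iUnion.1 h2
  exact hz N ⟨trivial, hN⟩

omit [OpensMeasurableSpace E] in
/-- Adding a jump away from zero is bounded from `L²(π)` to `L¹`. -/
theorem IsMeckePair.exists_bound (h : IsMeckePair π ν) (N : ℕ) :
    ∃ C : ℝ, ∀ f : Lp ℝ 2 π,
      Integrable (fun z : E × E => f (z.1 + z.2)) (π.prod (ν.restrict (awaySet E N))) ∧
      ∫ z, |f (z.1 + z.2)| ∂π.prod (ν.restrict (awaySet E N)) ≤ C * ‖f‖ := by
  obtain ⟨k, hk⟩ := h.exists_density N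
  have hadd := h.aemeasurable_add_restrict N
  have hkint := (Lp.memLp k).integrable (q := 2) one_le_two
  have hkm : MemLp (fun x => max (k x) 0) 2 π := (Lp.memLp k).pos_part
  refine ⟨‖hkm.toLp _‖, fun f => ?_⟩
  have hfw : Integrable f (π.withDensity fun x => ENNReal.ofReal (k x)) := by
    rw [integrable_withDensity_iff_integrable_smul₀' hkint.aemeasurable.ennreal_ofReal
      (Filter.Eventually.of_forall fun _ => ENNReal.ofReal_lt_top)]
    simp only [ENNReal.toReal_ofReal', smul_eq_mul]
    exact hkm.integrable_mul (Lp.memLp f)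
  have hfM := hfw.mono_measure hk
  have hfadd := (integrable_map_measure hfM.1 hadd).1 hfM
  refine ⟨hfadd, ?_⟩
  calc ∫ z, |f (z.1 + z.2)| ∂π.prod (ν.restrict (awaySet E N))
      = ∫ x, |f x| ∂(π.prod (ν.restrict (awaySet E N))).map fun z => z.1 + z.2 :=
        (integral_map hadd hfM.abs.1).symm
    _ ≤ ∫ x, |f x| ∂π.withDensity fun x => ENNReal.ofReal (k x) :=
        integral_mono_measure hk (Filter.Eventually.of_forall fun _ => abs_nonneg _) hfw.abs
    _ = inner ℝ (hkm.toLp _) ((Lp.memLp f).abs.toLp _) := by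
        rw [integral_withDensity_ofReal π hkint, L2.inner_def]
        refine integral_congr_ae ?_
        filter_upwards [hkm.coeFn_toLp, (Lp.memLp f).abs.coeFn_toLp] with x h1 h2
        rw [h1, h2]
        simp [mul_comm]
    _ ≤ ‖hkm.toLp _‖ * ‖(Lp.memLp f).abs.toLp _‖ := real_inner_le_norm _ _
    _ = ‖hkm.toLp _‖ * ‖f‖ := by
        congr 1
        rw [Lp.norm_toLp, Lp.norm_def]
        congr 1
        exact eLpNorm_norm (f := (f : E → ℝ))

/-- The adjoint of `f ↦ f (x + y)` is defined at `φ ⊗ u`, for `φ` bounded and `u` bounded and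
vanishing near zero. -/
theorem IsMeckePair.exists_adjoint_add (h : IsMeckePair π ν) {φ : Lp ℝ 2 π} {B : ℝ}
    (hφ : ∀ᵐ x ∂π, |φ x| ≤ B) {u : Lp ℝ 2 ν} (hu : u ∈ boundedAway E ν) :
    ∃ χ : Lp ℝ 2 π, ∀ f : Lp ℝ 2 π,
      Integrable (fun z : E × E => f (z.1 + z.2) * (φ z.1 * u z.2)) (π.prod ν) ∧
      ∫ z, f (z.1 + z.2) * (φ z.1 * u z.2) ∂π.prod ν = inner ℝ f χ := by
  obtain ⟨N, C, hu⟩ := hu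
  obtain ⟨A, hA⟩ := h.exists_bound N
  set S : Set (E × E) := Set.univ ×ˢ awaySet E N with hS
  have hSm : MeasurableSet S := MeasurableSet.univ.prod (measurableSet_awaySet N)
  have hw : ∀ᵐ z ∂π.prod ν, |φ z.1 * u z.2| ≤ |B * C| := by
    filter_upwards [ae_fst hφ, ae_snd hu] with z h1 h2
    rw [abs_mul, abs_mul]
    exact mul_le_mul (h1.trans (le_abs_self B)) (h2.1.trans (le_abs_self C)) (abs_nonneg _)
      (abs_nonneg _)
  have hwm : AEStronglyMeasurable (fun z : E × E => φ z.1 * u z.2) (π.prod ν) :=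
    (Lp.aestronglyMeasurable (lpProd π ν φ u)).congr (coeFn_lpProd φ u)
  have hzero : ∀ f : Lp ℝ 2 π, ∀ᵐ z ∂π.prod ν, z ∉ S → f (z.1 + z.2) * (φ z.1 * u z.2) = 0 := by
    intro f
    filter_upwards [ae_snd hu] with z h2 hz
    rw [h2.2 fun h => hz ⟨trivial, h⟩, mul_zero, mul_zero]
  have hintS : ∀ f : Lp ℝ 2 π,
      IntegrableOn (fun z : E × E => f (z.1 + z.2) * (φ z.1 * u z.2)) S (π.prod ν) := by
    intro f
    have h1 : IntegrableOn (fun z : E × E => f (z.1 + z.2)) S (π.prod ν) := by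
      rw [IntegrableOn, prod_restrict_away]
      exact (hA f).1
    exact h1.mul_bdd (c := |B * C|) hwm.restrict (ae_restrict_of_ae hw)
  have hint : ∀ f : Lp ℝ 2 π,
      Integrable (fun z : E × E => f (z.1 + z.2) * (φ z.1 * u z.2)) (π.prod ν) := fun f =>
    (hintS f).integrable_of_ae_notMem_eq_zero (hzero f)
  -- The adjoint value is the Riesz representative of the bounded functional `T`.
  let T : Lp ℝ 2 π →ₗ[ℝ] ℝ :=
    { toFun := fun f => ∫ z, f (z.1 + z.2) * (φ z.1 * u z.2) ∂π.prod ν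
      map_add' := fun f g => by
        rw [← integral_add (hint f) (hint g)]
        refine integral_congr_ae ?_
        filter_upwards [h.ae_add (Lp.coeFn_add f g)] with z hz
        rw [hz, Pi.add_apply, add_mul]
      map_smul' := fun c f => by
        rw [RingHom.id_apply, smul_eq_mul, ← integral_const_mul]
        refine integral_congr_ae ?_
        filter_upwards [h.ae_add (Lp.coeFn_smul c f)] with z hz
        rw [hz, Pi.smul_apply, smul_eq_mul, mul_assoc] }
  have hT : ∀ f, ‖T f‖ ≤ |B * C| * A * ‖f‖ := by
    intro f
    calc ‖T f‖ = ‖∫ z in S, f (z.1 + z.2) * (φ z.1 * u z.2) ∂π.prod ν‖ := by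
          rw [setIntegral_eq_integral_of_ae_compl_eq_zero (hzero f)]
          rfl
      _ ≤ ∫ z in S, |B * C| * |f (z.1 + z.2)| ∂π.prod ν := by
          refine norm_integral_le_of_norm_le ?_ ?_
          · rw [prod_restrict_away]
            exact (hA f).1.abs.const_mul _
          · filter_upwards [ae_restrict_of_ae hw] with z hz
            rw [norm_mul, mul_comm]
            exact mul_le_mul_of_nonneg_right hz (norm_nonneg _)
      _ ≤ |B * C| * (A * ‖f‖) := by
          rw [integral_const_mul, prod_restrict_away]
          exact mul_le_mul_of_nonneg_left (hA f).2 (abs_nonneg _)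
      _ = |B * C| * A * ‖f‖ := by ring
  refine ⟨(InnerProductSpace.toDual ℝ _).symm (T.mkContinuous _ hT), fun f => ⟨hint f, ?_⟩⟩
  rw [real_inner_comm, InnerProductSpace.toDual_symm_apply]
  rfl

/-- The adjoint of the Poissonian derivative is defined at `φ ⊗ u`, for `φ` bounded and `u` bounded
and vanishing near zero. -/
theorem IsMeckePair.lpProd_mem_adjointDomain (h : IsMeckePair π ν) {φ : Lp ℝ 2 π} {B : ℝ}
    (hφ : ∀ᵐ x ∂π, |φ x| ≤ B) {u : Lp ℝ 2 ν} (hu : u ∈ boundedAway E ν) :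
    lpProd π ν φ u ∈ adjointDomain (poissonGraph π ν) := by
  obtain ⟨χ, hχ⟩ := h.exists_adjoint_add hφ hu
  have huint : Integrable u ν := by
    obtain ⟨N, C, hu⟩ := hu
    have : IsFiniteMeasure (ν.restrict (awaySet E N)) :=
      ⟨by rw [Measure.restrict_apply_univ]; exact h.lt_top N⟩
    refine IntegrableOn.integrable_of_ae_notMem_eq_zero (s := awaySet E N)
      (((Lp.memLp u).restrict _).integrable one_le_two) ?_
    filter_upwards [hu] with y hy using hy.2
  refine mem_adjointDomain_span (χ - (∫ y, u y ∂ν) • φ) ?_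
  rintro p ⟨f, hf1, hf2⟩
  have h1 : Integrable (fun z : E × E => p.1 z.1 * φ z.1 * u z.2) (π.prod ν) :=
    ((Lp.memLp p.1).integrable_mul (Lp.memLp φ)).mul_prod huint
  have h2 : inner ℝ p.2 (lpProd π ν φ u) = ∫ z, (p.1 (z.1 + z.2) * (φ z.1 * u z.2) -
      p.1 z.1 * φ z.1 * u z.2) ∂π.prod ν := by
    rw [L2.inner_def]
    refine integral_congr_ae ?_
    filter_upwards [hf2, h.ae_add hf1, ae_fst hf1, coeFn_lpProd φ u] with z e1 e2 e3 e4
    rw [e1, e2, e3, e4]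
    simp only [RCLike.inner_apply, conj_trivial]
    ring
  have h3 : inner ℝ p.1 φ = ∫ x, p.1 x * φ x ∂π := by
    rw [L2.inner_def]
    refine integral_congr_ae (Filter.Eventually.of_forall fun x => ?_)
    simp [mul_comm]
  rw [h2, integral_sub (hχ p.1).1 h1, (hχ p.1).2,
    integral_prod_mul (fun x => p.1 x * φ x) (fun y => u y), inner_sub_right, inner_smul_right, h3,
    mul_comm (∫ y, u y ∂ν)]

variable [NormedSpace ℝ E]

omit [OpensMeasurableSpace E] in
theorem ae_abs_le_one_of_mem_trigSet {μ : Measure E} {φ : Lp ℝ 2 μ} (hφ : φ ∈ trigSet μ) :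
    ∀ᵐ x ∂μ, |φ x| ≤ 1 := by
  obtain ⟨L, hL | hL⟩ := hφ
  · filter_upwards [hL] with x hx
    rw [hx]; exact Real.abs_cos_le_one _
  · filter_upwards [hL] with x hx
    rw [hx]; exact Real.abs_sin_le_one _

theorem IsMeckePair.isClosableGraph_poissonGraph (h : IsMeckePair π ν)
    (hπ : Dense (Submodule.span ℝ (trigSet π) : Set (Lp ℝ 2 π))) :
    IsClosableGraph (poissonGraph π ν) := by
  refine isClosableGraph_of_dense_adjointDomain (dense_of_span_dense_subset
    (dense_span_lpProd hπ (T := boundedAway E ν) ?_) ?_)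
  · rw [Submodule.span_eq]
    exact dense_boundedAway h.ae_ne_zero
  · rintro _ ⟨φ, hφ, u, hu, rfl⟩
    exact h.lpProd_mem_adjointDomain (ae_abs_le_one_of_mem_trigSet hφ) hu

omit [OpensMeasurableSpace E] [IsProbabilityMeasure π] [SigmaFinite ν] in
theorem IsLevyMeasure.isMeckePair [BorelSpace E] [CompleteSpace E] (hν : IsLevyMeasure ν) (ξ : E)
    {F : Submodule ℝ E} (hνF : IsCarriedBy ν F) (hπF : IsCarriedBy (jumpMeasure ξ ν) F) :
    IsMeckePair (jumpMeasure ξ ν) ν := by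
  have := hν.sigmaFinite
  have := hν.isProbabilityMeasure_jumpMeasure ξ
  exact ⟨hν.awaySet_lt_top, hν.ae_ne_zero, hπF.aemeasurable_add hνF,
    fun N => hν.exists_map_add_le ξ N hνF hπF⟩

/-- Trigonometric functions belong to the domain of the Poissonian derivative, because
`|cos a - cos b|` and `|sin a - sin b|` are at most `min 2 |a - b|`. -/
theorem IsLevyMeasure.trigSet_subset_domain [BorelSpace E] (hν : IsLevyMeasure ν) {f : Lp ℝ 2 π}
    (hf : f ∈ trigSet π) : f ∈ (poissonDerivative π ν).domain := by
  have key : ∀ (u : ℝ → ℝ), Measurable u → (∀ t, |u t| ≤ 1) → (∀ s t, |u s - u t| ≤ |s - t|) →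
      ∀ L : StrongDual ℝ E, f =ᵐ[π] (fun x => u (L x)) → f ∈ (poissonDerivative π ν).domain := by
    intro u hum hu1 hu2 L hL
    have hB : MeasurableSet (Metric.closedBall (0 : E) 1) :=
      Metric.isClosed_closedBall.measurableSet
    have hg1 : MemLp ((Metric.closedBall (0 : E) 1).indicator fun y => |L y|) 2 ν := by
      rw [memLp_indicator_iff_restrict hB, memLp_two_iff_integrable_sq_norm (by fun_prop)]
      have := hν.integrableOn_sq L
      simpa [IntegrableOn] using this
    have hg2 : MemLp ((Metric.closedBall (0 : E) 1)ᶜ.indicator fun _ => (2 : ℝ)) 2 ν :=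
      memLp_indicator_const 2 hB.compl 2 (Or.inr hν.measure_compl_closedBall_lt_top.ne)
    have hg := memLp_prod_smul' (μ := π) (memLp_const (1 : ℝ)) (hg1.add hg2)
    have hmem : MemLp (fun z : E × E => u (L (z.1 + z.2)) - u (L z.1)) 2 (π.prod ν) := by
      refine hg.mono ?_ (Filter.Eventually.of_forall fun z => ?_)
      · simp only [map_add]
        have h1 : Measurable fun z : E × E => L z.1 := L.measurable.comp measurable_fst
        have h2 : Measurable fun z : E × E => L z.2 := L.measurable.comp measurable_snd
        exact ((hum.comp (h1.add h2)).sub (hum.comp h1)).aestronglyMeasurable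
      · rw [one_smul, Real.norm_eq_abs, Real.norm_eq_abs]
        refine le_trans ?_ (le_abs_self _)
        by_cases hz : z.2 ∈ Metric.closedBall (0 : E) 1
        · rw [Pi.add_apply, Set.indicator_of_mem hz,
            Set.indicator_of_notMem (fun h : z.2 ∈ (Metric.closedBall (0 : E) 1)ᶜ => h hz),
            add_zero]
          refine (hu2 _ _).trans (le_of_eq ?_)
          rw [map_add, add_sub_cancel_left]
        · rw [Pi.add_apply, Set.indicator_of_notMem hz,
            Set.indicator_of_mem (show z.2 ∈ (Metric.closedBall (0 : E) 1)ᶜ from hz), zero_add]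
          have := abs_sub (u (L (z.1 + z.2))) (u (L z.1))
          linarith [hu1 (L (z.1 + z.2)), hu1 (L z.1)]
    exact mem_closedOperator_domain (p := (f, hmem.toLp _))
      (Submodule.subset_span ⟨fun x => u (L x), hL, hmem.coeFn_toLp⟩)
  obtain ⟨L, hL | hL⟩ := hf
  · exact key Real.cos Real.measurable_cos Real.abs_cos_le_one Real.abs_cos_sub_cos_le L hL
  · exact key Real.sin Real.measurable_sin Real.abs_sin_le_one Real.abs_sin_sub_sin_le L hL

end Poisson

/-! ### Gaussian integration by parts -/

section GaussianIBP

/-- Integration by parts for a centred normal variable. -/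
theorem integral_id_mul_gaussianReal {v : NNReal} (hv : v ≠ 0) {u u' : ℝ → ℝ} {C : ℝ}
    (hu : ∀ s, HasDerivAt u (u' s) s) (hu' : Continuous u') (hC : ∀ s, |u s| ≤ C)
    (hC' : ∀ s, |u' s| ≤ C) :
    ∫ s, s * u s ∂gaussianReal 0 v = v * ∫ s, u' s ∂gaussianReal 0 v := by
  have hv0 : (v : ℝ) ≠ 0 := by exact_mod_cast hv
  have huc : Continuous u := continuous_iff_continuousAt.2 fun s => (hu s).continuousAt
  set ρ : ℝ → ℝ := gaussianPDFReal 0 v with hρ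
  have hρi : Integrable ρ := integrable_gaussianPDFReal 0 v
  have hρ' : ∀ s, HasDerivAt ρ (-(s / v) * ρ s) s := by
    intro s
    have h1 : HasDerivAt (fun s : ℝ => -(s - 0) ^ 2 / (2 * (v : ℝ))) (-(s / v)) s := by
      have := (((hasDerivAt_id s).sub_const 0).pow 2).neg.div_const (2 * (v : ℝ))
      refine this.congr_deriv ?_
      simp
      field_simp
    have h2 := (h1.exp).const_mul (√(2 * Real.pi * v))⁻¹
    refine h2.congr_deriv ?_
    simp only [hρ, gaussianPDFReal]
    ring
  have hsρ : Integrable fun s => s * ρ s := by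
    have h := (memLp_id_gaussianReal (μ := 0) (v := v) 1).integrable le_rfl
    rw [gaussianReal_of_var_ne_zero 0 hv, integrable_withDensity_iff_integrable_smul'
      (measurable_gaussianPDF 0 v) (Filter.Eventually.of_forall fun _ => gaussianPDF_lt_top)] at h
    refine h.congr (Filter.Eventually.of_forall fun s => ?_)
    simp [hρ, mul_comm]
  have key := integral_mul_deriv_eq_deriv_mul_of_integrable (u := u) (u' := u') (v := ρ)
    (v' := fun s => -(s / v) * ρ s) (fun s _ => hu s) (fun s _ => hρ' s) ?_ ?_ ?_
  · rw [integral_gaussianReal_eq_integral_smul hv, integral_gaussianReal_eq_integral_smul hv]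
    have h1 : ∫ s, ρ s • u' s = ∫ s, u' s * ρ s :=
      integral_congr_ae (Filter.Eventually.of_forall fun s => mul_comm _ _)
    rw [h1, ← neg_eq_iff_eq_neg.2 key, ← integral_neg, ← integral_const_mul]
    refine integral_congr_ae (Filter.Eventually.of_forall fun s => ?_)
    simp only [smul_eq_mul, ← hρ]
    field_simp
  · refine ((hsρ.const_mul (-(v : ℝ)⁻¹)).bdd_mul (c := C) huc.aestronglyMeasurable
      (Filter.Eventually.of_forall hC)).congr (Filter.Eventually.of_forall fun s => ?_)
    simp only [Pi.mul_apply]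
    field_simp
  · exact hρi.bdd_mul (c := C) hu'.aestronglyMeasurable (Filter.Eventually.of_forall hC')
  · exact hρi.bdd_mul (c := C) huc.aestronglyMeasurable (Filter.Eventually.of_forall hC)

variable {E : Type*} [NormedAddCommGroup E] [NormedSpace ℝ E] [MeasurableSpace E] [BorelSpace E]
  {γ : Measure E} [IsGaussian γ]

omit [BorelSpace E] in
theorem integrable_cexp_lp (w : Lp ℝ 2 γ) :
    Integrable (fun x => Complex.exp ((w x : ℂ) * Complex.I)) γ :=
  Integrable.of_bound (Complex.continuous_exp.comp_aestronglyMeasurable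
    ((Complex.continuous_ofReal.comp_aestronglyMeasurable (Lp.aestronglyMeasurable w)).mul_const _))
    1 (Filter.Eventually.of_forall fun x => by rw [Complex.norm_exp_ofReal_mul_I])

/-- The elements of the first chaos are centred normal variables. -/
theorem integral_cexp_of_mem_firstChaos (hγ : ∀ L : StrongDual ℝ E, ∫ x, L x ∂γ = 0)
    {w : Lp ℝ 2 γ} (hw : w ∈ firstChaos γ) :
    ∫ x, Complex.exp ((w x : ℂ) * Complex.I) ∂γ = Complex.exp (-(‖w‖ ^ 2 / 2 : ℝ)) := by
  have hspan : Submodule.span ℝ {F : Lp ℝ 2 γ | ∃ L : StrongDual ℝ E, F =ᵐ[γ] L} ≤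
      { carrier := {F : Lp ℝ 2 γ | ∃ L : StrongDual ℝ E, F =ᵐ[γ] L}
        add_mem' := fun {F G} ⟨L, hL⟩ ⟨M, hM⟩ => ⟨L + M, by
          filter_upwards [hL, hM, Lp.coeFn_add F G] with x h1 h2 h3
          rw [h3, Pi.add_apply, h1, h2]; rfl⟩
        zero_mem' := ⟨0, Lp.coeFn_zero ℝ 2 γ⟩
        smul_mem' := fun c F ⟨L, hL⟩ => ⟨c • L, by
          filter_upwards [hL, Lp.coeFn_smul c F] with x h1 h2
          rw [h2, Pi.smul_apply, h1]; rfl⟩ } := Submodule.span_le.2 fun F hF => hF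
  have hlip : ∀ w w' : Lp ℝ 2 γ, ‖(∫ x, Complex.exp ((w x : ℂ) * Complex.I) ∂γ) -
      ∫ x, Complex.exp ((w' x : ℂ) * Complex.I) ∂γ‖ ≤ 1 * ‖w - w'‖ := by
    intro w w'
    rw [← integral_sub (integrable_cexp_lp w) (integrable_cexp_lp w'), one_mul]
    calc ‖∫ x, (Complex.exp ((w x : ℂ) * Complex.I) - Complex.exp ((w' x : ℂ) * Complex.I)) ∂γ‖
        ≤ ∫ x, ‖(w - w') x‖ ∂γ := by
          refine norm_integral_le_of_norm_le ((Lp.memLp (w - w')).integrable one_le_two).norm ?_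
          filter_upwards [Lp.coeFn_sub w w'] with x hx
          have h1 : Complex.exp ((w x : ℂ) * Complex.I) - Complex.exp ((w' x : ℂ) * Complex.I) =
              Complex.exp ((w' x : ℂ) * Complex.I) *
                (Complex.exp (Complex.I * ((w x - w' x : ℝ) : ℂ)) - 1) := by
            rw [mul_sub, mul_one, ← Complex.exp_add]
            congr 2
            push_cast
            ring
          rw [h1, norm_mul, Complex.norm_exp_ofReal_mul_I, one_mul, hx]
          exact Real.norm_exp_I_mul_ofReal_sub_one_le
      _ = ‖∫ x, ‖(w - w') x‖ ∂γ‖ := by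
          rw [Real.norm_of_nonneg (integral_nonneg fun _ => norm_nonneg _)]
      _ ≤ ‖w - w'‖ := by
          have h := (Lp.memLp (w - w')).norm
          have h2 : ∫ x, ‖(w - w') x‖ ∂γ = inner ℝ (indicatorConstLp 2 MeasurableSet.univ
              (measure_ne_top γ _) (1 : ℝ)) (h.toLp _) := by
            rw [L2.inner_def]
            refine integral_congr_ae ?_
            filter_upwards [h.coeFn_toLp, indicatorConstLp_coeFn (p := 2)
              (hs := MeasurableSet.univ) (hμs := measure_ne_top γ _) (c := (1 : ℝ))] with x h1 h2
            rw [h1, h2]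
            simp
          rw [h2]
          refine (norm_inner_le_norm _ _).trans ?_
          rw [norm_indicatorConstLp (by simp) (by simp), Lp.norm_toLp, eLpNorm_norm, ← Lp.norm_def]
          simp
  have hcont : Continuous fun w : Lp ℝ 2 γ => ∫ x, Complex.exp ((w x : ℂ) * Complex.I) ∂γ :=
    (LipschitzWith.of_dist_le_mul (K := 1) fun w w' => by
      rw [dist_eq_norm, dist_eq_norm]; exact hlip w w').continuous
  have hcont' : Continuous fun w : Lp ℝ 2 γ => Complex.exp (-(‖w‖ ^ 2 / 2 : ℝ)) := by fun_prop
  refine closure_minimal (t := {w : Lp ℝ 2 γ | ∫ x, Complex.exp ((w x : ℂ) * Complex.I) ∂γ =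
    Complex.exp (-(‖w‖ ^ 2 / 2 : ℝ))}) ?_ (isClosed_eq hcont hcont') hw
  intro F hF
  obtain ⟨L, hL⟩ := hspan hF
  have h1 : ∫ x, Complex.exp ((F x : ℂ) * Complex.I) ∂γ = charFunDual γ L := by
    rw [charFunDual_apply]
    refine integral_congr_ae ?_
    filter_upwards [hL] with x hx
    rw [hx]
  have h2 : Var[L; γ] = ‖F‖ ^ 2 := by
    rw [variance_of_integral_eq_zero (by fun_prop) (hγ L), ← real_inner_self_eq_norm_sq,
      L2.inner_def]
    refine integral_congr_ae ?_
    filter_upwards [hL] with x hx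
    simp [hx, sq]
  change _ = _
  rw [h1, IsGaussian.charFunDual_eq, h2, integral_complex_ofReal, hγ L]
  simp

theorem map_eq_gaussianReal_of_mem_firstChaos (hγ : ∀ L : StrongDual ℝ E, ∫ x, L x ∂γ = 0)
    {w : Lp ℝ 2 γ} (hw : w ∈ firstChaos γ) :
    γ.map w = gaussianReal 0 (‖w‖₊ ^ 2) := by
  have hm : AEMeasurable w γ := (Lp.aestronglyMeasurable w).aemeasurable
  have : IsProbabilityMeasure (γ.map w) := Measure.isProbabilityMeasure_map hm
  refine Measure.ext_of_charFun (funext fun t => ?_)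
  rw [charFun_gaussianReal, charFun_apply_real, integral_map hm (by fun_prop)]
  have h1 := integral_cexp_of_mem_firstChaos hγ (Submodule.smul_mem _ t hw)
  have h2 : ∫ x, Complex.exp (((t • w) x : ℂ) * Complex.I) ∂γ =
      ∫ x, Complex.exp (t * w x * Complex.I) ∂γ := by
    refine integral_congr_ae ?_
    filter_upwards [Lp.coeFn_smul t w] with x hx
    rw [hx, Pi.smul_apply, smul_eq_mul, Complex.ofReal_mul]
  rw [← h2, h1, norm_smul, mul_pow, Real.norm_eq_abs, sq_abs]
  congr 1
  push_cast
  ring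

omit [NormedAddCommGroup E] [NormedSpace ℝ E] [BorelSpace E] [IsGaussian γ] in
theorem ae_eq_sum_smul {N : ℕ} (r : Fin N → Lp ℝ 2 γ) (c : Fin N → ℝ) :
    (∑ i, c i • r i : Lp ℝ 2 γ) =ᵐ[γ] fun x => ∑ i, c i * r i x := by
  have h1 := Lp.coeFn_finsetSum Finset.univ fun i => c i • r i
  filter_upwards [h1, ae_all_iff.2 fun i => Lp.coeFn_smul (c i) (r i)] with x h1 h2
  rw [h1, Finset.sum_apply]
  exact Finset.sum_congr rfl fun i _ => by rw [h2 i, Pi.smul_apply, smul_eq_mul]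

/-- Within the first chaos, orthogonality implies independence. -/
theorem indepFun_of_mem_firstChaos (hγ : ∀ L : StrongDual ℝ E, ∫ x, L x ∂γ = 0) {N : ℕ}
    {r : Fin N → Lp ℝ 2 γ} {w : Lp ℝ 2 γ} (hr : ∀ i, r i ∈ firstChaos γ) (hw : w ∈ firstChaos γ)
    (h0 : ∀ i, inner ℝ (r i) w = 0) : IndepFun (fun x i => r i x) w γ := by
  have hrm : AEMeasurable (fun x i => r i x) γ :=
    aemeasurable_pi_lambda _ fun i => (Lp.aestronglyMeasurable (r i)).aemeasurable
  have hwm : AEMeasurable w γ := (Lp.aestronglyMeasurable w).aemeasurable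
  rw [indepFun_iff_charFunDual_prod hrm hwm]
  intro L
  set c : Fin N → ℝ := fun i => L.comp (.inl ℝ (Fin N → ℝ) ℝ) (Pi.single i 1) with hc
  set t : ℝ := L.comp (.inr ℝ (Fin N → ℝ) ℝ) 1 with ht
  have h1 : (∑ i, c i • r i : Lp ℝ 2 γ) =ᵐ[γ]
      fun x => L.comp (.inl ℝ (Fin N → ℝ) ℝ) fun i => r i x := by
    filter_upwards [ae_eq_sum_smul r c] with x hx
    rw [hx, ← ContinuousLinearMap.coe_coe, LinearMap.pi_apply_eq_sum_univ
      (L.comp (.inl ℝ (Fin N → ℝ) ℝ) : (Fin N → ℝ) →ₗ[ℝ] ℝ)]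
    refine Finset.sum_congr rfl fun i _ => ?_
    have h : (fun j => if i = j then (1 : ℝ) else 0) = Pi.single i 1 := by
      ext j
      simp [Pi.single_apply, eq_comm]
    rw [smul_eq_mul, mul_comm, h]
    rfl
  have h2 : (t • w : Lp ℝ 2 γ) =ᵐ[γ] fun x => L.comp (.inr ℝ (Fin N → ℝ) ℝ) (w x) := by
    filter_upwards [Lp.coeFn_smul t w] with x hx
    have h : L.comp (.inr ℝ (Fin N → ℝ) ℝ) (w x • 1) = w x • t := map_smul _ _ _
    rw [hx, Pi.smul_apply, smul_eq_mul, mul_comm, ← smul_eq_mul, ← h, smul_eq_mul, mul_one]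
  have hu : (∑ i, c i • r i) ∈ firstChaos γ :=
    sum_mem fun i _ => Submodule.smul_mem _ _ (hr i)
  have hv : t • w ∈ firstChaos γ := Submodule.smul_mem _ _ hw
  have horth : inner ℝ (∑ i, c i • r i) (t • w) = 0 := by
    rw [sum_inner]
    exact Finset.sum_eq_zero fun i _ => by rw [inner_smul_left, inner_smul_right, h0]; simp
  have e1 : charFunDual (γ.map fun x i => r i x) (L.comp (.inl ℝ (Fin N → ℝ) ℝ)) =
      Complex.exp (-(‖∑ i, c i • r i‖ ^ 2 / 2 : ℝ)) := by
    rw [← integral_cexp_of_mem_firstChaos hγ hu, charFunDual_apply, integral_map hrm (by fun_prop)]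
    refine integral_congr_ae ?_
    filter_upwards [h1] with x hx
    rw [hx]
  have e2 : charFunDual (γ.map w) (L.comp (.inr ℝ (Fin N → ℝ) ℝ)) =
      Complex.exp (-(‖t • w‖ ^ 2 / 2 : ℝ)) := by
    rw [← integral_cexp_of_mem_firstChaos hγ hv, charFunDual_apply, integral_map hwm (by fun_prop)]
    refine integral_congr_ae ?_
    filter_upwards [h2] with x hx
    rw [hx]
  have e3 : charFunDual (γ.map fun x => ((fun i => r i x), w x)) L =
      Complex.exp (-(‖(∑ i, c i • r i) + t • w‖ ^ 2 / 2 : ℝ)) := by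
    rw [← integral_cexp_of_mem_firstChaos hγ (add_mem hu hv), charFunDual_apply,
      integral_map (hrm.prodMk hwm) (by fun_prop)]
    refine integral_congr_ae ?_
    filter_upwards [h1, h2, Lp.coeFn_add (∑ i, c i • r i) (t • w)] with x h1 h2 h3
    rw [h3, Pi.add_apply, h1, h2, ← L.comp_inl_add_comp_inr (fun i => r i x, w x)]
  rw [e1, e2, e3, ← Complex.exp_add, norm_add_sq_real, horth]
  congr 1
  push_cast
  ring

/-- Gaussian integration by parts for cylindrical functions. -/
theorem integral_mul_cylindrical (hγ : ∀ L : StrongDual ℝ E, ∫ x, L x ∂γ = 0) {N : ℕ}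
    {W : Fin N → Lp ℝ 2 γ} {w : Lp ℝ 2 γ} (hW : ∀ i, W i ∈ firstChaos γ) (hw : w ∈ firstChaos γ)
    {g : (Fin N → ℝ) → ℝ} (hg : IsCb1 g) :
    ∫ x, w x * g (fun i => W i x) ∂γ =
      ∫ x, fderiv ℝ g (fun i => W i x) (fun i => inner ℝ (W i) w) ∂γ := by
  obtain ⟨hgc, C, hC⟩ := hg
  rcases eq_or_ne w 0 with rfl | hw0
  · have h1 : (fun i => inner ℝ (W i) (0 : Lp ℝ 2 γ)) = 0 := funext fun i => inner_zero_right _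
    rw [h1]
    simp only [map_zero, integral_zero]
    rw [← integral_zero E ℝ (μ := γ)]
    refine integral_congr_ae ?_
    filter_upwards [Lp.coeFn_zero ℝ 2 γ] with x hx
    rw [hx, Pi.zero_apply, zero_mul]
  -- Split off from the `W i` their orthogonal projections `a i • w` onto the line through `w`.
  have hn : ‖w‖ ^ 2 ≠ 0 := pow_ne_zero _ (norm_ne_zero_iff.2 hw0)
  set a : Fin N → ℝ := fun i => inner ℝ (W i) w / ‖w‖ ^ 2 with ha
  have hv : (fun i => inner ℝ (W i) w) = ‖w‖ ^ 2 • a := by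
    ext i
    rw [ha, Pi.smul_apply, smul_eq_mul, mul_div_cancel₀ _ hn]
  set r : Fin N → Lp ℝ 2 γ := fun i => W i - a i • w with hr
  have hrm : ∀ i, r i ∈ firstChaos γ := fun i => sub_mem (hW i) (Submodule.smul_mem _ _ hw)
  have hr0 : ∀ i, inner ℝ (r i) w = 0 := by
    intro i
    rw [hr, inner_sub_left, inner_smul_left, real_inner_self_eq_norm_sq, ha, conj_trivial,
      div_mul_cancel₀ _ hn, sub_self]
  have hind := indepFun_of_mem_firstChaos hγ hrm hw hr0
  have hrM : AEMeasurable (fun x i => r i x) γ :=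
    aemeasurable_pi_lambda _ fun i => (Lp.aestronglyMeasurable (r i)).aemeasurable
  have hwM : AEMeasurable w γ := (Lp.aestronglyMeasurable w).aemeasurable
  rw [indepFun_iff_map_prod_eq_prod_map_map hrM hwM,
    map_eq_gaussianReal_of_mem_firstChaos hγ hw] at hind
  have hWr : ∀ᵐ x ∂γ, (fun i => W i x) = (fun i => r i x) + w x • a := by
    filter_upwards [ae_all_iff.2 fun i => Lp.coeFn_sub (W i) (a i • w),
      ae_all_iff.2 fun i => Lp.coeFn_smul (a i) w] with x h1 h2
    ext i
    rw [Pi.add_apply, hr, h1 i, Pi.sub_apply, h2 i]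
    simp only [Pi.smul_apply, smul_eq_mul]
    ring
  have hfc : Continuous (fderiv ℝ g) := hgc.continuous_fderiv one_ne_zero
  set ρ : Measure (Fin N → ℝ) := γ.map fun x i => r i x with hρ
  have : IsProbabilityMeasure ρ := Measure.isProbabilityMeasure_map hrM
  have htrans : ∀ F : (Fin N → ℝ) × ℝ → ℝ, Continuous F →
      Integrable F (ρ.prod (gaussianReal 0 (‖w‖₊ ^ 2))) →
      ∫ x, F (fun i => r i x, w x) ∂γ = ∫ y, ∫ s, F (y, s) ∂gaussianReal 0 (‖w‖₊ ^ 2) ∂ρ := by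
    intro F hF hFi
    rw [← integral_prod F hFi, ← hind, integral_map (hrM.prodMk hwM) hF.aestronglyMeasurable]
  have hbd : ∀ t, |fderiv ℝ g t a| ≤ C * ‖a‖ := fun t =>
    ((fderiv ℝ g t).le_opNorm a).trans (mul_le_mul_of_nonneg_right (hC t).2 (norm_nonneg _))
  have e1 : ∫ x, w x * g (fun i => W i x) ∂γ = ∫ x, w x * g ((fun i => r i x) + w x • a) ∂γ := by
    refine integral_congr_ae ?_
    filter_upwards [hWr] with x hx
    rw [hx]
  have e2 : ∫ x, fderiv ℝ g (fun i => W i x) (fun i => inner ℝ (W i) w) ∂γ =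
      ‖w‖ ^ 2 * ∫ x, fderiv ℝ g ((fun i => r i x) + w x • a) a ∂γ := by
    rw [hv, ← integral_const_mul]
    refine integral_congr_ae ?_
    filter_upwards [hWr] with x hx
    rw [hx, map_smul, smul_eq_mul]
  have hc1 : Continuous fun z : (Fin N → ℝ) × ℝ => z.2 * g (z.1 + z.2 • a) := by
    have := hgc.continuous
    fun_prop
  have hc2 : Continuous fun z : (Fin N → ℝ) × ℝ => fderiv ℝ g (z.1 + z.2 • a) a := by fun_prop
  have hi1 : Integrable (fun z : (Fin N → ℝ) × ℝ => z.2 * g (z.1 + z.2 • a))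
      (ρ.prod (gaussianReal 0 (‖w‖₊ ^ 2))) := by
    have h := ((memLp_id_gaussianReal (μ := 0) (v := ‖w‖₊ ^ 2) 1).integrable le_rfl).comp_snd ρ
    have hcg : Continuous fun z : (Fin N → ℝ) × ℝ => g (z.1 + z.2 • a) := by
      have := hgc.continuous
      fun_prop
    exact h.mul_bdd (c := C) hcg.aestronglyMeasurable
      (Filter.Eventually.of_forall fun z => (hC _).1)
  have hi2 : Integrable (fun z : (Fin N → ℝ) × ℝ => fderiv ℝ g (z.1 + z.2 • a) a)
      (ρ.prod (gaussianReal 0 (‖w‖₊ ^ 2))) :=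
    Integrable.of_bound hc2.aestronglyMeasurable (C * ‖a‖)
      (Filter.Eventually.of_forall fun z => hbd _)
  rw [e1, e2, htrans _ hc1 hi1, htrans _ hc2 hi2, ← integral_const_mul]
  refine integral_congr_ae (Filter.Eventually.of_forall fun y => ?_)
  have hder : ∀ s : ℝ, HasDerivAt (fun s : ℝ => g (y + s • a)) (fderiv ℝ g (y + s • a) a) s := by
    intro s
    have h1 : HasDerivAt (fun s : ℝ => y + s • a) a s := by
      simpa using ((hasDerivAt_id s).smul_const a).const_add y
    exact ((hgc.differentiable one_ne_zero _).hasFDerivAt).comp_hasDerivAt s h1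
  have h := integral_id_mul_gaussianReal (v := ‖w‖₊ ^ 2) (C := max C (C * ‖a‖))
    (pow_ne_zero _ (nnnorm_ne_zero_iff.2 hw0)) hder (by fun_prop)
    (fun s => (hC _).1.trans (le_max_left _ _)) (fun s => (hbd _).trans (le_max_right _ _))
  simpa using h

end GaussianIBP

/-! ### The Gaussian derivative -/

section GaussianDerivative

variable {E : Type*} [NormedAddCommGroup E] [NormedSpace ℝ E] [MeasurableSpace E] [BorelSpace E]
  {γ : Measure E} [IsGaussian γ]

/-- A continuous linear functional, as an element of `L²(γ)`. -/
def dualLp (γ : Measure E) [IsGaussian γ] (L : StrongDual ℝ E) : Lp ℝ 2 γ :=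
  (IsGaussian.memLp_dual γ L 2 (by simp)).toLp _

theorem coeFn_dualLp (L : StrongDual ℝ E) : dualLp γ L =ᵐ[γ] L := MemLp.coeFn_toLp _

theorem dualLp_mem_firstChaos (L : StrongDual ℝ E) : dualLp γ L ∈ firstChaos γ :=
  Submodule.le_topologicalClosure _ (Submodule.subset_span ⟨L, coeFn_dualLp L⟩)

theorem hasFDerivAt_tail_mul_head {N : ℕ} {g : (Fin N → ℝ) → ℝ} (hg : ContDiff ℝ 1 g) {c c' : ℝ → ℝ}
    (hc : ∀ s, HasDerivAt c (c' s) s) (t : Fin (N + 1) → ℝ) :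
    HasFDerivAt (fun t : Fin (N + 1) → ℝ => g (Fin.tail t) * c (t 0))
      (g (Fin.tail t) • c' (t 0) • ContinuousLinearMap.proj (R := ℝ) (φ := fun _ => ℝ) 0 +
        c (t 0) • (fderiv ℝ g (Fin.tail t)).comp (ContinuousLinearMap.pi fun i : Fin N =>
          ContinuousLinearMap.proj (R := ℝ) (φ := fun _ => ℝ) i.succ)) t := by
  set T : (Fin (N + 1) → ℝ) →L[ℝ] (Fin N → ℝ) := ContinuousLinearMap.pi fun i : Fin N =>
    ContinuousLinearMap.proj (R := ℝ) (φ := fun _ => ℝ) i.succ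
  have h1 : HasFDerivAt (fun t : Fin (N + 1) → ℝ => g (T t)) ((fderiv ℝ g (T t)).comp T) t :=
    (hg.differentiable one_ne_zero _).hasFDerivAt.comp t T.hasFDerivAt
  have h2 : HasFDerivAt (fun t : Fin (N + 1) → ℝ => c (t 0))
      (c' (t 0) • ContinuousLinearMap.proj (R := ℝ) (φ := fun _ => ℝ) 0) t :=
    (hc (t 0)).comp_hasFDerivAt t
      (ContinuousLinearMap.proj (R := ℝ) (φ := fun _ : Fin (N + 1) => ℝ) 0).hasFDerivAt
  exact h1.mul h2

theorem IsCb1.tail_mul_head {N : ℕ} {g : (Fin N → ℝ) → ℝ} (hg : IsCb1 g) {c c' : ℝ → ℝ}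
    (hc : ∀ s, HasDerivAt c (c' s) s) (hc' : Continuous c') (h1 : ∀ s, |c s| ≤ 1)
    (h1' : ∀ s, |c' s| ≤ 1) :
    IsCb1 fun t : Fin (N + 1) → ℝ => g (Fin.tail t) * c (t 0) := by
  obtain ⟨hgc, C, hC⟩ := hg
  have hC0 : 0 ≤ C := (abs_nonneg _).trans (hC 0).1
  have hcc : ContDiff ℝ 1 c := by
    rw [contDiff_one_iff_deriv]
    refine ⟨fun s => (hc s).differentiableAt, ?_⟩
    rwa [show deriv c = c' from funext fun s => (hc s).deriv]
  refine ⟨?_, C + C, fun t => ⟨?_, ?_⟩⟩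
  · refine (hgc.comp (g := g) (f := fun t : Fin (N + 1) → ℝ => Fin.tail t) ?_).mul
      (hcc.comp (g := c) (f := fun t : Fin (N + 1) → ℝ => t 0) (contDiff_apply ℝ ℝ 0))
    exact contDiff_pi.2 fun i => contDiff_apply ℝ ℝ i.succ
  · rw [abs_mul]
    nlinarith [hC (Fin.tail t), h1 (t 0), abs_nonneg (g (Fin.tail t)), abs_nonneg (c (t 0))]
  · rw [(hasFDerivAt_tail_mul_head hgc hc t).fderiv]
    refine ContinuousLinearMap.opNorm_le_bound _ (add_nonneg hC0 hC0) fun v => ?_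
    have htail : ‖Fin.tail v‖ ≤ ‖v‖ :=
      (pi_norm_le_iff_of_nonneg (norm_nonneg _)).2 fun i => norm_le_pi_norm v i.succ
    have e1 : ‖g (Fin.tail t) * (c' (t 0) * v 0)‖ ≤ C * (1 * ‖v‖) := by
      rw [norm_mul, norm_mul]
      gcongr
      · exact (hC _).1
      · exact h1' _
      · exact norm_le_pi_norm v 0
    have e2 : ‖c (t 0) * fderiv ℝ g (Fin.tail t) (Fin.tail v)‖ ≤ 1 * (C * ‖v‖) := by
      rw [norm_mul]
      gcongr
      · exact h1 _
      · refine (ContinuousLinearMap.le_opNorm _ _).trans ?_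
        gcongr
        exact (hC _).2
    calc _ = ‖g (Fin.tail t) * (c' (t 0) * v 0) +
          c (t 0) * fderiv ℝ g (Fin.tail t) (Fin.tail v)‖ := rfl
      _ ≤ _ := (norm_add_le _ _).trans (by linarith)

omit [NormedAddCommGroup E] [NormedSpace ℝ E] [BorelSpace E] [IsGaussian γ] in
theorem aestronglyMeasurable_lp_pi {N : ℕ} (W : Fin N → Lp ℝ 2 γ) :
    AEStronglyMeasurable (fun x i => W i x) γ :=
  (aemeasurable_pi_lambda _ fun i =>
    (Lp.aestronglyMeasurable (W i)).aemeasurable).aestronglyMeasurable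

/-- The divergence of `φ ⊗ h` for `φ = c (L x)` exists: by integration by parts it is
`φ φ_h - ⟪L, φ_h⟫ c' (L x)`. -/
theorem lpSmul_mem_adjointDomain_of_hasDerivAt (hγ : ∀ L : StrongDual ℝ E, ∫ x, L x ∂γ = 0)
    {c c' : ℝ → ℝ} (hc : ∀ s, HasDerivAt c (c' s) s) (hc' : Continuous c') (h1 : ∀ s, |c s| ≤ 1)
    (h1' : ∀ s, |c' s| ≤ 1) {L : StrongDual ℝ E} {φ : Lp ℝ 2 γ} (hφ : φ =ᵐ[γ] fun x => c (L x))
    (h : RKHS γ) : lpSmul γ φ h ∈ adjointDomain (gaussianGraph γ) := by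
  have hcc : Continuous c := continuous_iff_continuousAt.2 fun s => (hc s).continuousAt
  set w : Lp ℝ 2 γ := chaosIsometry γ h with hw
  set b : ℝ := inner ℝ (dualLp γ L) w with hb
  have hm1 : MemLp (fun x => c (L x) * w x) 2 γ := by
    refine (Lp.memLp w).mono ((by fun_prop : AEStronglyMeasurable (fun x => c (L x)) γ).mul
      (Lp.aestronglyMeasurable w)) (Filter.Eventually.of_forall fun x => ?_)
    rw [norm_mul]
    exact mul_le_of_le_one_left (norm_nonneg _) (h1 _)
  have hm2 : MemLp (fun x => c' (L x)) 2 γ :=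
    MemLp.of_bound (by fun_prop) 1 (Filter.Eventually.of_forall fun x => h1' _)
  refine mem_adjointDomain_span (hm1.toLp _ - b • hm2.toLp _) ?_
  rintro p ⟨N, g, k, hg, hp1, hp2⟩
  obtain ⟨hgc, C, hC⟩ := id hg
  set K : Fin N → Lp ℝ 2 γ := fun i => chaosIsometry γ (k i) with hK
  have hKm := aestronglyMeasurable_lp_pi K
  -- Integrate `φ_h g c` by parts, with the functional `L` as an additional zeroth variable.
  set W : Fin (N + 1) → Lp ℝ 2 γ := Fin.cons (dualLp γ L) K with hW
  have hWm : ∀ i, W i ∈ firstChaos γ := by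
    intro i
    refine Fin.cases ?_ (fun i => ?_) i
    · exact dualLp_mem_firstChaos L
    · exact (isChaosOf_chaosMap γ (k i)).1
  have hIBP := integral_mul_cylindrical hγ hWm (isChaosOf_chaosMap γ h).1
    (hg.tail_mul_head hc hc' h1 h1')
  have hi1 : Integrable (fun x => g (fun i => K i x) * c' (L x)) γ := by
    refine Integrable.of_bound ((hgc.continuous.comp_aestronglyMeasurable hKm).mul
      (by fun_prop)) (C * 1) (Filter.Eventually.of_forall fun x => ?_)
    rw [norm_mul]
    exact mul_le_mul (hC _).1 (h1' _) (abs_nonneg _) ((abs_nonneg _).trans (hC 0).1)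
  set v : Fin N → ℝ := fun i => inner ℝ (K i) w with hv
  have hi2 : Integrable (fun x => c (L x) * fderiv ℝ g (fun i => K i x) v) γ := by
    have hfc : Continuous fun t => fderiv ℝ g t v :=
      (hgc.continuous_fderiv one_ne_zero).clm_apply continuous_const
    refine Integrable.of_bound ((by fun_prop : AEStronglyMeasurable (fun x => c (L x)) γ).mul
      (hfc.comp_aestronglyMeasurable hKm)) (1 * (C * ‖v‖))
      (Filter.Eventually.of_forall fun x => ?_)
    rw [norm_mul]
    exact mul_le_mul (h1 _) ((ContinuousLinearMap.le_opNorm _ _).trans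
      (mul_le_mul_of_nonneg_right (hC _).2 (norm_nonneg _))) (norm_nonneg _) zero_le_one
  have hi3 : Integrable (fun x => g (fun i => K i x) * (c (L x) * w x)) γ :=
    (hm1.integrable one_le_two).bdd_mul (c := C) (hgc.continuous.comp_aestronglyMeasurable hKm)
      (Filter.Eventually.of_forall fun x => (hC _).1)
  have e1 : ∫ x, g (fun i => K i x) * (c (L x) * w x) ∂γ =
      b * ∫ x, g (fun i => K i x) * c' (L x) ∂γ +
        ∫ x, c (L x) * fderiv ℝ g (fun i => K i x) v ∂γ := by
    rw [← integral_const_mul, ← integral_add (hi1.const_mul b) hi2]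
    refine Eq.trans (integral_congr_ae ?_) (hIBP.trans (integral_congr_ae ?_))
    · filter_upwards [coeFn_dualLp (γ := γ) L] with x hx
      have e : (W 0 : Lp ℝ 2 γ) x = L x := hx
      rw [e]
      change _ = w x * (g (fun i => K i x) * c (L x))
      ring
    · filter_upwards [coeFn_dualLp (γ := γ) L] with x hx
      have e : (W 0 : Lp ℝ 2 γ) x = L x := hx
      rw [(hasFDerivAt_tail_mul_head hgc hc _).fderiv]
      change g (fun i => K i x) * (c' (W 0 x) * b) + c (W 0 x) * fderiv ℝ g (fun i => K i x) v = _
      rw [e]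
      ring
  have e2 : inner ℝ p.2 (lpSmul γ φ h) = ∫ x, c (L x) * fderiv ℝ g (fun i => K i x) v ∂γ := by
    rw [L2.inner_def]
    refine integral_congr_ae ?_
    filter_upwards [hp2, coeFn_lpSmul φ h, hφ] with x h2 h3 h4
    rw [h2, h3, h4, inner_smul_right, sum_inner]
    congr 1
    rw [← ContinuousLinearMap.coe_coe, LinearMap.pi_apply_eq_sum_univ
      (fderiv ℝ g (fun i => K i x) : (Fin N → ℝ) →ₗ[ℝ] ℝ) v]
    refine Finset.sum_congr rfl fun i _ => ?_
    have h : (fun j => if i = j then (1 : ℝ) else 0) = Pi.single i 1 := by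
      ext j
      simp [Pi.single_apply, eq_comm]
    rw [h, inner_smul_left, conj_trivial, mul_comm, smul_eq_mul, hv]
    congr 1
  have e3 : inner ℝ p.1 (hm1.toLp _ - b • hm2.toLp _) =
      ∫ x, g (fun i => K i x) * (c (L x) * w x) ∂γ - b * ∫ x, g (fun i => K i x) * c' (L x) ∂γ := by
    rw [inner_sub_right, inner_smul_right, L2.inner_def, L2.inner_def]
    congr 1
    · refine integral_congr_ae ?_
      filter_upwards [hp1, hm1.coeFn_toLp] with x h2 h3
      rw [h2, h3]
      simp [hK, mul_comm]
    · congr 1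
      refine integral_congr_ae ?_
      filter_upwards [hp1, hm2.coeFn_toLp] with x h2 h3
      rw [h2, h3]
      simp [hK, mul_comm]
  rw [e2, e3, e1]
  ring

theorem lpSmul_mem_adjointDomain (hγ : ∀ L : StrongDual ℝ E, ∫ x, L x ∂γ = 0) {φ : Lp ℝ 2 γ}
    (hφ : φ ∈ trigSet γ) (h : RKHS γ) : lpSmul γ φ h ∈ adjointDomain (gaussianGraph γ) := by
  obtain ⟨L, hL | hL⟩ := hφ
  · exact lpSmul_mem_adjointDomain_of_hasDerivAt hγ Real.hasDerivAt_cos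
      Real.continuous_sin.neg Real.abs_cos_le_one
      (fun s => by rw [abs_neg]; exact Real.abs_sin_le_one s) hL h
  · exact lpSmul_mem_adjointDomain_of_hasDerivAt hγ Real.hasDerivAt_sin
      Real.continuous_cos Real.abs_sin_le_one Real.abs_cos_le_one hL h

theorem dense_span_univ (V : Type*) [NormedAddCommGroup V] [NormedSpace ℝ V] :
    Dense (Submodule.span ℝ (Set.univ : Set V) : Set V) := by
  rw [Submodule.span_univ]
  exact dense_univ

theorem isClosableGraph_gaussianGraph (hγ : ∀ L : StrongDual ℝ E, ∫ x, L x ∂γ = 0)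
    (hd : Dense (Submodule.span ℝ (trigSet γ) : Set (Lp ℝ 2 γ))) :
    IsClosableGraph (gaussianGraph γ) := by
  have h1 := dense_span_lpSmul (V := RKHS γ) hd (dense_span_univ (RKHS γ))
  refine isClosableGraph_of_dense_adjointDomain (dense_of_span_dense_subset h1 ?_)
  rintro _ ⟨φ, hφ, h, -, rfl⟩
  exact lpSmul_mem_adjointDomain hγ hφ h

/-- The norm has a second moment under a Gaussian measure carried by a separable subspace, by
Fernique's theorem. -/
theorem IsCarriedBy.memLp_two_id [CompleteSpace E] {F : Submodule ℝ E} (hF : IsCarriedBy γ F) :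
    MemLp (fun x : E => x) 2 γ := by
  have := hF.secondCountable
  have : CompleteSpace F := hF.isClosed.completeSpace_coe
  have hrm := measurable_retract hF.isClosed
  have : IsGaussian (γ.map (retract F)) := by
    refine isGaussian_of_map_eq_gaussianReal fun L' => ?_
    obtain ⟨L, hL, -⟩ := exists_extension_norm_eq F L'
    refine ⟨_, _, Eq.trans ?_ (IsGaussian.map_eq_gaussianReal (μ := γ) L)⟩
    rw [Measure.map_map L'.continuous.measurable hrm]
    refine Measure.map_congr ?_
    filter_upwards [hF.ae_mem] with x hx
    rw [Function.comp_apply, ← hL, coe_retract hx]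
  have h1 : MemLp (fun y : F => (y : E)) 2 (γ.map (retract F)) :=
    F.subtypeL.comp_memLp' (IsGaussian.memLp_two_id (μ := γ.map (retract F)))
  have h2 := h1.comp_of_map hrm.aemeasurable
  refine h2.ae_eq ?_
  filter_upwards [hF.ae_mem] with x hx
  exact coe_retract hx

/-- Every continuous linear functional `L` is of the form `φ_h`, with `h = ∫ L(x) x dγ(x)`. -/
theorem exists_chaosIsometry_eq_dualLp [CompleteSpace E] {F : Submodule ℝ E}
    (hF : IsCarriedBy γ F) (L : StrongDual ℝ E) :
    ∃ h : RKHS γ, chaosIsometry γ h = dualLp γ L := by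
  have hint : Integrable (fun x => L x • x) γ :=
    memLp_one_iff_integrable.1 (MemLp.smul (p := 2) (q := 2) hF.memLp_two_id
      (IsGaussian.memLp_dual γ L 2 (by simp)))
  have hch : IsChaosOf γ (∫ x, L x • x ∂γ) (dualLp γ L) := by
    refine ⟨dualLp_mem_firstChaos L, fun M => ?_⟩
    rw [← M.integral_comp_comm hint]
    refine integral_congr_ae ?_
    filter_upwards [coeFn_dualLp (γ := γ) L] with x hx
    rw [hx, map_smul, smul_eq_mul]
  exact ⟨⟨_, _, hch⟩, (isChaosOf_chaosMap γ ⟨_, _, hch⟩).unique hch⟩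

theorem mem_gaussianDerivative_domain_of_hasDerivAt [CompleteSpace E] {F : Submodule ℝ E}
    (hF : IsCarriedBy γ F) {c c' : ℝ → ℝ} (hc : ∀ s, HasDerivAt c (c' s) s) (hc' : Continuous c')
    (h1 : ∀ s, |c s| ≤ 1) (h1' : ∀ s, |c' s| ≤ 1) {L : StrongDual ℝ E} {f : Lp ℝ 2 γ}
    (hf : f =ᵐ[γ] fun x => c (L x)) : f ∈ (gaussianDerivative γ).domain := by
  obtain ⟨h, hh⟩ := exists_chaosIsometry_eq_dualLp hF L
  have hm : MemLp (fun x => c' (L x)) 2 γ :=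
    MemLp.of_bound (by fun_prop) 1 (Filter.Eventually.of_forall fun x => h1' _)
  -- `c` itself is the product of the constant function of no variables with `c (t 0)`.
  have hone : IsCb1 fun _ : Fin 0 → ℝ => (1 : ℝ) :=
    ⟨contDiff_const, 1, fun t => by simp⟩
  refine mem_closedOperator_domain (p := (f, lpSmul γ (hm.toLp _) h)) (Submodule.subset_span
    ⟨1, _, fun _ => h, hone.tail_mul_head hc hc' h1 h1', ?_, ?_⟩)
  · filter_upwards [hf, coeFn_dualLp (γ := γ) L] with x e1 e2
    rw [hh, e1, e2, one_mul]
  · filter_upwards [coeFn_lpSmul (hm.toLp _) h, hm.coeFn_toLp, coeFn_dualLp (γ := γ) L]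
      with x e1 e2 e3
    rw [e1, e2, (hasFDerivAt_tail_mul_head hone.1 hc _).fderiv, hh, e3]
    simp

theorem trigSet_subset_gaussianDerivative_domain [CompleteSpace E] {F : Submodule ℝ E}
    (hF : IsCarriedBy γ F) {f : Lp ℝ 2 γ} (hf : f ∈ trigSet γ) :
    f ∈ (gaussianDerivative γ).domain := by
  obtain ⟨L, hL | hL⟩ := hf
  · exact mem_gaussianDerivative_domain_of_hasDerivAt hF Real.hasDerivAt_cos
      Real.continuous_sin.neg Real.abs_cos_le_one
      (fun s => by rw [abs_neg]; exact Real.abs_sin_le_one s) hL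
  · exact mem_gaussianDerivative_domain_of_hasDerivAt hF Real.hasDerivAt_sin
      Real.continuous_cos Real.abs_sin_le_one Real.abs_cos_le_one hL

end GaussianDerivative

/-! ### The operators on `L²(γ × π; 𝓗_n)` -/

section TensorOperators

theorem inner_eq_of_ae_eq_mul {α β V : Type*} [MeasurableSpace α] [MeasurableSpace β]
    [NormedAddCommGroup V] [InnerProductSpace ℝ V] {μ : Measure α} {ν : Measure β} [SFinite μ]
    [SFinite ν] {F F' : Lp V 2 (μ.prod ν)} (A : α → ℝ) (B : β → ℝ) (c : ℝ)
    (h : ∀ᵐ z ∂μ.prod ν, inner ℝ (F z) (F' z) = A z.1 * B z.2 * c) :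
    inner ℝ F F' = (∫ x, A x ∂μ) * (∫ y, B y ∂ν) * c := by
  rw [L2.inner_def, integral_congr_ae h, integral_mul_const, integral_prod_mul]

theorem inner_lpSmul_eq_zero {α V : Type*} [MeasurableSpace α] [NormedAddCommGroup V]
    [InnerProductSpace ℝ V] {μ : Measure α} {F : Lp V 2 μ} {a : α → ℝ} {b : α → V} {f : Lp ℝ 2 μ}
    {c : V} (hF : F =ᵐ[μ] fun z => a z • b z) (h : ∀ z, inner ℝ (b z) c = 0) :
    inner ℝ F (lpSmul μ f c) = 0 := by
  rw [L2.inner_def, ← integral_zero α ℝ (μ := μ)]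
  refine integral_congr_ae ?_
  filter_upwards [hF, coeFn_lpSmul f c] with z h1 h2
  rw [h1, h2, inner_smul_left, inner_smul_right, h, mul_zero, mul_zero]

theorem inner_lp_eq_integral_mul {α : Type*} [MeasurableSpace α] {μ : Measure α}
    (f g : Lp ℝ 2 μ) : inner ℝ f g = ∫ x, f x * g x ∂μ := by
  rw [L2.inner_def]
  exact integral_congr_ae (Filter.Eventually.of_forall fun x => by simp [mul_comm])

variable {E : Type*} [NormedAddCommGroup E] [NormedSpace ℝ E] [MeasurableSpace E] [BorelSpace E]
  {γ : Measure E} [IsGaussian γ] {π ν : Measure E} [IsProbabilityMeasure π]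

/-- If the divergence of `φ ⊗ h` exists, then the adjoint of `D_γ ⊗ I` is defined at
`φ ⊗ ψ ⊗ (h ⊗ ⋯ ⊗ h) ⊗ t`. -/
theorem lpSmul_mem_adjointDomain_gaussianTensorGraph (hG : IsClosableGraph (gaussianGraph γ))
    {φ : Lp ℝ 2 γ} {h : RKHS γ} (hφ : lpSmul γ φ h ∈ adjointDomain (gaussianGraph γ))
    (ψ : Lp ℝ 2 π) {n j k : ℕ} (hjk : j + k = n + 1) (t : SymPow (Lp ℝ 2 ν) k) :
    lpSmul (γ.prod π) (lpProd γ π φ ψ) (chaosTens j k hjk (symDiag h j) t) ∈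
      adjointDomain (gaussianTensorGraph γ π ν n) := by
  rw [← adjointDomain_topologicalClosure] at hφ
  obtain ⟨χ, hχ⟩ := hφ
  have hχ' : ∀ f : (gaussianDerivative γ).domain,
      ∫ x, φ x * inner ℝ (gaussianDerivative γ f x) h ∂γ = ∫ x, (f : Lp ℝ 2 γ) x * χ x ∂γ := by
    intro f
    rw [← inner_lp_eq_integral_mul]
    refine Eq.trans ?_ (hχ _ (closedOperator_apply_mem hG f))
    rw [L2.inner_def]
    refine integral_congr_ae ?_
    filter_upwards [coeFn_lpSmul φ h] with x hx
    rw [hx, inner_smul_right]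
    rfl
  rcases j with _ | i
  · refine mem_adjointDomain_span 0 ?_
    rintro p ⟨f, g, j', k', hjk', s, t', -, hp⟩
    rw [inner_zero_right]
    exact inner_lpSmul_eq_zero hp fun z => inner_chaosTens_of_ne _ _ (by omega) _ _ _ _
  · have hik : i + k = n := by omega
    refine mem_adjointDomain_span
      (lpSmul (γ.prod π) (lpProd γ π χ ψ) (chaosTens i k hik (symDiag h i) t)) ?_
    rintro p ⟨f, g, j', k', hjk', s, t', hp1, hp2⟩
    by_cases hji : j' = i
    · subst hji
      obtain rfl : k' = k := by omega
      rw [inner_eq_of_ae_eq_mul (fun x => φ x * inner ℝ (gaussianDerivative γ f x) h)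
          (fun y => g y * ψ y) (inner ℝ s (symDiag h j') * inner ℝ t' t) ?_,
        inner_eq_of_ae_eq_mul (fun x => (f : Lp ℝ 2 γ) x * χ x)
          (fun y => g y * ψ y) (inner ℝ s (symDiag h j') * inner ℝ t' t) ?_, hχ' f]
      · filter_upwards [hp1, coeFn_lpSmul (lpProd γ π χ ψ) (chaosTens j' k' hik (symDiag h j') t),
          coeFn_lpProd χ ψ] with z h1 h2 h3
        rw [h1, h2, h3, inner_smul_left, inner_smul_right, inner_chaosTens_self, conj_trivial]
        ring
      · filter_upwards [hp2, coeFn_lpSmul (lpProd γ π φ ψ)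
          (chaosTens (j' + 1) k' hjk (symDiag h (j' + 1)) t), coeFn_lpProd φ ψ] with z h1 h2 h3
        rw [h1, h2, h3, inner_smul_left, inner_smul_right, inner_chaosTens_self,
          inner_symMul_symDiag, conj_trivial]
        ring
    · rw [inner_lpSmul_eq_zero hp1 fun z => inner_chaosTens_of_ne _ _ hji _ _ _ _,
        inner_lpSmul_eq_zero hp2 fun z => inner_chaosTens_of_ne _ _ (by omega) _ _ _ _]

omit [NormedAddCommGroup E] [NormedSpace ℝ E] [BorelSpace E] in
/-- Pairing the curried derivative with `ψ ⊗ u`. -/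
theorem integral_mul_inner_curry [SFinite ν] {F : Lp ℝ 2 (π.prod ν)} {G : Lp (Lp ℝ 2 ν) 2 π}
    (hG : ∀ᵐ y ∂π, G y =ᵐ[ν] fun y' => F (y, y')) (ψ : Lp ℝ 2 π) (u : Lp ℝ 2 ν) :
    ∫ y, ψ y * inner ℝ (G y) u ∂π = inner ℝ F (lpProd π ν ψ u) := by
  have h1 : inner ℝ F (lpProd π ν ψ u) = ∫ z, F z * (ψ z.1 * u z.2) ∂π.prod ν := by
    rw [L2.inner_def]
    refine integral_congr_ae ?_
    filter_upwards [coeFn_lpProd ψ u] with z hz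
    rw [hz]
    simp only [RCLike.inner_apply, conj_trivial]
    ring
  have h2 : Integrable (fun z => F z * (ψ z.1 * u z.2)) (π.prod ν) := by
    refine ((Lp.memLp F).integrable_mul (Lp.memLp (lpProd π ν ψ u))).congr ?_
    filter_upwards [coeFn_lpProd ψ u] with z hz
    rw [Pi.mul_apply, hz]
  rw [h1, integral_prod _ h2]
  refine integral_congr_ae ?_
  filter_upwards [hG] with y hy
  rw [inner_lp_eq_integral_mul, ← integral_const_mul]
  refine integral_congr_ae ?_
  filter_upwards [hy] with y' hy'
  rw [hy']
  ring

/-- If the adjoint of `D_π` is defined at `ψ ⊗ u`, then the adjoint of `I ⊗ D_π` is defined at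
`φ ⊗ ψ ⊗ s ⊗ (u ⊗ ⋯ ⊗ u)`. -/
theorem lpSmul_mem_adjointDomain_poissonTensorGraph [SFinite ν]
    (hP : IsClosableGraph (poissonGraph π ν)) (φ : Lp ℝ 2 γ) {ψ : Lp ℝ 2 π} {u : Lp ℝ 2 ν}
    (hψ : lpProd π ν ψ u ∈ adjointDomain (poissonGraph π ν)) {n j k : ℕ} (hjk : j + k = n + 1)
    (s : SymPow (RKHS γ) j) :
    lpSmul (γ.prod π) (lpProd γ π φ ψ) (chaosTens j k hjk s (symDiag u k)) ∈
      adjointDomain (poissonTensorGraph γ π ν n) := by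
  rw [← adjointDomain_topologicalClosure] at hψ
  obtain ⟨χ, hχ⟩ := hψ
  have hχ' : ∀ (g : (poissonDerivative π ν).domain) (G : Lp (Lp ℝ 2 ν) 2 π),
      (∀ᵐ y ∂π, G y =ᵐ[ν] fun y' => poissonDerivative π ν g (y, y')) →
      ∫ y, ψ y * inner ℝ (G y) u ∂π = ∫ y, (g : Lp ℝ 2 π) y * χ y ∂π := by
    intro g G hG
    rw [integral_mul_inner_curry hG, ← inner_lp_eq_integral_mul]
    exact hχ _ (closedOperator_apply_mem hP g)
  rcases k with _ | i
  · refine mem_adjointDomain_span 0 ?_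
    rintro p ⟨f, g, G, j', k', hjk', s', t', -, -, hp⟩
    rw [inner_zero_right]
    exact inner_lpSmul_eq_zero hp fun z => inner_chaosTens_of_ne _ _ (by omega) _ _ _ _
  · have hij : j + i = n := by omega
    refine mem_adjointDomain_span
      (lpSmul (γ.prod π) (lpProd γ π φ χ) (chaosTens j i hij s (symDiag u i))) ?_
    rintro p ⟨f, g, G, j', k', hjk', s', t', hG, hp1, hp2⟩
    by_cases hji : j' = j
    · subst hji
      obtain rfl : k' = i := by omega
      rw [inner_eq_of_ae_eq_mul (fun x => f x * φ x) (fun y => ψ y * inner ℝ (G y) u)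
          (inner ℝ s' s * inner ℝ t' (symDiag u k')) ?_,
        inner_eq_of_ae_eq_mul (fun x => f x * φ x) (fun y => (g : Lp ℝ 2 π) y * χ y)
          (inner ℝ s' s * inner ℝ t' (symDiag u k')) ?_, hχ' g G hG]
      · filter_upwards [hp1, coeFn_lpSmul (lpProd γ π φ χ) (chaosTens j' k' hij s (symDiag u k')),
          coeFn_lpProd φ χ] with z h1 h2 h3
        rw [h1, h2, h3, inner_smul_left, inner_smul_right, inner_chaosTens_self, conj_trivial]
        ring
      · filter_upwards [hp2, coeFn_lpSmul (lpProd γ π φ ψ)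
          (chaosTens j' (k' + 1) hjk s (symDiag u (k' + 1))), coeFn_lpProd φ ψ] with z h1 h2 h3
        rw [h1, h2, h3, inner_smul_left, inner_smul_right, inner_chaosTens_self,
          inner_symMul_symDiag, conj_trivial]
        ring
    · rw [inner_lpSmul_eq_zero hp1 fun z => inner_chaosTens_of_ne _ _ hji _ _ _ _,
        inner_lpSmul_eq_zero hp2 fun z => inner_chaosTens_of_ne _ _ (by omega) _ _ _ _]

theorem exists_mem_gaussianTensorGraph {n : ℕ} (f : (gaussianDerivative γ).domain) (g : Lp ℝ 2 π)
    {j k : ℕ} (hjk : j + k = n) (s : SymPow (RKHS γ) j) (t : SymPow (Lp ℝ 2 ν) k)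
    {F : L2Chaos γ π ν n}
    (hF : F =ᵐ[γ.prod π] fun z => ((f : Lp ℝ 2 γ) z.1 * g z.2) • chaosTens j k hjk s t) :
    ∃ F', (F, F') ∈ gaussianTensorGraph γ π ν n := by
  set A : RKHS γ →L[ℝ] Chaos γ ν (n + 1) :=
    ((chaosTensL (RKHS γ) (Lp ℝ 2 ν) (j + 1) k (by omega)).flip t).comp (symMulL s)
  have hm := A.comp_memLp' (memLp_prod_smul (Lp.memLp (gaussianDerivative γ f)) (Lp.memLp g))
  refine ⟨hm.toLp _, Submodule.subset_span ⟨f, g, j, k, hjk, s, t, hF, ?_⟩⟩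
  filter_upwards [hm.coeFn_toLp] with z hz
  rw [hz, Function.comp_apply, map_smul]
  rfl

theorem exists_mem_poissonTensorGraph [SigmaFinite ν] {n : ℕ} (f : Lp ℝ 2 γ)
    (g : (poissonDerivative π ν).domain)
    {j k : ℕ} (hjk : j + k = n) (s : SymPow (RKHS γ) j) (t : SymPow (Lp ℝ 2 ν) k)
    {F : L2Chaos γ π ν n}
    (hF : F =ᵐ[γ.prod π] fun z => (f z.1 * (g : Lp ℝ 2 π) z.2) • chaosTens j k hjk s t) :
    ∃ F', (F, F') ∈ poissonTensorGraph γ π ν n := by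
  obtain ⟨G, hG⟩ := exists_curry (poissonDerivative π ν g)
  set A : Lp ℝ 2 ν →L[ℝ] Chaos γ ν (n + 1) :=
    (chaosTensL (RKHS γ) (Lp ℝ 2 ν) j (k + 1) (by omega) s).comp (symMulL t)
  have hm := A.comp_memLp' (memLp_prod_smul' (Lp.memLp f) (Lp.memLp G))
  refine ⟨hm.toLp _, Submodule.subset_span ⟨f, g, G, j, k, hjk, s, t, hG, hF, ?_⟩⟩
  filter_upwards [hm.coeFn_toLp] with z hz
  rw [hz, Function.comp_apply, map_smul]
  rfl

theorem naturalDomain_le_domain [SigmaFinite ν] (n : ℕ) :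
    naturalDomain γ π ν n ≤ (totalDerivative γ π ν n).domain := by
  refine Submodule.span_le.2 ?_
  rintro F ⟨f, g, j, k, hjk, s, t, hF⟩
  obtain ⟨F₁, h1⟩ := exists_mem_gaussianTensorGraph f (g : Lp ℝ 2 π) hjk s t hF
  obtain ⟨F₂, h2⟩ := exists_mem_poissonTensorGraph (f : Lp ℝ 2 γ) g hjk s t hF
  exact ⟨mem_closedOperator_domain h1, mem_closedOperator_domain h2⟩

theorem dense_span_lpSmul_lpProd_chaosTens {S : Set (Lp ℝ 2 γ)} {T : Set (Lp ℝ 2 π)}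
    {V : Set (Lp ℝ 2 ν)} (hS : Dense (Submodule.span ℝ S : Set (Lp ℝ 2 γ)))
    (hT : Dense (Submodule.span ℝ T : Set (Lp ℝ 2 π))) (hV : Dense V) (n : ℕ)
    {M : Submodule ℝ (L2Chaos γ π ν n)}
    (hM : ∀ φ ∈ S, ∀ ψ ∈ T, ∀ (j k : ℕ) (hjk : j + k = n) (h : RKHS γ), ∀ u ∈ V,
      lpSmul (γ.prod π) (lpProd γ π φ ψ) (chaosTens j k hjk (symDiag h j) (symDiag u k)) ∈ M) :
    Dense (M : Set (L2Chaos γ π ν n)) := by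
  refine dense_of_span_dense_subset (dense_span_lpSmul (V := Chaos γ ν n)
    (dense_span_lpProd hS hT) (dense_span_chaosTens (dense_univ (X := RKHS γ)) hV n)) ?_
  rintro _ ⟨_, ⟨φ, hφ, ψ, hψ, rfl⟩, _, ⟨j, k, hjk, h, -, u, hu, rfl⟩, rfl⟩
  exact hM φ hφ ψ hψ j k hjk h u hu

/-- If the domains contain total sets, the natural domain is dense. -/
theorem dense_naturalDomain {S : Set (Lp ℝ 2 γ)} {T : Set (Lp ℝ 2 π)}
    (hS : Dense (Submodule.span ℝ S : Set (Lp ℝ 2 γ)))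
    (hT : Dense (Submodule.span ℝ T : Set (Lp ℝ 2 π)))
    (hSd : ∀ f ∈ S, f ∈ (gaussianDerivative γ).domain)
    (hTd : ∀ g ∈ T, g ∈ (poissonDerivative π ν).domain) (n : ℕ) :
    Dense (naturalDomain γ π ν n : Set (L2Chaos γ π ν n)) := by
  refine dense_span_lpSmul_lpProd_chaosTens hS hT dense_univ n ?_
  intro φ hφ ψ hψ j k hjk h u _
  refine Submodule.subset_span ⟨⟨φ, hSd φ hφ⟩, ⟨ψ, hTd ψ hψ⟩, j, k, hjk, symDiag h j,
    symDiag u k, ?_⟩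
  filter_upwards [coeFn_lpSmul (lpProd γ π φ ψ) (chaosTens j k hjk (symDiag h j) (symDiag u k)),
    coeFn_lpProd φ ψ] with z h1 h2
  rw [h1, h2]

end TensorOperators

end SecondQuantisation

end

theorem mainTheorem4 {E : Type*} [NormedAddCommGroup E] [NormedSpace ℝ E] [CompleteSpace E]
    [MeasurableSpace E] [BorelSpace E]
    (γ : Measure E) [IsGaussian γ] [γ.InnerRegular]
    (hγ : ∀ L : StrongDual ℝ E, ∫ x, L x ∂γ = 0)
    (ξ : E) (ν : Measure E) (hν : IsLevyMeasure ν)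
    (π : Measure E) (hπ : π = jumpMeasure ξ ν) (n : ℕ) :
    IsClosableGraph (gaussianGraph γ) ∧
    IsClosableGraph (poissonGraph π ν) ∧
    IsClosableGraph (gaussianTensorGraph γ π ν n) ∧
    IsClosableGraph (poissonTensorGraph γ π ν n) ∧
    naturalDomain γ π ν n ≤
      (totalDerivative γ π ν n).domain ∧
    Dense (naturalDomain γ π ν n : Set (L2Chaos γ π ν n)) ∧
    Dense ((totalDerivative γ π ν n).domain : Set (L2Chaos γ π ν n)) ∧
    (totalDerivative γ π ν n).IsClosable := by
  subst hπ
  obtain ⟨F, hγF, hνF, hπF⟩ := hν.exists_carrier ξ γ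
  have := hν.sigmaFinite
  have := hν.isProbabilityMeasure_jumpMeasure ξ
  have hM := hν.isMeckePair ξ hνF hπF
  have hS := hγF.dense_span_trigSet
  have hT := hπF.dense_span_trigSet
  have hG := isClosableGraph_gaussianGraph hγ hS
  have hP := hM.isClosableGraph_poissonGraph hT
  -- The common test vectors of `D_γ ⊗ I` and `I ⊗ D_π` are dense.
  have htest : Dense ((adjointDomain (gaussianTensorGraph γ (jumpMeasure ξ ν) ν n) ⊓
      adjointDomain (poissonTensorGraph γ (jumpMeasure ξ ν) ν n) : Submodule ℝ _) :
        Set (L2Chaos γ (jumpMeasure ξ ν) ν (n + 1))) := by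
    refine dense_span_lpSmul_lpProd_chaosTens hS hT (dense_boundedAway hM.ae_ne_zero) (n + 1) ?_
    intro φ hφ ψ hψ j k hjk h u hu
    exact ⟨lpSmul_mem_adjointDomain_gaussianTensorGraph hG
        (lpSmul_mem_adjointDomain hγ hφ h) ψ hjk _,
      lpSmul_mem_adjointDomain_poissonTensorGraph hP φ
        (hM.lpProd_mem_adjointDomain (ae_abs_le_one_of_mem_trigSet hψ) hu) hjk _⟩
  have hGn := isClosableGraph_of_dense_adjointDomain (htest.mono fun _ h => h.1)
  have hPn := isClosableGraph_of_dense_adjointDomain (htest.mono fun _ h => h.2)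
  have hle := naturalDomain_le_domain (γ := γ) (π := jumpMeasure ξ ν) (ν := ν) n
  have hd := dense_naturalDomain hS hT
    (fun f hf => trigSet_subset_gaussianDerivative_domain hγF hf)
    (fun g hg => hν.trigSet_subset_domain hg) n
  exact ⟨hG, hP, hGn, hPn, hle, hd, hd.mono hle, isClosable_closedOperator_add hGn hPn htest⟩
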